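/- Let $d\ge 1$ and let $\xi=\{\xi(x,t): x\in\mathbb Z^d,\ t\ge 0\}$ be a real random field on a probability space $(\Omega,\mathcal F,\mathbb P)$, with $(t,\omega)\mapsto\xi(x,t)(\omega)$ measurable for each $x$. Assume that $\xi$ is stationary and ergodic under translations in space and time (the law of $\xi$ is invariant under all translations by elements of $\mathbb Z^d\times[0,\infty)$, and every event invariant, up to null sets, under all of them has probability $0$ or $1$), that $\xi$ is not constant, and that $\xi(0,0)$ is integrable. For $\kappa,\gamma\in[0,\infty)$ let $u$ be the solution of the parabolic Anderson model $$\frac{\partial}{\partial t}u(x,t)=\kappa\Delta u(x,t)+\gamma\,\xi(x,t)\,u(x,t),\qquad u(x,0)=\delta_0(x),\qquad x\in\mathbb Z^d,\ t\ge 0,$$ with $\Delta u(x,t)=\sum_{\|y-x\|=1}[u(y,t)-u(x,t)]$, given by the Feynman–Kac formula $$u(x,t)=\mathrm E_x\Big(\exp\Big[\gamma\int_0^t\xi\big(X^\kappa(s),t-s\big)\,ds\Big]\,\delta_0\big(X^\kappa(t)\big)\Big)\in[0,\infty],$$ where $X^\kappa$ is simple random walk on $\mathbb Z^d$ stepping at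 rate $2d\kappa$ and independent of $\xi$. Assume the growth bound: for all $\kappa,\gamma\in[0,\infty)$ there is $c=c(\kappa,\gamma)<\infty$ such that $\mathbb E(\log u(0,t))\le ct$ for all $t\ge 0$. Then for every $\kappa\in[0,\infty)$ and $\gamma\in(0,\infty)$: $\mathbb P$-a.s., $0<u(0,t)<\infty$ for all $t\ge0$, and the limit $$\lambda_0=\lim_{t\to\infty}\frac1t\log u(0,t)$$ exists $\mathbb P$-a.s. and in $\mathbb P$-mean (i.e. in $L^1(\mathbb P)$), and is finite and integrable. Moreover, $\lambda_0$ is $\mathbb P$-a.s. equal to a deterministic constant if $\kappa>0$, or if $\xi$ is ergodic already under the translations in time alone (every event invariant, up to null sets, under all time translations has probability $0$ or $1$). -/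

import Mathlib

open MeasureTheory ProbabilityTheory Filter Topology
open scoped NNReal ENNReal

namespace PAM

/-- The lattice `ℤ^d`. -/
abbrev Lattice (d : ℕ) : Type := Fin d → ℤ

/-! ### Continuous-time simple random walk, built from its jump chain and its holding times -/

/-- The nearest-neighbour step `± e_i`, labelled by the direction `i` and a sign. -/
def step {d : ℕ} (a : Fin d × Bool) : Lattice d :=
  Pi.single a.1 (if a.2 then 1 else -1)

/-- Sample space of the walk: for each `n`, the `n`-th holding time (before the change of time
scale) and the label of the `n`-th jump. -/
abbrev WalkSpace (d : ℕ) : Type := ℕ → ℝ × (Fin d × Bool)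

/-- Law of one holding time together with one jump: a rate-one exponential time and, independently,
one of the `2d` nearest-neighbour steps chosen uniformly. -/
noncomputable def stepLaw (d : ℕ) : Measure (ℝ × (Fin d × Bool)) :=
  (expMeasure 1).prod (uniformOn Set.univ)

instance (d : ℕ) [NeZero d] : IsProbabilityMeasure (stepLaw d) := by
  have : IsProbabilityMeasure (expMeasure 1) := isProbabilityMeasure_expMeasure one_pos
  unfold stepLaw
  infer_instance

/-- The probability measure on the sample space: the pairs (holding time, jump) are i.i.d. -/
noncomputable def walkLaw (d : ℕ) [NeZero d] : Measure (WalkSpace d) :=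
  Measure.infinitePi (fun _ : ℕ => stepLaw d)

/-- The rate-one Poisson process with the given holding times: `jumpCount w r` is the number of
jumps up to time `r`, i.e. the least `n` such that the `(n+1)`-st jump occurs after time `r`. -/
noncomputable def jumpCount {d : ℕ} (w : WalkSpace d) (r : ℝ) : ℕ :=
  sInf {n : ℕ | r < ∑ i ∈ Finset.range (n + 1), (w i).1}

/-- Simple random walk `X^κ` on `ℤ^d` started at `0` and stepping at rate `2dκ`
(jumping to each of the `2d` neighbours at rate `κ`). -/
noncomputable def walk {d : ℕ} (κ : ℝ) (w : WalkSpace d) (s : ℝ) : Lattice d :=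
  ∑ i ∈ Finset.range (jumpCount w (2 * d * κ * s)), step (w i).2

/-! ### The solution of the parabolic Anderson model -/

section Solution

variable {Ω : Type*} {d : ℕ} [NeZero d]

/-- The solution `u(x,t)` of `∂u/∂t = κ Δ u + γ ξ u`, `u(·,0) = δ_0`, in the environment
`ξ(·,·,ω)`, given by the Feynman-Kac formula
`u(x,t) = E_x ( exp [γ ∫_0^t ξ(X^κ(s), t-s) ds] δ_0(X^κ(t)) )`, with values in `[0,∞]`. -/
noncomputable def solution (ξ : Lattice d → ℝ≥0 → Ω → ℝ) (κ γ : ℝ)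
    (x : Lattice d) (t : ℝ) (ω : Ω) : ℝ≥0∞ :=
  ∫⁻ w, ENNReal.ofReal
      (Real.exp (γ * ∫ s in (0 : ℝ)..t, ξ (x + walk κ w s) (t - s).toNNReal ω)
        * (if x + walk κ w t = 0 then 1 else 0)) ∂(walkLaw d)

/-- `Λ_0(t) = (1/t) log u(0,t)`. -/
noncomputable def growthRate (ξ : Lattice d → ℝ≥0 → Ω → ℝ) (κ γ t : ℝ) (ω : Ω) : ℝ :=
  1 / t * Real.log (solution ξ κ γ 0 t ω).toReal

end Solution

/-! ### The random environment -/

section Environment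

variable {Ω : Type*} [MeasurableSpace Ω] {d : ℕ}

/-- The space-time index set `ℤ^d × [0,∞)`. -/
abbrev SpaceTime (d : ℕ) : Type := Lattice d × ℝ≥0

/-- The space-time translation `(T_z f)(p) = f(p + z)` of real fields on `ℤ^d × [0,∞)`. -/
def shift (z : SpaceTime d) (f : SpaceTime d → ℝ) : SpaceTime d → ℝ :=
  fun p => f (p + z)

/-- The law of the random field `ξ`, on the product `σ`-algebra. -/
noncomputable def fieldLaw (P : Measure Ω) (ξ : Lattice d → ℝ≥0 → Ω → ℝ) :
    Measure (SpaceTime d → ℝ) :=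
  P.map (fun ω p => ξ p.1 p.2 ω)

/-- The law `μ` of a field is invariant under all translations in space and time. -/
def IsStationary (μ : Measure (SpaceTime d → ℝ)) : Prop :=
  ∀ z : SpaceTime d, μ.map (shift z) = μ

/-- Ergodicity of the law `μ` of a field under the translations in `S`: every event which, up to
`μ`-null sets, is invariant under each of these translations has probability zero or one. -/
def IsErgodicUnder (S : Set (SpaceTime d)) (μ : Measure (SpaceTime d → ℝ)) : Prop :=
  ∀ A : Set (SpaceTime d → ℝ), MeasurableSet A →
    (∀ z ∈ S, shift z ⁻¹' A =ᵐ[μ] A) → μ A = 0 ∨ μ A = 1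

/-- The standing assumptions on the environment: a (jointly measurable in time and chance) real
random field which is stationary and ergodic under translations in space and time, is not
constant, and has a finite mean `ρ = E ξ(0,0)`. -/
structure IsEnvironment (P : Measure Ω) (ξ : Lattice d → ℝ≥0 → Ω → ℝ) : Prop where
  measurable : ∀ x, Measurable (fun p : ℝ≥0 × Ω => ξ x p.1 p.2)
  stationary : IsStationary (fieldLaw P ξ)
  ergodic : IsErgodicUnder Set.univ (fieldLaw P ξ)
  not_constant : ¬ ∃ c : ℝ, ∀ x t, ∀ᵐ ω ∂P, ξ x t ω = c
  integrable : Integrable (ξ 0 0) P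

/-- The set of pure time translations. -/
def timeTranslations (d : ℕ) : Set (SpaceTime d) := {z | z.1 = 0}

/-- The expectation `E(f⁺) - E(f⁻)` of an extended-real random variable. -/
noncomputable def expectation (P : Measure Ω) (f : Ω → EReal) : EReal :=
  ((∫⁻ ω, (f ω).toENNReal ∂P : ℝ≥0∞) : EReal) - ((∫⁻ ω, (-f ω).toENNReal ∂P : ℝ≥0∞) : EReal)

/-- The growth bound: for all `κ, γ ∈ [0,∞)` there is `c < ∞` with
`E (log u(0,t)) ≤ c t` for all `t ≥ 0` (here `log 0 = -∞` and `log ∞ = ∞`). -/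
def GrowthBound [NeZero d] (P : Measure Ω) (ξ : Lattice d → ℝ≥0 → Ω → ℝ) : Prop :=
  ∀ κ γ : ℝ, 0 ≤ κ → 0 ≤ γ → ∃ c : ℝ, ∀ t : ℝ, 0 ≤ t →
    expectation P (fun ω => ENNReal.log (solution ξ κ γ 0 t ω)) ≤ ((c * t : ℝ) : EReal)

end Environment

end PAM

/-!
The proof treats `n ↦ log u(0, n)` as a superadditive process over the time translations of the
environment and applies Kingman's theorem to it.

Forcing the walk to visit a site at an intermediate time gives
`u(x, z; s + t) ≥ u_t(x, y; s) u(y, z; t)` for the fundamental solutions, where `u_t` lives in the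
environment shifted by time `t`; this is the Markov property of the walk (`markov`), in the form
`feynmanKac_mul_le` and `fundamental_mul_le`. Letting the walk rest at the origin bounds
`log u(0,n)` from below by minus a Birkhoff sum of the integrable function `restCost`
(`exp_neg_sum_restCost_le`). With the growth bound on `E (log u(0,t))` this shows that `u(0,n)` is
almost surely finite and that `log u(0,n)` plus the Birkhoff sum is a nonnegative superadditive
process with linearly bounded means (`growth_of_expectation_le`). Positivity of `u(0,t)` is the
resting strategy again, and finiteness at real times follows from finiteness at integers by
superadditivity.

Kingman's theorem (`kingman`) gives the limit along the integers, almost surely and in mean. It is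
proved for nonnegative processes by the Katznelson-Weiss covering argument
(`birkhoffSum_le_of_superadditive`) and reduced to them by subtracting an additive process.
Between `n` and `n + 1` the resting strategy controls the change of `log u(0,t)` by a stationary
integrable sequence, which is `o(n)` almost surely and `O(1)` in mean; so the limit exists along
real times.

The assumptions of stationarity and ergodicity concern the law of the field on the product
`σ`-algebra, whereas time integrals of `ξ` are measurable only with respect to `P`. The notion
`IsCovariant` bridges this: integrals of functionals of the sample path agree almost surely with a
measurable function of the sample path, the same one for all translates of the field
(`IsCovariant.lintegral`). Hence the limit is `Λ(ξ)` for a measurable functional `Λ` of the path.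

Superadditivity gives `Λ ∘ shift z ≤ Λ` almost surely when `z` is a time translation, and, if
`κ > 0`, also when `z = (e, 1)` with `e` a unit vector, because the walk reaches `e` in unit time
at a cost that is `o(n)`. As `Λ` and `Λ ∘ shift z` have the same integral, they are almost surely
equal (`ae_eq_comp_of_ae_le`). So `Λ` is invariant under all time translations, and under all
translations if `κ > 0` (`comp_shift_ae_eq_of_step`), and ergodicity makes it constant.
-/

namespace PAM

/-! ### Superadditive ergodic theorem -/

section Ergodic

variable {X : Type*}

/-- The covering argument of Katznelson and Weiss. Outside the bad set `B` some block of length at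
most `N` starting at `x` satisfies `l * G x ≤ h l x + l * ε`. The orbit is cut into such blocks
and into single points of `B`, and the blocks are joined by superadditivity; the last, incomplete
block costs at most `N * M`. -/
theorem birkhoffSum_le_of_superadditive {T : X → X} {h : ℕ → X → ℝ≥0∞} {G : X → ℝ≥0∞}
    {B S : Set X} {N : ℕ} {M ε : ℝ≥0∞} (hS : ∀ x ∈ S, T x ∈ S)
    (hsup : ∀ x ∈ S, ∀ m n, h m x + h n (T^[m] x) ≤ h (m + n) x)
    (hG : ∀ x ∈ S, G (T x) ≤ G x) (hM : ∀ x, G x ≤ M)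
    (hB : ∀ x ∈ S, x ∉ B → ∃ l, 1 ≤ l ∧ l ≤ N ∧ l * G x ≤ h l x + l * ε) (n : ℕ) :
    ∀ x ∈ S, birkhoffSum T G n x
      ≤ h n x + birkhoffSum T (fun y => B.indicator (fun _ => M) y + ε) n x + N * M := by
  have hSi : ∀ k, ∀ x ∈ S, T^[k] x ∈ S := by
    intro k
    induction k with
    | zero => simp
    | succ k ih => intro x hx; rw [Function.iterate_succ_apply]; exact ih _ (hS x hx)
  have hGi : ∀ k, ∀ x ∈ S, G (T^[k] x) ≤ G x := by
    intro k
    induction k with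
    | zero => simp
    | succ k ih =>
      intro x hx
      rw [Function.iterate_succ_apply]
      exact (ih _ (hS x hx)).trans (hG x hx)
  induction n using Nat.strong_induction_on with
  | _ n ih =>
  intro x hx
  by_cases hn : n ≤ N
  · calc birkhoffSum T G n x ≤ ∑ k ∈ Finset.range n, M := Finset.sum_le_sum fun k _ => hM _
      _ = n * M := by simp
      _ ≤ N * M := by gcongr
      _ ≤ _ := le_add_self
  -- It suffices to find an initial block of length `l` on which the inequality holds.
  have key : ∀ l, 1 ≤ l → l ≤ n → birkhoffSum T G l x ≤ h l x +
      birkhoffSum T (fun y => B.indicator (fun _ => M) y + ε) l x →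
      birkhoffSum T G n x
      ≤ h n x + birkhoffSum T (fun y => B.indicator (fun _ => M) y + ε) n x + N * M := by
    intro l hl1 hl2 hl
    obtain ⟨k, rfl⟩ := Nat.exists_eq_add_of_le hl2
    rw [birkhoffSum_add, birkhoffSum_add]
    have h1 := ih k (by omega) _ (hSi l x hx)
    calc _ ≤ _ := add_le_add hl h1
      _ = (h l x + h k (T^[l] x)) +
          (birkhoffSum T (fun y => B.indicator (fun _ => M) y + ε) l x +
            birkhoffSum T (fun y => B.indicator (fun _ => M) y + ε) k (T^[l] x)) + N * M := by
        simp only [add_assoc, add_left_comm]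
      _ ≤ _ := by gcongr; exact hsup x hx l k
  push Not at hn
  by_cases hxB : x ∈ B
  · refine key 1 le_rfl (by omega) ?_
    simp only [birkhoffSum_one, Set.indicator_of_mem hxB]
    exact (hM x).trans (le_self_add.trans le_add_self)
  · obtain ⟨l, hl1, hl2, hl⟩ := hB x hx hxB
    refine key l hl1 (by omega) ?_
    calc birkhoffSum T G l x ≤ ∑ k ∈ Finset.range l, G x :=
          Finset.sum_le_sum fun k _ => hGi k x hx
      _ = l * G x := by simp
      _ ≤ h l x + l * ε := hl
      _ = h l x + ∑ k ∈ Finset.range l, ε := by simp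
      _ ≤ _ := by
        gcongr
        exact Finset.sum_le_sum fun k _ => le_add_self

/-- Superadditivity along the `m` decompositions of the orbit into blocks of length `m`, one for
each residue class of starting points. -/
theorem birkhoffSum_le_mul_of_superadditive {T : X → X} {h : ℕ → X → ℝ≥0∞} {x : X}
    (hsup : ∀ m n, h m x + h n (T^[m] x) ≤ h (m + n) x) {m : ℕ} (hm : 0 < m) (n : ℕ) :
    birkhoffSum T (h m) n x ≤ m * h (n + m) x := by
  have h1 : birkhoffSum T (h m) n x ≤ ∑ j ∈ Finset.range m, h (n + j) x := by
    induction n with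
    | zero => simp
    | succ n ih =>
      rw [birkhoffSum_succ]
      have h2 : h n x + ∑ j ∈ Finset.range m, h (n + 1 + j) x
          = ∑ j ∈ Finset.range m, h (n + j) x + h (n + m) x := by
        rw [← Finset.sum_range_succ, Finset.sum_range_succ', add_zero, add_comm]
        simp only [add_assoc, add_comm 1]
      by_cases htop : h n x = ∞
      · have h3 : h (n + 1) x = ∞ := top_le_iff.1 (htop ▸ le_self_add.trans (hsup n 1))
        refine le_top.trans_eq (Eq.symm (ENNReal.sum_eq_top.2 ⟨0, Finset.mem_range.2 hm, ?_⟩))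
        simpa using h3
      · refine (ENNReal.add_le_add_iff_left htop).1 ?_
        rw [h2]
        calc _ = birkhoffSum T (h m) n x + (h n x + h m (T^[n] x)) := by
              simp only [add_left_comm]
          _ ≤ _ := add_le_add ih (hsup n m)
  refine h1.trans ?_
  calc ∑ j ∈ Finset.range m, h (n + j) x ≤ ∑ j ∈ Finset.range m, h (n + m) x := by
        refine Finset.sum_le_sum fun j hj => ?_
        obtain ⟨k, rfl⟩ := Nat.exists_eq_add_of_le (Finset.mem_range.1 hj).le
        rw [← add_assoc]
        exact le_self_add.trans (hsup (n + j) k)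
    _ = _ := by simp

variable [MeasurableSpace X] {μ : Measure X}

theorem lintegral_birkhoffSum {T : X → X} (hT : MeasurePreserving T μ μ) {f : X → ℝ≥0∞}
    (hf : Measurable f) (n : ℕ) : ∫⁻ x, birkhoffSum T f n x ∂μ = n * ∫⁻ x, f x ∂μ := by
  simp only [birkhoffSum]
  rw [lintegral_finsetSum (f := fun k x => f (T^[k] x)) _
    fun k _ => hf.comp (hT.iterate k).measurable]
  simp [(hT.iterate _).lintegral_comp hf]

theorem measurable_birkhoffSum {M : Type*} [AddCommMonoid M] [MeasurableSpace M]
    [MeasurableAdd₂ M] {T : X → X} (hT : Measurable T) {f : X → M}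
    (hf : Measurable f) (n : ℕ) : Measurable (birkhoffSum T f n) := by
  unfold birkhoffSum
  exact Finset.measurable_sum _ fun k _ => hf.comp (hT.iterate k)

theorem le_of_forall_nat_mul_le {a b c : ℝ≥0∞} (hc : c ≠ ∞)
    (h : ∀ n : ℕ, n * a ≤ n * b + c) : a ≤ b := by
  have h1 : Tendsto (fun n : ℕ => b + c / n) atTop (𝓝 (b + 0)) :=
    tendsto_const_nhds.add (ENNReal.Tendsto.const_div ENNReal.tendsto_nat_nhds_top (Or.inr hc)
      |>.trans (by simp))
  rw [add_zero] at h1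
  refine ge_of_tendsto h1 ?_
  filter_upwards [eventually_gt_atTop 0] with n hn
  have hn0 : (n : ℝ≥0∞) ≠ 0 := by exact_mod_cast hn.ne'
  have := h n
  calc a = (n * a) / n := by rw [mul_comm, ENNReal.mul_div_cancel_right hn0 (by simp)]
    _ ≤ (n * b + c) / n := by gcongr
    _ = b + c / n := by
      rw [ENNReal.add_div, mul_comm, ENNReal.mul_div_cancel_right hn0 (by simp)]

theorem lintegral_le_of_forall_min_le {f : X → ℝ≥0∞} (hf : Measurable f) {γ : ℝ≥0∞}
    (h : ∀ M : ℕ, ∫⁻ x, min (f x) M ∂μ ≤ γ) : ∫⁻ x, f x ∂μ ≤ γ := by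
  have h1 : ∀ x, f x = ⨆ M : ℕ, min (f x) M := by
    intro x
    rw [← inf_iSup_eq]
    rw [ENNReal.iSup_natCast, inf_top_eq]
  rw [lintegral_congr h1, lintegral_iSup (fun n => hf.min measurable_const)]
  · exact iSup_le h
  · intro a b hab x
    dsimp only
    gcongr

theorem ae_forall_iterate {T : X → X} (hT : MeasurePreserving T μ μ)
    {p : X → Prop} (hp : ∀ᵐ x ∂μ, p x) : ∀ᵐ x ∂μ, ∀ k, p (T^[k] x) :=
  ae_all_iff.2 fun k => (hT.iterate k).quasiMeasurePreserving.ae hp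

/-- The upper half of Kingman's theorem. The upper limit `G`, truncated at `M`, satisfies
`G ∘ T ≤ G`, and the set where no block of length at most `N` comes close to `G` decreases to `∅`
as `N → ∞`. -/
theorem lintegral_limsup_le_of_superadditive [IsProbabilityMeasure μ] {T : X → X}
    (hT : MeasurePreserving T μ μ) {h : ℕ → X → ℝ≥0∞} (hm : ∀ n, Measurable (h n))
    (hsup : ∀ᵐ x ∂μ, ∀ m n, h m x + h n (T^[m] x) ≤ h (m + n) x) {γ : ℝ≥0∞}
    (hγ : ∀ n : ℕ, ∫⁻ x, h n x ∂μ ≤ n * γ) :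
    ∫⁻ x, limsup (fun n => h n x / n) atTop ∂μ ≤ γ := by
  have hUm : Measurable fun x => limsup (fun n => h n x / n) atTop :=
    Measurable.limsup fun n => (hm n).div_const _
  refine lintegral_le_of_forall_min_le hUm fun M => ?_
  set G : X → ℝ≥0∞ := fun x => min (limsup (fun n => h n x / n) atTop) M with hGdef
  have hGm : Measurable G := hUm.min measurable_const
  set S : Set X := {x | ∀ k, ∀ m n, h m (T^[k] x) + h n (T^[m] (T^[k] x)) ≤ h (m + n) (T^[k] x)}
  have hSae : ∀ᵐ x ∂μ, x ∈ S := ae_forall_iterate hT hsup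
  have hS : ∀ x ∈ S, T x ∈ S := by
    intro x hx k
    rw [← Function.iterate_succ_apply]
    exact hx (k + 1)
  have hS0 : ∀ x ∈ S, ∀ m n, h m x + h n (T^[m] x) ≤ h (m + n) x := fun x hx => hx 0
  have hG : ∀ x ∈ S, G (T x) ≤ G x := by
    intro x hx
    refine min_le_min ?_ le_rfl
    refine le_of_forall_gt_imp_ge_of_dense fun c hc => ?_
    have hlim : Tendsto (fun n : ℕ => c * (1 + 1 / (n : ℝ≥0∞))) atTop (𝓝 (c * (1 + 0))) := by
      refine ENNReal.Tendsto.const_mul (tendsto_const_nhds.add ?_) (Or.inl (by simp))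
      simpa using ENNReal.tendsto_inv_nat_nhds_zero
    rw [add_zero, mul_one] at hlim
    rw [← hlim.limsup_eq]
    refine limsup_le_limsup ?_
    rw [← limsup_nat_add (fun n => h n x / n) 1] at hc
    filter_upwards [eventually_lt_of_limsup_lt hc, eventually_gt_atTop 0] with n hn hn1
    have hn0 : (n : ℝ≥0∞) ≠ 0 := by exact_mod_cast hn1.ne'
    have h2 : h (n + 1) x ≤ c * (n + 1 : ℕ) :=
      (ENNReal.div_le_iff (by simp) (by simp)).1 hn.le
    rw [ENNReal.div_le_iff hn0 (by simp), mul_assoc, add_mul, ENNReal.div_mul_cancel hn0 (by simp),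
      one_mul]
    rw [add_comm n 1] at h2
    refine (le_add_self.trans (hS0 x hx 1 n)).trans (h2.trans_eq ?_)
    push_cast
    rw [add_comm]
  refine ENNReal.le_of_forall_pos_le_add fun ε hε _ => ?_
  set B : ℕ → Set X := fun N => {x | ∀ l : ℕ, 1 ≤ l → l ≤ N → h l x + l * (ε : ℝ≥0∞) < l * G x}
  have hBm : ∀ N, MeasurableSet (B N) := by
    intro N
    simp only [B, Set.ofPred_forall]
    exact MeasurableSet.iInter fun l => MeasurableSet.iInter fun _ => MeasurableSet.iInter fun _ =>
      measurableSet_lt ((hm l).add_const _) (hGm.const_mul _)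
  have hBe : ⋂ N, B N = ∅ := by
    refine Set.eq_empty_of_forall_notMem fun x hx => ?_
    have hx' : ∀ l : ℕ, 1 ≤ l → h l x + l * (ε : ℝ≥0∞) < l * G x := fun l hl =>
      Set.mem_iInter.1 hx l l hl le_rfl
    have hε1 : (ε : ℝ≥0∞) < G x := by
      have := hx' 1 le_rfl
      simp only [Nat.cast_one, one_mul] at this
      exact lt_of_le_of_lt le_add_self this
    have hGM : G x ≠ ∞ := ne_top_of_le_ne_top (ENNReal.natCast_ne_top M) (min_le_right _ _)
    have h1 : G x - ε < limsup (fun n => h n x / n) atTop :=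
      lt_of_lt_of_le (ENNReal.sub_lt_self hGM (pos_of_gt hε1).ne' (by simpa using hε.ne'))
        (min_le_left _ _)
    obtain ⟨l, hl1, hl2⟩ :=
      ((frequently_lt_of_lt_limsup (by isBoundedDefault) h1).and_eventually
        (eventually_ge_atTop 1)).exists
    have hl0 : (l : ℝ≥0∞) ≠ 0 := by exact_mod_cast (by omega : l ≠ 0)
    refine absurd (hx' l hl2) (not_lt.2 ?_)
    rw [ENNReal.lt_div_iff_mul_lt (Or.inl hl0) (Or.inl (by simp))] at hl1
    calc l * G x = (G x - ε + ε) * l := by rw [tsub_add_cancel_of_le hε1.le, mul_comm]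
      _ = (G x - ε) * l + l * ε := by rw [add_mul, mul_comm (ε : ℝ≥0∞)]
      _ ≤ _ := by gcongr
  have hBN : ∀ N, ∫⁻ x, G x ∂μ ≤ γ + (M * μ (B N) + ε) := by
    intro N
    refine le_of_forall_nat_mul_le (c := N * M)
      (by finiteness) fun n => ?_
    have h1 : ∀ᵐ x ∂μ, birkhoffSum T G n x ≤ h n x +
        birkhoffSum T (fun y => (B N).indicator (fun _ => (M : ℝ≥0∞)) y + ε) n x + N * M := by
      filter_upwards [hSae] with x hx
      refine birkhoffSum_le_of_superadditive hS hS0 hG (fun x => min_le_right _ _) ?_ n x hx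
      intro y _ hy
      simp only [B, Set.mem_ofPred_eq, not_forall, not_lt] at hy
      obtain ⟨l, h1, h2, h3⟩ := hy
      exact ⟨l, h1, h2, h3⟩
    have hfm : Measurable fun y => (B N).indicator (fun _ => (M : ℝ≥0∞)) y + ε :=
      (measurable_const.indicator (hBm N)).add_const _
    have h2 := lintegral_mono_ae h1
    rw [lintegral_birkhoffSum hT hGm, lintegral_add_right _ measurable_const,
      lintegral_add_left (hm n), lintegral_birkhoffSum hT hfm, lintegral_const,
      lintegral_add_right _ measurable_const, lintegral_indicator (hBm N), lintegral_const,
      lintegral_const, Measure.restrict_apply_univ, measure_univ, mul_one, mul_one] at h2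
    refine h2.trans ?_
    rw [mul_add, mul_add, mul_add]
    gcongr
    exact hγ n
  have hlim : Tendsto (fun N => γ + (M * μ (B N) + ε)) atTop
      (𝓝 (γ + (M * μ (⋂ N, B N) + ε))) := by
    refine tendsto_const_nhds.add (Tendsto.add_const _ (ENNReal.Tendsto.const_mul ?_
      (Or.inr (by simp))))
    refine tendsto_measure_iInter_atTop (fun N => (hBm N).nullMeasurableSet) ?_
      ⟨0, measure_ne_top _ _⟩
    intro a b hab x hx l hl1 hl2
    exact hx l hl1 (hl2.trans hab)
  rw [hBe, measure_empty, mul_zero, zero_add] at hlim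
  exact ge_of_tendsto' hlim hBN

/-- The lower half of Birkhoff's theorem for bounded functions, which is the upper half for
`C - f`. -/
theorem lintegral_le_lintegral_liminf_birkhoffSum [IsProbabilityMeasure μ] {T : X → X}
    (hT : MeasurePreserving T μ μ) {f : X → ℝ≥0∞} (hf : Measurable f) {C : ℝ≥0}
    (hC : ∀ x, f x ≤ C) :
    ∫⁻ x, f x ∂μ ≤ ∫⁻ x, liminf (fun n : ℕ => birkhoffSum T f n x / n) atTop ∂μ := by
  have hadd : ∀ n x, birkhoffSum T (fun y => C - f y) n x + birkhoffSum T f n x = n * C := by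
    intro n x
    simp [birkhoffSum, ← Finset.sum_add_distrib, tsub_add_cancel_of_le (hC _)]
  have hlim : ∀ x, limsup (fun n : ℕ => birkhoffSum T (fun y => C - f y) n x / n) atTop
      = C - liminf (fun n : ℕ => birkhoffSum T f n x / n) atTop := by
    intro x
    rw [← ENNReal.limsup_const_sub _ _ ENNReal.coe_ne_top]
    refine limsup_congr ?_
    filter_upwards [eventually_gt_atTop 0] with n hn
    have hn0 : (n : ℝ≥0∞) ≠ 0 := by exact_mod_cast hn.ne'
    have h1 := hadd n x
    have hfin : birkhoffSum T f n x ≠ ∞ := by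
      refine ne_top_of_le_ne_top ?_ (le_add_self.trans_eq h1)
      finiteness
    have h2 : birkhoffSum T f n x / n ≠ ∞ := ENNReal.div_ne_top hfin hn0
    refine ENNReal.eq_sub_of_add_eq h2 ?_
    rw [← ENNReal.add_div, h1, mul_comm, ENNReal.mul_div_cancel_right hn0 (by simp)]
  have hLC : ∀ x, liminf (fun n : ℕ => birkhoffSum T f n x / n) atTop ≤ C := by
    intro x
    refine liminf_le_of_le (by isBoundedDefault) fun b hb => ?_
    obtain ⟨n, hn, hn1⟩ := (hb.and (eventually_gt_atTop 0)).exists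
    have hn0 : (n : ℝ≥0∞) ≠ 0 := by exact_mod_cast hn1.ne'
    refine hn.trans ?_
    rw [ENNReal.div_le_iff hn0 (by simp), mul_comm, ← hadd n x]
    exact le_add_self
  have hLm : Measurable fun x => liminf (fun n : ℕ => birkhoffSum T f n x / n) atTop :=
    Measurable.liminf fun n => (measurable_birkhoffSum hT.measurable hf n).div_const _
  have h1 := lintegral_limsup_le_of_superadditive hT
    (h := fun n => birkhoffSum T (fun y => C - f y) n)
    (fun n => measurable_birkhoffSum hT.measurable (hf.const_sub _) n)
    (ae_of_all _ fun x m n => (birkhoffSum_add _ _ _ _ _).ge)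
    (fun n => (lintegral_birkhoffSum hT (hf.const_sub _) n).le)
  simp_rw [hlim] at h1
  have h2 : ∫⁻ x, (C - f x) ∂μ + ∫⁻ x, f x ∂μ = C := by
    rw [← lintegral_add_right _ hf]
    simp [tsub_add_cancel_of_le (hC _)]
  have h3 : ∫⁻ x, (C - liminf (fun n : ℕ => birkhoffSum T f n x / n) atTop) ∂μ
      + ∫⁻ x, liminf (fun n : ℕ => birkhoffSum T f n x / n) atTop ∂μ = C := by
    rw [← lintegral_add_right _ hLm]
    simp [tsub_add_cancel_of_le (hLC _)]
  have hfin : ∫⁻ x, (C - f x) ∂μ ≠ ∞ :=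
    ne_top_of_le_ne_top ENNReal.coe_ne_top (le_self_add.trans_eq h2)
  refine (ENNReal.add_le_add_iff_left hfin).1 ?_
  rw [h2]
  exact h3.ge.trans (add_le_add h1 le_rfl)

/-- The lower half of Kingman's theorem: Birkhoff's theorem is applied to truncations of
`h m / m`, whose Birkhoff sums are at most `h k` up to a constant. -/
theorem lintegral_le_lintegral_liminf_of_superadditive [IsProbabilityMeasure μ] {T : X → X}
    (hT : MeasurePreserving T μ μ) {h : ℕ → X → ℝ≥0∞} (hm : ∀ n, Measurable (h n))
    (hsup : ∀ᵐ x ∂μ, ∀ m n, h m x + h n (T^[m] x) ≤ h (m + n) x) {m : ℕ} (hm0 : 0 < m) :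
    ∫⁻ x, h m x ∂μ ≤ m * ∫⁻ x, liminf (fun n => h n x / n) atTop ∂μ := by
  have hm0' : (m : ℝ≥0∞) ≠ 0 := by exact_mod_cast hm0.ne'
  refine lintegral_le_of_forall_min_le (hm m) fun C => ?_
  have hfm : Measurable fun x => min (h m x) C / m := ((hm m).min measurable_const).div_const _
  have h1 : ∀ᵐ x ∂μ, ∀ k, birkhoffSum T (fun x => min (h m x) C / m) k x ≤ h k x + C := by
    filter_upwards [hsup] with x hx k
    have hc : ∀ (k : ℕ) y, k ≤ m → birkhoffSum T (fun x => min (h m x) C / m) k y ≤ C := by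
      intro k y hk
      calc _ ≤ ∑ j ∈ Finset.range k, (C : ℝ≥0∞) / m := by
            refine Finset.sum_le_sum fun j _ => ?_
            dsimp only
            gcongr
            exact min_le_right _ _
        _ = k * (C / m) := by simp
        _ ≤ m * (C / m) := by gcongr
        _ = C := ENNReal.mul_div_cancel hm0' (by simp)
    rcases le_total k m with hk | hk
    · exact (hc k x hk).trans le_add_self
    · obtain ⟨n, rfl⟩ := Nat.exists_eq_add_of_le' hk
      rw [birkhoffSum_add]
      refine add_le_add ?_ (hc m _ le_rfl)
      calc _ ≤ ∑ j ∈ Finset.range n, h m (T^[j] x) / m := by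
            refine Finset.sum_le_sum fun j _ => ?_
            dsimp only
            gcongr
            exact min_le_left _ _
        _ = birkhoffSum T (h m) n x / m := by
            simp only [birkhoffSum, div_eq_mul_inv, Finset.sum_mul]
        _ ≤ m * h (n + m) x / m := by
            gcongr
            exact birkhoffSum_le_mul_of_superadditive hx hm0 n
        _ = h (n + m) x := by rw [mul_comm, ENNReal.mul_div_cancel_right hm0' (by simp)]
  have h2 : ∫⁻ x, min (h m x) C / m ∂μ ≤ ∫⁻ x, liminf (fun n => h n x / n) atTop ∂μ := by
    refine (lintegral_le_lintegral_liminf_birkhoffSum hT hfm (C := C / m) fun x => ?_).trans ?_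
    · rw [ENNReal.coe_div (by exact_mod_cast hm0.ne')]
      push_cast
      gcongr
      exact min_le_right _ _
    · refine lintegral_mono_ae ?_
      filter_upwards [h1] with x hx
      have h0 : Tendsto (fun n : ℕ => (C : ℝ≥0∞) / n) atTop (𝓝 0) := by
        refine (ENNReal.Tendsto.const_div ENNReal.tendsto_nat_nhds_top
          (Or.inr (by simp))).trans (by simp)
      refine (liminf_le_liminf (Eventually.of_forall fun n => ?_)).trans_eq
        (ENNReal.liminf_add_of_right_tendsto_zero h0 _)
      rw [Pi.add_apply, ← ENNReal.add_div]
      exact ENNReal.div_le_div_right (hx n) _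
  calc ∫⁻ x, min (h m x) C ∂μ = m * ∫⁻ x, min (h m x) C / m ∂μ := by
        rw [← lintegral_const_mul _ hfm]
        simp only [ENNReal.mul_div_cancel hm0' (ENNReal.natCast_ne_top m)]
    _ ≤ _ := by gcongr

theorem ae_tendsto_div_of_superadditive [IsProbabilityMeasure μ] {T : X → X}
    (hT : MeasurePreserving T μ μ) {h : ℕ → X → ℝ≥0∞} (hm : ∀ n, Measurable (h n))
    (hsup : ∀ᵐ x ∂μ, ∀ m n, h m x + h n (T^[m] x) ≤ h (m + n) x) {γ : ℝ≥0}
    (hγ : ∀ n : ℕ, ∫⁻ x, h n x ∂μ ≤ n * γ) :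
    ∃ L : X → ℝ≥0∞, Measurable L ∧ ∫⁻ x, L x ∂μ ≠ ∞ ∧
      (∀ᵐ x ∂μ, Tendsto (fun n => h n x / n) atTop (𝓝 (L x))) ∧
      ∀ n, 0 < n → ∫⁻ x, h n x ∂μ ≤ n * ∫⁻ x, L x ∂μ := by
  have hge : ∀ n, 0 < n → ∫⁻ x, h n x ∂μ ≤ n * ∫⁻ x, liminf (fun n => h n x / n) atTop ∂μ :=
    fun n hn => lintegral_le_lintegral_liminf_of_superadditive hT hm hsup hn
  have hLm : Measurable fun x => liminf (fun n => h n x / n) atTop :=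
    Measurable.liminf fun n => (hm n).div_const _
  have hUm : Measurable fun x => limsup (fun n => h n x / n) atTop :=
    Measurable.limsup fun n => (hm n).div_const _
  have hle : ∀ x, liminf (fun n => h n x / n) atTop ≤ limsup (fun n => h n x / n) atTop :=
    fun x => liminf_le_limsup
  have hUL : ∫⁻ x, limsup (fun n => h n x / n) atTop ∂μ
      ≤ ∫⁻ x, liminf (fun n => h n x / n) atTop ∂μ := by
    refine lintegral_limsup_le_of_superadditive hT hm hsup fun n => ?_
    rcases Nat.eq_zero_or_pos n with rfl | hn
    · simpa using hγ 0
    · exact hge n hn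
  have hfin : ∫⁻ x, liminf (fun n => h n x / n) atTop ∂μ ≠ ∞ :=
    ne_top_of_le_ne_top ENNReal.coe_ne_top
      ((lintegral_mono hle).trans (lintegral_limsup_le_of_superadditive hT hm hsup hγ))
  refine ⟨_, hLm, hfin, ?_, hge⟩
  filter_upwards [ae_eq_of_ae_le_of_lintegral_le (ae_of_all _ hle) hfin hUm.aemeasurable hUL]
    with x hx
  exact tendsto_of_liminf_eq_limsup rfl hx.symm

/-- Kingman's theorem for nonnegative superadditive processes. Convergence in mean follows from
almost sure convergence as in Scheffé's lemma, since the mean of `b n / n` is at most that of the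
limit. -/
theorem kingman_of_nonneg [IsProbabilityMeasure μ] {T : X → X}
    (hT : MeasurePreserving T μ μ) {b : ℕ → X → ℝ} (hm : ∀ n, Measurable (b n))
    (hb : ∀ᵐ x ∂μ, ∀ n, 0 ≤ b n x)
    (hsup : ∀ᵐ x ∂μ, ∀ m n, b m x + b n (T^[m] x) ≤ b (m + n) x) {γ : ℝ≥0}
    (hγ : ∀ n : ℕ, ∫⁻ x, ENNReal.ofReal (b n x) ∂μ ≤ n * γ) :
    ∃ L : X → ℝ, Measurable L ∧ Integrable L μ ∧
      (∀ᵐ x ∂μ, Tendsto (fun n => b n x / n) atTop (𝓝 (L x))) ∧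
      Tendsto (fun n => ∫⁻ x, ‖b n x / n - L x‖ₑ ∂μ) atTop (𝓝 0) := by
  have hb' := ae_forall_iterate hT hb
  obtain ⟨L, hLm, hLfin, hLlim, hLge⟩ := ae_tendsto_div_of_superadditive hT
    (h := fun n x => ENNReal.ofReal (b n x)) (fun n => (hm n).ennreal_ofReal) (by
      filter_upwards [hsup, hb'] with x hx hbx m n
      rw [← ENNReal.ofReal_add (by simpa using hbx 0 m) (hbx m n)]
      exact ENNReal.ofReal_le_ofReal (hx m n)) hγ
  have hLae : ∀ᵐ x ∂μ, L x < ∞ := ae_lt_top hLm hLfin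
  have hlim : ∀ᵐ x ∂μ, Tendsto (fun n => b n x / n) atTop (𝓝 (L x).toReal) := by
    filter_upwards [hLlim, hLae, hb] with x hx hfin hbx
    refine ((ENNReal.tendsto_toReal hfin.ne).comp hx).congr fun n => ?_
    simp [ENNReal.toReal_div, ENNReal.toReal_ofReal (hbx n)]
  have hLint : Integrable (fun x => (L x).toReal) μ :=
    integrable_toReal_of_lintegral_ne_top hLm.aemeasurable hLfin
  refine ⟨fun x => (L x).toReal, hLm.ennreal_toReal, hLint, hlim, ?_⟩
  -- The part of `L` that is not attained, `(L - b n / n)⁺`, is dominated by `L`.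
  set D : ℕ → X → ℝ≥0∞ := fun n x => ENNReal.ofReal ((L x).toReal - b n x / n)
  have hDm : ∀ n, Measurable (D n) := fun n =>
    (hLm.ennreal_toReal.sub ((hm n).div_const _)).ennreal_ofReal
  have hD : Tendsto (fun n => ∫⁻ x, D n x ∂μ) atTop (𝓝 0) := by
    have h0 : ∫⁻ _, (0 : ℝ≥0∞) ∂μ = 0 := by simp
    rw [← h0]
    refine tendsto_lintegral_of_dominated_convergence L hDm (fun n => ?_) hLfin ?_
    · filter_upwards [hb] with x hx
      refine (ENNReal.ofReal_le_ofReal (sub_le_self _ (div_nonneg (hx n) n.cast_nonneg))).trans ?_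
      exact ENNReal.ofReal_toReal_le
    · filter_upwards [hlim] with x hx
      have := ENNReal.tendsto_ofReal (hx.const_sub (L x).toReal)
      simpa using this
  have hbound : ∀ n : ℕ, 0 < n → ∫⁻ x, ‖b n x / n - (L x).toReal‖ₑ ∂μ ≤ 2 * ∫⁻ x, D n x ∂μ := by
    intro n hn
    have hn0 : (n : ℝ≥0∞) ≠ 0 := by exact_mod_cast hn.ne'
    have h1 : ∫⁻ x, ENNReal.ofReal (b n x / n) ∂μ ≤ ∫⁻ x, L x ∂μ := by
      have h2 : ∀ x, ENNReal.ofReal (b n x / n) = ENNReal.ofReal (b n x) * (n : ℝ≥0∞)⁻¹ := by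
        intro x
        rw [ENNReal.ofReal_div_of_pos (by exact_mod_cast hn), ENNReal.ofReal_natCast,
          div_eq_mul_inv]
      simp_rw [h2]
      rw [lintegral_mul_const _ (hm n).ennreal_ofReal, ← div_eq_mul_inv,
        ENNReal.div_le_iff hn0 (by simp), mul_comm]
      exact hLge n hn
    have h3 : ∫⁻ x, L x ∂μ + ∫⁻ x, ‖b n x / n - (L x).toReal‖ₑ ∂μ
        ≤ ∫⁻ x, ENNReal.ofReal (b n x / n) ∂μ + 2 * ∫⁻ x, D n x ∂μ := by
      rw [← lintegral_add_left hLm, ← lintegral_const_mul _ (hDm n),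
        ← lintegral_add_left ((hm n).div_const _).ennreal_ofReal]
      refine lintegral_mono_ae ?_
      filter_upwards [hb, hLae] with x hx hfin
      have hbn : 0 ≤ b n x / n := div_nonneg (hx n) n.cast_nonneg
      obtain ⟨l, hl⟩ : ∃ l : ℝ≥0, L x = l := ⟨(L x).toNNReal, (ENNReal.coe_toNNReal hfin.ne).symm⟩
      simp only [D, hl, ENNReal.coe_toReal]
      rw [Real.enorm_eq_ofReal_abs, ← ENNReal.ofReal_coe_nnreal,
        ← ENNReal.ofReal_add l.coe_nonneg (abs_nonneg _)]
      have h4 : (2 : ℝ≥0∞) = ENNReal.ofReal 2 := by simp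
      rw [h4, ← ENNReal.ofReal_mul (by norm_num)]
      rcases le_total (b n x / n) l with h | h
      · rw [← ENNReal.ofReal_add hbn (by linarith)]
        refine ENNReal.ofReal_le_ofReal ?_
        rw [abs_of_nonpos (by linarith)]
        linarith
      · refine le_trans (ENNReal.ofReal_le_ofReal ?_) le_self_add
        rw [abs_of_nonneg (by linarith)]
        linarith
    exact (ENNReal.add_le_add_iff_left hLfin).1 (h3.trans (by gcongr))
  have h2D : Tendsto (fun n => 2 * ∫⁻ x, D n x ∂μ) atTop (𝓝 0) := by
    simpa using ENNReal.Tendsto.const_mul hD (Or.inr (by simp : (2 : ℝ≥0∞) ≠ ∞))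
  refine tendsto_of_tendsto_of_tendsto_of_le_of_le' tendsto_const_nhds h2D
    (Eventually.of_forall fun n => zero_le) ?_
  filter_upwards [eventually_gt_atTop 0] with n hn using hbound n hn

theorem lintegral_ofReal_birkhoffSum {T : X → X} (hT : MeasurePreserving T μ μ) {f : X → ℝ}
    (hf : Measurable f) (hf0 : ∀ x, 0 ≤ f x) (n : ℕ) :
    ∫⁻ x, ENNReal.ofReal (birkhoffSum T f n x) ∂μ = n * ∫⁻ x, ENNReal.ofReal (f x) ∂μ := by
  rw [← lintegral_birkhoffSum hT hf.ennreal_ofReal]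
  simp only [birkhoffSum, ENNReal.ofReal_sum_of_nonneg fun k _ => hf0 _]

/-- Birkhoff's theorem for a nonnegative function, with convergence in mean. -/
theorem birkhoff_of_nonneg [IsProbabilityMeasure μ] {T : X → X}
    (hT : MeasurePreserving T μ μ) {f : X → ℝ} (hf : Measurable f) (hf0 : ∀ x, 0 ≤ f x)
    (hfi : Integrable f μ) :
    ∃ L : X → ℝ, Measurable L ∧ Integrable L μ ∧
      (∀ᵐ x ∂μ, Tendsto (fun n => birkhoffSum T f n x / n) atTop (𝓝 (L x))) ∧
      Tendsto (fun n => ∫⁻ x, ‖birkhoffSum T f n x / n - L x‖ₑ ∂μ) atTop (𝓝 0) := by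
  have hfin : ∫⁻ x, ENNReal.ofReal (f x) ∂μ ≠ ∞ := hfi.lintegral_lt_top.ne
  refine kingman_of_nonneg hT (measurable_birkhoffSum hT.measurable hf)
    (ae_of_all _ fun x n => Finset.sum_nonneg fun k _ => hf0 _)
    (ae_of_all _ fun x m n => (birkhoffSum_add _ _ _ _ _).ge)
    (γ := (∫⁻ x, ENNReal.ofReal (f x) ∂μ).toNNReal) fun n => ?_
  rw [lintegral_ofReal_birkhoffSum hT hf hf0, ENNReal.coe_toNNReal hfin]

/-- A stationary integrable sequence grows sublinearly: it consists of the increments of Birkhoff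
sums. -/
theorem tendsto_iterate_div_of_nonneg [IsProbabilityMeasure μ] {T : X → X}
    (hT : MeasurePreserving T μ μ) {f : X → ℝ} (hf : Measurable f) (hf0 : ∀ x, 0 ≤ f x)
    (hfi : Integrable f μ) :
    ∀ᵐ x ∂μ, Tendsto (fun n : ℕ => f (T^[n] x) / n) atTop (𝓝 0) := by
  obtain ⟨L, -, -, hL, -⟩ := birkhoff_of_nonneg hT hf hf0 hfi
  filter_upwards [hL] with x hx
  have h1 : Tendsto (fun n : ℕ => birkhoffSum T f (n + 1) x / (n + 1 : ℕ) * ((n + 1 : ℕ) / n)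
      - birkhoffSum T f n x / n) atTop (𝓝 (L x * 1 - L x)) := by
    refine (Tendsto.mul ((tendsto_add_atTop_iff_nat 1).2 hx) ?_).sub hx
    have h2 : Tendsto (fun n : ℕ => 1 + 1 / (n : ℝ)) atTop (𝓝 (1 + 0)) :=
      tendsto_const_nhds.add tendsto_one_div_atTop_nhds_zero_nat
    rw [add_zero] at h2
    refine h2.congr' ?_
    filter_upwards [eventually_gt_atTop 0] with n hn
    have : (n : ℝ) ≠ 0 := by exact_mod_cast hn.ne'
    push_cast
    field_simp
  rw [mul_one, sub_self] at h1
  refine h1.congr' ?_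
  filter_upwards [eventually_gt_atTop 0] with n hn
  have : (n : ℝ) ≠ 0 := by exact_mod_cast hn.ne'
  rw [birkhoffSum_succ]
  push_cast
  field_simp
  ring

/-- Kingman's superadditive ergodic theorem, almost surely and in mean, for processes that become
nonnegative when the Birkhoff sums of an integrable function are added. -/
theorem kingman [IsProbabilityMeasure μ] {T : X → X}
    (hT : MeasurePreserving T μ μ) {a : ℕ → X → ℝ} (hm : ∀ n, Measurable (a n))
    {f : X → ℝ} (hf : Measurable f) (hf0 : ∀ x, 0 ≤ f x) (hfi : Integrable f μ)
    (hlow : ∀ᵐ x ∂μ, ∀ n, 0 ≤ a n x + birkhoffSum T f n x)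
    (hsup : ∀ᵐ x ∂μ, ∀ m n, a m x + a n (T^[m] x) ≤ a (m + n) x) {γ : ℝ≥0}
    (hγ : ∀ n : ℕ, ∫⁻ x, ENNReal.ofReal (a n x + birkhoffSum T f n x) ∂μ ≤ n * γ) :
    ∃ L : X → ℝ, Measurable L ∧ Integrable L μ ∧
      (∀ᵐ x ∂μ, Tendsto (fun n => a n x / n) atTop (𝓝 (L x))) ∧
      Tendsto (fun n => ∫⁻ x, ‖a n x / n - L x‖ₑ ∂μ) atTop (𝓝 0) := by
  obtain ⟨L, hLm, hLi, hL, hL1⟩ := birkhoff_of_nonneg hT hf hf0 hfi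
  obtain ⟨H, hHm, hHi, hH, hH1⟩ := kingman_of_nonneg hT
    (b := fun n x => a n x + birkhoffSum T f n x)
    (fun n => (hm n).add (measurable_birkhoffSum hT.measurable hf n)) hlow (by
      filter_upwards [hsup] with x hx m n
      rw [birkhoffSum_add]
      linarith [hx m n]) hγ
  refine ⟨fun x => H x - L x, hHm.sub hLm, hHi.sub hLi, ?_, ?_⟩
  · filter_upwards [hL, hH] with x hx1 hx2
    refine (hx2.sub hx1).congr fun n => ?_
    rw [add_div, add_sub_cancel_right]
  · have h1 := hH1.add hL1
    rw [add_zero] at h1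
    refine tendsto_of_tendsto_of_tendsto_of_le_of_le tendsto_const_nhds h1 (fun n => zero_le)
      fun n => ?_
    have h2 : Measurable fun x => ‖birkhoffSum T f n x / n - L x‖ₑ :=
      (((measurable_birkhoffSum hT.measurable hf n).div_const _).sub hLm).enorm
    dsimp only
    rw [← lintegral_add_right _ h2]
    refine lintegral_mono fun x => ?_
    refine le_trans (le_of_eq ?_) (enorm_sub_le)
    congr 1
    ring

end Ergodic

/-! ### The Markov property of the walk -/

section Walk

variable {d : ℕ}

/-- Prepend a holding time and a jump to the data of a walk. -/
def cons (p : (ℝ × (Fin d × Bool)) × WalkSpace d) : WalkSpace d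
  | 0 => p.1
  | n + 1 => p.2 n

@[simp] theorem cons_zero (p : (ℝ × (Fin d × Bool)) × WalkSpace d) : cons p 0 = p.1 := rfl

@[simp] theorem cons_succ (p : (ℝ × (Fin d × Bool)) × WalkSpace d) (n : ℕ) :
    cons p (n + 1) = p.2 n := rfl

theorem measurable_cons : Measurable (cons (d := d)) := by
  refine measurable_pi_iff.2 fun n => ?_
  cases n with
  | zero => exact measurable_fst
  | succ n => exact (measurable_pi_apply n).comp measurable_snd

instance [NeZero d] : IsProbabilityMeasure (walkLaw d) := by
  unfold walkLaw
  infer_instance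

/-- The first holding time and jump are independent of the later ones, which have the law of a
walk again. -/
theorem walkLaw_map_cons [NeZero d] : ((stepLaw d).prod (walkLaw d)).map cons = walkLaw d := by
  refine Measure.eq_infinitePi _ fun s t ht => ?_
  classical
  obtain ⟨n, hn⟩ := s.exists_nat_subset_range
  set t' : ℕ → Set (ℝ × (Fin d × Bool)) := fun i => if i ∈ s then t i else Set.univ with ht'
  have ht'm : ∀ i, MeasurableSet (t' i) := by
    intro i
    simp only [ht']
    split_ifs
    exacts [ht i, MeasurableSet.univ]
  have hsub : s ⊆ Finset.range (n + 1) := hn.trans (Finset.range_subset_range.2 n.le_succ)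
  have h1 : Set.pi (s : Set ℕ) t = Set.pi (Finset.range (n + 1) : Set ℕ) t' := by
    ext w
    simp only [Set.mem_pi, ht']
    constructor
    · intro h i _
      split_ifs with hi
      exacts [h i hi, trivial]
    · intro h i hi
      have := h i (hsub hi)
      rwa [if_pos (by simpa using hi)] at this
  have h2 : ∏ i ∈ s, stepLaw d (t i) = ∏ i ∈ Finset.range (n + 1), stepLaw d (t' i) := by
    rw [← Finset.prod_subset hsub (f := fun i => stepLaw d (t' i))]
    · refine Finset.prod_congr rfl fun i hi => ?_
      simp [ht', hi]
    · intro i _ hi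
      simp [ht', hi]
  have h3 : cons ⁻¹' Set.pi (Finset.range (n + 1) : Set ℕ) t'
      = t' 0 ×ˢ Set.pi (Finset.range n : Set ℕ) (fun i => t' (i + 1)) := by
    ext p
    simp only [Set.mem_preimage, Set.mem_pi, Set.mem_prod, Finset.coe_range, Set.mem_Iio]
    constructor
    · intro h
      exact ⟨h 0 (by omega), fun i hi => h (i + 1) (by omega)⟩
    · rintro ⟨h0, h⟩ i hi
      cases i with
      | zero => exact h0
      | succ i => exact h i (by omega)
  rw [h1, h2, Measure.map_apply measurable_cons
    (MeasurableSet.pi (Finset.countable_toSet _) fun i _ => ht'm i), h3, Measure.prod_prod,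
    Finset.prod_range_succ', mul_comm]
  congr 1
  exact Measure.infinitePi_pi _ fun i _ => ht'm (i + 1)

theorem lintegral_walkLaw [NeZero d] {F : WalkSpace d → ℝ≥0∞} (hF : Measurable F) :
    ∫⁻ w, F w ∂walkLaw d = ∫⁻ p, ∫⁻ w, F (cons (p, w)) ∂walkLaw d ∂stepLaw d := by
  conv_lhs => rw [← walkLaw_map_cons]
  rw [lintegral_map hF measurable_cons]
  exact lintegral_prod (fun q => F (cons q)) (hF.comp measurable_cons).aemeasurable

theorem expMeasure_one_eq : expMeasure 1 = volume.withDensity (exponentialPDF 1) := rfl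

theorem measurable_exponentialPDF (r : ℝ) : Measurable (exponentialPDF r) :=
  (measurable_exponentialPDFReal r).ennreal_ofReal

/-- The exponential distribution has no memory. -/
theorem setLIntegral_Ioi_expMeasure {F : ℝ → ℝ≥0∞} (hF : Measurable F) {r : ℝ} (hr : 0 ≤ r) :
    ∫⁻ τ in Set.Ioi r, F (τ - r) ∂expMeasure 1
      = ENNReal.ofReal (Real.exp (-r)) * ∫⁻ τ, F τ ∂expMeasure 1 := by
  have hFr : Measurable fun τ => F (τ - r) := hF.comp (measurable_id.sub_const r)
  rw [expMeasure_one_eq, setLIntegral_withDensity_eq_setLIntegral_mul _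
    (measurable_exponentialPDF 1) hFr measurableSet_Ioi, lintegral_withDensity_eq_lintegral_mul _
    (measurable_exponentialPDF 1) hF,
    ← lintegral_const_mul _ ((measurable_exponentialPDF 1).mul hF),
    ← lintegral_indicator measurableSet_Ioi, ← lintegral_add_right_eq_self _ r]
  have h0 : ∀ᵐ σ : ℝ, σ ≠ 0 := by simp [ae_iff, measure_singleton]
  refine lintegral_congr_ae ?_
  filter_upwards [h0] with σ hσ
  rcases lt_or_gt_of_ne hσ with h | h
  · rw [Set.indicator_of_notMem (by simp [h.le])]
    simp [exponentialPDF_of_neg h]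
  · rw [Set.indicator_of_mem (by simpa using h)]
    simp only [Pi.mul_apply, add_sub_cancel_right]
    rw [exponentialPDF_of_nonneg h.le, exponentialPDF_of_nonneg (by linarith), ← mul_assoc,
      ← ENNReal.ofReal_mul (Real.exp_pos _).le]
    congr 2
    rw [one_mul, one_mul, one_mul, one_mul, ← Real.exp_add]
    ring_nf

theorem expMeasure_Ioi {r : ℝ} (hr : 0 ≤ r) :
    expMeasure 1 (Set.Ioi r) = ENNReal.ofReal (Real.exp (-r)) := by
  have : IsProbabilityMeasure (expMeasure 1) := isProbabilityMeasure_expMeasure one_pos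
  have := setLIntegral_Ioi_expMeasure (F := fun _ => 1) measurable_const hr
  simpa using this

/-- The time of the `n`-th jump, `n ≥ 1`. -/
noncomputable def jumpTime (w : WalkSpace d) (n : ℕ) : ℝ := ∑ i ∈ Finset.range n, (w i).1

theorem measurable_jumpTime (n : ℕ) : Measurable fun w : WalkSpace d => jumpTime w n :=
  Finset.measurable_sum _ fun i _ => measurable_fst.comp (measurable_pi_apply i)

theorem jumpTime_succ (w : WalkSpace d) (n : ℕ) :
    jumpTime w (n + 1) = jumpTime w n + (w n).1 := Finset.sum_range_succ _ _

@[simp] theorem jumpTime_zero (w : WalkSpace d) : jumpTime w 0 = 0 := rfl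

theorem jumpTime_cons_succ (p : ℝ × (Fin d × Bool)) (w : WalkSpace d) (n : ℕ) :
    jumpTime (cons (p, w)) (n + 1) = p.1 + jumpTime w n := by
  simp [jumpTime, Finset.sum_range_succ', add_comm]

theorem stepLaw_map_fst [NeZero d] : (stepLaw d).map Prod.fst = expMeasure 1 := by
  have : IsProbabilityMeasure (expMeasure 1) := isProbabilityMeasure_expMeasure one_pos
  unfold stepLaw
  simp

theorem stepLaw_Ioi [NeZero d] {r : ℝ} (hr : 0 ≤ r) :
    stepLaw d {p | r < p.1} = ENNReal.ofReal (Real.exp (-r)) := by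
  rw [← expMeasure_Ioi hr, ← stepLaw_map_fst (d := d),
    Measure.map_apply measurable_fst measurableSet_Ioi]
  rfl

theorem stepLaw_le_lt_one [NeZero d] {r : ℝ} (hr : 0 ≤ r) : stepLaw d {p | p.1 ≤ r} < 1 := by
  have hm : MeasurableSet {p : ℝ × (Fin d × Bool) | r < p.1} :=
    measurableSet_lt measurable_const measurable_fst
  have h : {p : ℝ × (Fin d × Bool) | p.1 ≤ r} = {p | r < p.1}ᶜ := by ext; simp
  rw [h, prob_compl_eq_one_sub hm, stepLaw_Ioi hr]
  refine ENNReal.sub_lt_self (by simp) (by simp) ?_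
  simpa using Real.exp_pos _

theorem ae_stepLaw_pos [NeZero d] : ∀ᵐ p ∂stepLaw d, 0 < p.1 := by
  have h := stepLaw_Ioi (d := d) le_rfl
  rw [neg_zero, Real.exp_zero, ENNReal.ofReal_one] at h
  exact (prob_compl_eq_zero_iff (measurableSet_lt measurable_const measurable_fst)).2 h

theorem ae_walkLaw_pos [NeZero d] : ∀ᵐ w ∂walkLaw d, ∀ n, 0 < (w n).1 :=
  ae_all_iff.2 fun n =>
    (measurePreserving_eval_infinitePi (fun _ : ℕ => stepLaw d) n).quasiMeasurePreserving.ae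
      ae_stepLaw_pos

/-- The walk does not explode: the probability `p` of having infinitely many jumps up to time `r`
satisfies `p ≤ q p`, where `q < 1` is the probability that the first holding time is at most `r`.
-/
theorem walkLaw_jumpTime_le [NeZero d] (r : ℝ) :
    walkLaw d {w | ∀ n, jumpTime w n ≤ r} = 0 := by
  rcases lt_or_ge r 0 with hr | hr
  · convert measure_empty (μ := walkLaw d)
    ext w
    simp only [Set.mem_ofPred_eq, Set.mem_empty_iff_false, iff_false, not_forall, not_le]
    exact ⟨0, by simpa using hr⟩
  have hm : MeasurableSet {w : WalkSpace d | ∀ n, jumpTime w n ≤ r} := by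
    rw [Set.ofPred_forall]
    exact MeasurableSet.iInter fun n => measurableSet_le (measurable_jumpTime n) measurable_const
  have h1 : walkLaw d {w | ∀ n, jumpTime w n ≤ r}
      ≤ stepLaw d {p | p.1 ≤ r} * walkLaw d {w | ∀ n, jumpTime w n ≤ r} := by
    conv_lhs => rw [← walkLaw_map_cons, Measure.map_apply measurable_cons hm]
    rw [← Measure.prod_prod]
    have hpos : ∀ᵐ q ∂(stepLaw d).prod (walkLaw d), 0 < q.1.1 :=
      Measure.quasiMeasurePreserving_fst.ae ae_stepLaw_pos
    refine measure_mono_ae ?_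
    filter_upwards [hpos] with q hq hw
    have hw' : ∀ n, jumpTime (cons q) n ≤ r := hw
    refine ⟨?_, fun n => ?_⟩
    · simpa [jumpTime] using hw' 1
    · have h := hw' (n + 1)
      rw [← Prod.mk.eta (p := q), jumpTime_cons_succ] at h
      linarith
  by_contra h0
  refine absurd h1 (not_le.2 ?_)
  calc _ < 1 * walkLaw d {w | ∀ n, jumpTime w n ≤ r} :=
        ENNReal.mul_lt_mul_left h0 (measure_ne_top _ _) (stepLaw_le_lt_one hr)
    _ = _ := one_mul _

/-- The holding times are positive and the jump times are unbounded. -/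
def IsRegular (w : WalkSpace d) : Prop := (∀ n, 0 < (w n).1) ∧ ∀ r, ∃ n, r < jumpTime w n

theorem ae_isRegular [NeZero d] : ∀ᵐ w ∂walkLaw d, IsRegular w := by
  have h : ∀ᵐ w ∂walkLaw d, ∀ k : ℕ, ∃ n, (k : ℝ) < jumpTime w n := by
    refine ae_all_iff.2 fun k => ?_
    have := walkLaw_jumpTime_le (d := d) k
    rw [ae_iff]
    simpa using this
  filter_upwards [ae_walkLaw_pos, h] with w h1 h2
  refine ⟨h1, fun r => ?_⟩
  obtain ⟨k, hk⟩ := exists_nat_gt r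
  obtain ⟨n, hn⟩ := h2 k
  exact ⟨n, hk.trans hn⟩

/-- The event that exactly `n` jumps occur up to time `r`. -/
def jumpEvent (d : ℕ) (n : ℕ) (r : ℝ) : Set (WalkSpace d) :=
  {w | jumpTime w n ≤ r ∧ r < jumpTime w (n + 1)}

theorem measurableSet_jumpEvent (n : ℕ) (r : ℝ) : MeasurableSet (jumpEvent d n r) :=
  (measurableSet_le (measurable_jumpTime n) measurable_const).inter
    (measurableSet_lt measurable_const (measurable_jumpTime (n + 1)))

/-- The walk seen from time `r` on, on the event that `n` jumps have occurred up to time `r`. -/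
noncomputable def afterTime (n : ℕ) (r : ℝ) (w : WalkSpace d) : WalkSpace d :=
  cons ((jumpTime w (n + 1) - r, (w n).2), fun i => w (n + 1 + i))

theorem measurable_afterTime (n : ℕ) (r : ℝ) : Measurable (afterTime (d := d) n r) := by
  refine measurable_cons.comp (Measurable.prodMk (Measurable.prodMk ?_ ?_) ?_)
  · exact (measurable_jumpTime (n + 1)).sub_const r
  · exact measurable_snd.comp (measurable_pi_apply n)
  · exact measurable_pi_iff.2 fun i => measurable_pi_apply _

/-- The Markov property on the event that no jump has occurred up to time `r`. -/
theorem setLIntegral_jumpEvent_zero [NeZero d] {Ψ : WalkSpace d → ℝ≥0∞} (hΨ : Measurable Ψ)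
    {r : ℝ} (hr : 0 ≤ r) :
    ∫⁻ w in jumpEvent d 0 r, Ψ (afterTime 0 r w) ∂walkLaw d
      = ENNReal.ofReal (Real.exp (-r)) * ∫⁻ w, Ψ w ∂walkLaw d := by
  have : IsProbabilityMeasure (expMeasure 1) := isProbabilityMeasure_expMeasure one_pos
  set Ψ' : ℝ × (Fin d × Bool) → ℝ≥0∞ := fun p => ∫⁻ w, Ψ (cons (p, w)) ∂walkLaw d with hΨ'
  have hΨm : Measurable Ψ' := Measurable.lintegral_prod_right' (hΨ.comp measurable_cons)
  have hm : Measurable ((jumpEvent d 0 r).indicator fun w => Ψ (afterTime 0 r w)) :=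
    (hΨ.comp (measurable_afterTime _ _)).indicator (measurableSet_jumpEvent _ _)
  rw [lintegral_walkLaw hΨ, ← lintegral_indicator (measurableSet_jumpEvent _ _),
    lintegral_walkLaw hm]
  have h1 : ∀ p : ℝ × (Fin d × Bool), ∫⁻ w, (jumpEvent d 0 r).indicator
      (fun w => Ψ (afterTime 0 r w)) (cons (p, w)) ∂walkLaw d
      = (Set.Ioi r).indicator (fun τ => Ψ' (τ - r, p.2)) p.1 := by
    intro p
    by_cases hp : r < p.1
    · rw [Set.indicator_of_mem (by exact hp)]
      refine lintegral_congr fun w => ?_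
      rw [Set.indicator_of_mem (by simpa [jumpEvent, jumpTime, hr] using hp)]
      congr 1
      unfold afterTime
      congr 1
      refine Prod.ext (Prod.ext ?_ rfl) ?_
      · simp [jumpTime]
      · funext i
        simp only
        rw [show 0 + 1 + i = i + 1 by ring, cons_succ]
    · rw [Set.indicator_of_notMem (by exact hp), ← lintegral_zero]
      refine lintegral_congr fun w => ?_
      rw [Set.indicator_of_notMem (by simpa [jumpEvent, jumpTime, hr] using hp)]
  rw [lintegral_congr h1]
  have h2 : Measurable fun p : ℝ × (Fin d × Bool) =>
      (Set.Ioi r).indicator (fun τ => Ψ' (τ - r, p.2)) p.1 := by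
    have h3 : Measurable fun p : ℝ × (Fin d × Bool) => Ψ' (p.1 - r, p.2) :=
      hΨm.comp ((measurable_fst.sub_const r).prodMk measurable_snd)
    exact h3.indicator (measurable_fst measurableSet_Ioi)
  unfold stepLaw
  rw [lintegral_prod_symm _ h2.aemeasurable, lintegral_prod_symm _ hΨm.aemeasurable,
    ← lintegral_const_mul _ (Measurable.lintegral_prod_left' hΨm)]
  refine lintegral_congr fun a => ?_
  refine (lintegral_indicator measurableSet_Ioi fun τ => Ψ' (τ - r, a)).trans ?_
  exact setLIntegral_Ioi_expMeasure (F := fun τ => Ψ' (τ, a))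
    (hΨm.comp (measurable_id.prodMk measurable_const)) hr

theorem walkLaw_jumpEvent_zero [NeZero d] {r : ℝ} (hr : 0 ≤ r) :
    walkLaw d (jumpEvent d 0 r) = ENNReal.ofReal (Real.exp (-r)) := by
  simpa using setLIntegral_jumpEvent_zero (d := d) (Ψ := fun _ => 1) measurable_const hr

/-- The Markov property on the event that exactly `n` jumps have occurred up to time `r`, by
induction on `n` through the decomposition at the first jump. Here `Φ` depends on the first `n`
holding times and jumps only. -/
theorem markov_jumpEvent [NeZero d] {Ψ : WalkSpace d → ℝ≥0∞} (hΨ : Measurable Ψ) (n : ℕ) :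
    ∀ (r : ℝ) (Φ : WalkSpace d → ℝ≥0∞), Measurable Φ →
      (∀ w w' : WalkSpace d, (∀ i < n, w i = w' i) → Φ w = Φ w') →
      ∫⁻ w in jumpEvent d n r, Φ w * Ψ (afterTime n r w) ∂walkLaw d
        = (∫⁻ w in jumpEvent d n r, Φ w ∂walkLaw d) * ∫⁻ w, Ψ w ∂walkLaw d := by
  induction n with
  | zero =>
    intro r Φ hΦ hΦc
    have hc : ∀ w, Φ w = Φ fun _ => (0, (0, true)) := fun w => hΦc _ _ (by simp)
    generalize Φ (fun _ => (0, (0, true))) = c at hc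
    have hm : Measurable fun w => Ψ (afterTime 0 r w) := hΨ.comp (measurable_afterTime _ _)
    simp only [hc]
    rw [lintegral_const_mul _ hm, lintegral_const,
      Measure.restrict_apply_univ]
    rcases lt_or_ge r 0 with hr | hr
    · have : jumpEvent d 0 r = ∅ := by
        ext w
        simp [jumpEvent, hr]
      simp [this]
    · rw [setLIntegral_jumpEvent_zero hΨ hr, walkLaw_jumpEvent_zero hr, mul_assoc]
  | succ n ih =>
    intro r Φ hΦ hΦc
    have hm1 : Measurable fun w => (jumpEvent d (n + 1) r).indicator
        (fun w => Φ w * Ψ (afterTime (n + 1) r w)) w :=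
      (hΦ.mul (hΨ.comp (measurable_afterTime _ _))).indicator (measurableSet_jumpEvent _ _)
    have hm2 : Measurable fun w => (jumpEvent d (n + 1) r).indicator Φ w :=
      hΦ.indicator (measurableSet_jumpEvent _ _)
    have hm3 : Measurable fun p => ∫⁻ w, (jumpEvent d (n + 1) r).indicator Φ (cons (p, w))
        ∂walkLaw d := Measurable.lintegral_prod_right' (hm2.comp measurable_cons)
    have hmem : ∀ (p : ℝ × (Fin d × Bool)) (w : WalkSpace d),
        cons (p, w) ∈ jumpEvent d (n + 1) r ↔ w ∈ jumpEvent d n (r - p.1) := by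
      intro p w
      simp only [jumpEvent, Set.mem_ofPred_eq, jumpTime_cons_succ]
      constructor <;> rintro ⟨h1, h2⟩ <;> constructor <;> linarith
    have hafter : ∀ (p : ℝ × (Fin d × Bool)) (w : WalkSpace d),
        afterTime (n + 1) r (cons (p, w)) = afterTime n (r - p.1) w := by
      intro p w
      unfold afterTime
      congr 1
      refine Prod.ext (Prod.ext ?_ rfl) ?_
      · simp only [jumpTime_cons_succ]
        ring
      · funext i
        simp only
        rw [show n + 1 + 1 + i = (n + 1 + i) + 1 by ring, cons_succ]
    rw [← lintegral_indicator (measurableSet_jumpEvent _ _), lintegral_walkLaw hm1,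
      ← lintegral_indicator (measurableSet_jumpEvent _ _), lintegral_walkLaw hm2,
      ← lintegral_mul_const _ hm3]
    refine lintegral_congr fun p => ?_
    have h1 := ih (r - p.1) (fun w => Φ (cons (p, w)))
      (hΦ.comp (measurable_cons.comp (measurable_const.prodMk measurable_id))) (by
        intro w w' h
        refine hΦc _ _ fun i hi => ?_
        cases i with
        | zero => rfl
        | succ i => exact h i (by omega))
    rw [← lintegral_indicator (measurableSet_jumpEvent _ _),
      ← lintegral_indicator (measurableSet_jumpEvent _ _)] at h1
    have h2 : ∀ w, (jumpEvent d (n + 1) r).indicator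
        (fun w => Φ w * Ψ (afterTime (n + 1) r w)) (cons (p, w))
        = (jumpEvent d n (r - p.1)).indicator
          (fun w => Φ (cons (p, w)) * Ψ (afterTime n (r - p.1) w)) w := by
      intro w
      by_cases h : w ∈ jumpEvent d n (r - p.1)
      · rw [Set.indicator_of_mem h, Set.indicator_of_mem ((hmem p w).2 h), hafter]
      · rw [Set.indicator_of_notMem h, Set.indicator_of_notMem (mt (hmem p w).1 h)]
    have h3 : ∀ w, (jumpEvent d (n + 1) r).indicator Φ (cons (p, w))
        = (jumpEvent d n (r - p.1)).indicator (fun w => Φ (cons (p, w))) w := by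
      intro w
      by_cases h : w ∈ jumpEvent d n (r - p.1)
      · rw [Set.indicator_of_mem h, Set.indicator_of_mem ((hmem p w).2 h)]
      · rw [Set.indicator_of_notMem h, Set.indicator_of_notMem (mt (hmem p w).1 h)]
    simp_rw [h2, h3]
    exact h1

theorem IsRegular.monotone_jumpTime {w : WalkSpace d} (hw : IsRegular w) :
    Monotone (jumpTime w) :=
  monotone_nat_of_le_succ fun n => by rw [jumpTime_succ]; linarith [hw.1 n]

theorem exists_mem_jumpEvent {w : WalkSpace d} (hw : IsRegular w) {r : ℝ} (hr : 0 ≤ r) :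
    ∃ n, w ∈ jumpEvent d n r := by
  classical
  have h := hw.2 r
  have h0 : Nat.find h ≠ 0 := by
    intro h0
    have := Nat.find_spec h
    rw [h0, jumpTime_zero] at this
    linarith
  obtain ⟨n, hn⟩ := Nat.exists_eq_succ_of_ne_zero h0
  refine ⟨n, ?_, ?_⟩
  · exact not_lt.1 (Nat.find_min h (m := n) (by omega))
  · have := Nat.find_spec h
    rwa [hn] at this

theorem jumpEvent_unique {w : WalkSpace d} (hw : IsRegular w) {r : ℝ} {m n : ℕ}
    (hm : w ∈ jumpEvent d m r) (hn : w ∈ jumpEvent d n r) : m = n := by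
  rcases lt_trichotomy m n with h | h | h
  · have := hw.monotone_jumpTime (show m + 1 ≤ n from h)
    exact absurd (hm.2.trans_le (this.trans hn.1)) (lt_irrefl _)
  · exact h
  · have := hw.monotone_jumpTime (show n + 1 ≤ m from h)
    exact absurd (hn.2.trans_le (this.trans hm.1)) (lt_irrefl _)

theorem lintegral_eq_tsum_jumpEvent [NeZero d] (F : WalkSpace d → ℝ≥0∞) {r : ℝ} (hr : 0 ≤ r) :
    ∫⁻ w, F w ∂walkLaw d = ∑' n, ∫⁻ w in jumpEvent d n r, F w ∂walkLaw d := by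
  rw [← lintegral_iUnion₀ (fun n => (measurableSet_jumpEvent n r).nullMeasurableSet)]
  · have : (⋃ n, jumpEvent d n r) =ᵐ[walkLaw d] Set.univ := by
      refine eventuallyEq_univ.2 ?_
      filter_upwards [ae_isRegular] with w hw
      exact Set.mem_iUnion.2 (exists_mem_jumpEvent hw hr)
    rw [setLIntegral_congr this, setLIntegral_univ]
  · intro m n hmn
    refine measure_mono_null (fun w hw => ?_) (ae_iff.1 (ae_isRegular (d := d)))
    exact fun hreg => hmn (jumpEvent_unique hreg hw.1 hw.2)

/-- Keep the first `n` holding times and jumps and make the remaining holding times exceed `r`. -/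
noncomputable def truncate [NeZero d] (n : ℕ) (r : ℝ) (w : WalkSpace d) : WalkSpace d :=
  fun i => if i < n then w i else (|r| + 1, (0, true))

theorem measurable_truncate [NeZero d] (n : ℕ) (r : ℝ) : Measurable (truncate (d := d) n r) := by
  refine measurable_pi_iff.2 fun i => ?_
  unfold truncate
  split_ifs
  exacts [measurable_pi_apply i, measurable_const]

/-- The Markov property of the walk at time `r`, for a functional `Φ` of the past and a
functional `Ψ` of the future. -/
theorem markov [NeZero d] {r : ℝ} (hr : 0 ≤ r) {F Φ Ψ : WalkSpace d → ℝ≥0∞}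
    (hΦ : Measurable Φ) (hΨ : Measurable Ψ)
    (hpast : ∀ n w, IsRegular w → w ∈ jumpEvent d n r → Φ (truncate n r w) = Φ w)
    (hF : ∀ n w, IsRegular w → w ∈ jumpEvent d n r → F w = Φ w * Ψ (afterTime n r w)) :
    ∫⁻ w, F w ∂walkLaw d = (∫⁻ w, Φ w ∂walkLaw d) * ∫⁻ w, Ψ w ∂walkLaw d := by
  rw [lintegral_eq_tsum_jumpEvent F hr, lintegral_eq_tsum_jumpEvent Φ hr, ← ENNReal.tsum_mul_right]
  congr 1
  funext n
  have h1 := markov_jumpEvent hΨ n r (fun w => Φ (truncate n r w))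
    (hΦ.comp (measurable_truncate n r)) (by
      intro w w' h
      congr 1
      funext i
      unfold truncate
      split_ifs with hi
      exacts [h i hi, rfl])
  have hreg : ∀ᵐ w ∂(walkLaw d).restrict (jumpEvent d n r), IsRegular w :=
    ae_restrict_of_ae ae_isRegular
  have hmem := ae_restrict_mem (μ := walkLaw d) (measurableSet_jumpEvent (d := d) n r)
  have h2 : ∫⁻ w in jumpEvent d n r, F w ∂walkLaw d
      = ∫⁻ w in jumpEvent d n r, Φ (truncate n r w) * Ψ (afterTime n r w) ∂walkLaw d := by
    refine lintegral_congr_ae ?_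
    filter_upwards [hreg, hmem] with w hw hwm
    rw [hpast n w hw hwm, hF n w hw hwm]
  have h3 : ∫⁻ w in jumpEvent d n r, Φ w ∂walkLaw d
      = ∫⁻ w in jumpEvent d n r, Φ (truncate n r w) ∂walkLaw d := by
    refine lintegral_congr_ae ?_
    filter_upwards [hreg, hmem] with w hw hwm
    rw [hpast n w hw hwm]
  rw [h2, h3, h1]

theorem jumpCount_def (w : WalkSpace d) (r : ℝ) :
    jumpCount w r = sInf {n | r < jumpTime w (n + 1)} := rfl

theorem jumpCount_eq {w : WalkSpace d} {r : ℝ} {n : ℕ} (h1 : ∀ k < n, jumpTime w (k + 1) ≤ r)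
    (h2 : r < jumpTime w (n + 1)) : jumpCount w r = n := by
  rw [jumpCount_def]
  refine le_antisymm (Nat.sInf_le h2) ?_
  by_contra! h
  have h3 : r < jumpTime w (sInf {n | r < jumpTime w (n + 1)} + 1) :=
    Nat.sInf_mem (s := {n | r < jumpTime w (n + 1)}) ⟨n, h2⟩
  exact absurd h3 (not_lt.2 (h1 _ h))

theorem jumpTime_le_of_lt_jumpCount {w : WalkSpace d} {r : ℝ} {k : ℕ} (hk : k < jumpCount w r) :
    jumpTime w (k + 1) ≤ r :=
  not_lt.1 (Nat.notMem_of_lt_sInf hk)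

theorem lt_jumpTime_jumpCount {w : WalkSpace d} {r : ℝ} {n : ℕ} (h : r < jumpTime w (n + 1)) :
    r < jumpTime w (jumpCount w r + 1) := Nat.sInf_mem (s := {n | r < jumpTime w (n + 1)}) ⟨n, h⟩

theorem jumpCount_le {w : WalkSpace d} {r : ℝ} {n : ℕ} (h : r < jumpTime w (n + 1)) :
    jumpCount w r ≤ n := Nat.sInf_le h

theorem IsRegular.jumpCount_eq {w : WalkSpace d} (hw : IsRegular w) {r : ℝ} {n : ℕ}
    (h : w ∈ jumpEvent d n r) : jumpCount w r = n :=
  PAM.jumpCount_eq (fun _ hk => (hw.monotone_jumpTime hk).trans h.1) h.2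

theorem jumpTime_truncate [NeZero d] {n : ℕ} (r : ℝ) (w : WalkSpace d) {k : ℕ} (hk : k ≤ n) :
    jumpTime (truncate n r w) k = jumpTime w k := by
  refine Finset.sum_congr rfl fun i hi => ?_
  rw [truncate, if_pos ((Finset.mem_range.1 hi).trans_le hk)]

/-- Up to time `t` the walk is determined by the jumps that have occurred by time `t`. -/
theorem walk_truncate [NeZero d] {w : WalkSpace d} (hw : IsRegular w) {n : ℕ} {κ s t : ℝ}
    (hκ : 0 ≤ κ) (hst : s ≤ t) (h : w ∈ jumpEvent d n (2 * d * κ * t)) :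
    walk κ (truncate n (2 * d * κ * t) w) s = walk κ w s := by
  set r := 2 * d * κ * t
  have hsr : 2 * d * κ * s ≤ r := mul_le_mul_of_nonneg_left hst (by positivity)
  have h1 : 2 * d * κ * s < jumpTime w (n + 1) := hsr.trans_lt h.2
  have h2 : jumpCount w (2 * d * κ * s) ≤ n := jumpCount_le h1
  have h3 : jumpCount (truncate n r w) (2 * d * κ * s) = jumpCount w (2 * d * κ * s) := by
    refine PAM.jumpCount_eq (fun k hk => ?_) ?_
    · rw [jumpTime_truncate _ _ (by omega)]
      exact jumpTime_le_of_lt_jumpCount hk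
    · rcases h2.lt_or_eq with h2 | h2
      · rw [jumpTime_truncate _ _ (by omega)]
        exact lt_jumpTime_jumpCount h1
      · rw [h2, jumpTime_succ, jumpTime_truncate _ _ le_rfl, truncate, if_neg (lt_irrefl _)]
        have h4 : 0 ≤ jumpTime w n := hw.monotone_jumpTime n.zero_le
        have h5 := le_abs_self r
        simp only
        linarith
  unfold walk
  rw [h3]
  refine Finset.sum_congr rfl fun i hi => ?_
  rw [truncate, if_pos ((Finset.mem_range.1 hi).trans_le h2)]

theorem jumpTime_afterTime (n : ℕ) (r : ℝ) (w : WalkSpace d) (k : ℕ) :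
    jumpTime (afterTime n r w) (k + 1) = jumpTime w (n + k + 1) - r := by
  induction k with
  | zero => simp [jumpTime, afterTime]
  | succ k ih =>
    rw [jumpTime_succ, ih, show n + (k + 1) + 1 = (n + k + 1) + 1 by ring,
      jumpTime_succ w (n + k + 1)]
    simp only [afterTime, cons_succ]
    rw [show n + 1 + k = n + k + 1 by ring]
    ring

theorem jumpCount_afterTime {w : WalkSpace d} (hw : IsRegular w) {n : ℕ} {r v : ℝ} (hv : 0 ≤ v)
    (h : w ∈ jumpEvent d n r) :
    jumpCount w (r + v) = n + jumpCount (afterTime n r w) v := by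
  obtain ⟨m, hm⟩ := exists_mem_jumpEvent hw (r := r + v)
    (by linarith [h.1, hw.monotone_jumpTime n.zero_le, jumpTime_zero w])
  have hnm : n ≤ m := by
    by_contra! hlt
    have := hw.monotone_jumpTime (show m + 1 ≤ n from hlt)
    linarith [hm.2, h.1]
  obtain ⟨k, rfl⟩ := Nat.exists_eq_add_of_le hnm
  rw [hw.jumpCount_eq hm]
  congr 1
  refine (PAM.jumpCount_eq (fun j hj => ?_) ?_).symm
  · rw [jumpTime_afterTime]
    have := hw.monotone_jumpTime (show n + j + 1 ≤ n + k by omega)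
    linarith [hm.1]
  · rw [jumpTime_afterTime]
    linarith [hm.2]

/-- After time `s` the walk moves as the walk with the data `afterTime`. -/
theorem walk_add {w : WalkSpace d} (hw : IsRegular w) {n : ℕ} {κ s v : ℝ} (hκ : 0 ≤ κ)
    (hv : 0 ≤ v) (h : w ∈ jumpEvent d n (2 * d * κ * s)) :
    walk κ w (s + v) = walk κ w s + walk κ (afterTime n (2 * d * κ * s) w) v := by
  unfold walk
  rw [mul_add, jumpCount_afterTime hw (by positivity) h, hw.jumpCount_eq h,
    Finset.sum_range_add]
  congr 1
  refine Finset.sum_congr rfl fun i _ => ?_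
  cases i with
  | zero => rfl
  | succ i => rw [afterTime, cons_succ, add_comm i 1, ← add_assoc]

theorem measurable_jumpCount : Measurable fun p : WalkSpace d × ℝ => jumpCount p.1 p.2 := by
  refine measurable_to_countable' fun n => ?_
  have hA : ∀ k, MeasurableSet {p : WalkSpace d × ℝ | p.2 < jumpTime p.1 (k + 1)} := fun k =>
    measurableSet_lt measurable_snd ((measurable_jumpTime (k + 1)).comp measurable_fst)
  -- The second set accounts for `sInf ∅ = 0`, when all jump times are at most `r`.
  have h : (fun p : WalkSpace d × ℝ => jumpCount p.1 p.2) ⁻¹' {n}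
      = ({p | p.2 < jumpTime p.1 (n + 1)} ∩ ⋂ k, ⋂ _ : k < n, {p | p.2 < jumpTime p.1 (k + 1)}ᶜ) ∪
        ({_p | n = 0} ∩ ⋂ k, {p | p.2 < jumpTime p.1 (k + 1)}ᶜ) := by
    ext p
    simp only [Set.mem_preimage, Set.mem_singleton_iff, Set.mem_union, Set.mem_inter_iff,
      Set.mem_ofPred_eq, Set.mem_iInter, Set.mem_compl_iff, not_lt]
    constructor
    · rintro rfl
      by_cases hex : ∃ k, p.2 < jumpTime p.1 (k + 1)
      · obtain ⟨k, hk⟩ := hex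
        exact Or.inl ⟨lt_jumpTime_jumpCount hk, fun _ => jumpTime_le_of_lt_jumpCount⟩
      · refine Or.inr ⟨?_, by simpa using hex⟩
        rw [jumpCount_def, Nat.sInf_eq_zero]
        refine Or.inr (Set.eq_empty_of_forall_notMem fun k hk => hex ⟨k, hk⟩)
    · rintro (⟨h1, h2⟩ | ⟨rfl, h⟩)
      · exact PAM.jumpCount_eq h2 h1
      · rw [jumpCount_def, Nat.sInf_eq_zero]
        exact Or.inr (Set.eq_empty_of_forall_notMem fun k hk => absurd hk (not_lt.2 (h k)))
  rw [h]
  refine ((hA n).inter (MeasurableSet.iInter fun k => MeasurableSet.iInter fun _ =>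
    (hA k).compl)).union (MeasurableSet.inter ?_ (MeasurableSet.iInter fun k => (hA k).compl))
  exact MeasurableSet.const _

theorem measurable_walk (κ : ℝ) : Measurable fun p : WalkSpace d × ℝ => walk κ p.1 p.2 := by
  have h1 : Measurable fun q : ℕ × WalkSpace d =>
      (∑ i ∈ Finset.range q.1, step (q.2 i).2 : Lattice d) := by
    refine measurable_from_prod_countable_right fun n => ?_
    refine Finset.measurable_sum (f := fun i (w : WalkSpace d) => (step (w i).2 : Lattice d))
      (Finset.range n) fun i _ => ?_
    have h2 : Measurable (step : Fin d × Bool → Lattice d) := measurable_of_countable _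
    exact h2.comp (measurable_snd.comp (measurable_pi_apply i))
  have h2 : Measurable fun p : WalkSpace d × ℝ => jumpCount p.1 (2 * d * κ * p.2) :=
    measurable_jumpCount.comp (measurable_fst.prodMk (measurable_snd.const_mul _))
  exact h1.comp (h2.prodMk measurable_fst)

end Walk

/-! ### Feynman-Kac functionals -/

section Kernel

variable {d : ℕ}

/-- The Feynman-Kac weight of the paths from `x` to `y` in time `t` in the potential `f`, where
`f z s` is the potential met by a path that is at `z` at time `s`. -/
noncomputable def feynmanKac [NeZero d] (κ : ℝ) (f : Lattice d → ℝ → ℝ) (x y : Lattice d) (t : ℝ) :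
    ℝ≥0∞ :=
  ∫⁻ w, ENNReal.ofReal (Real.exp (∫ s in (0 : ℝ)..t, f (x + walk κ w s) s)
    * (if x + walk κ w t = y then 1 else 0)) ∂walkLaw d

theorem measurable_intervalIntegral {α : Type*} [MeasurableSpace α] {g : α → ℝ → ℝ}
    (hg : Measurable (Function.uncurry g)) (a b : ℝ) : Measurable fun x => ∫ s in a..b, g x s := by
  simp only [intervalIntegral]
  exact (hg.stronglyMeasurable.integral_prod_right
      (ν := volume.restrict (Set.Ioc a b))).measurable.sub
    (hg.stronglyMeasurable.integral_prod_right (ν := volume.restrict (Set.Ioc b a))).measurable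

/-- A random potential is jointly measurable along a random walk. -/
theorem measurable_along_walk {α : Type*} [MeasurableSpace α] {W : α → WalkSpace d}
    (hW : Measurable W) {g : α → Lattice d → ℝ → ℝ}
    (hg : ∀ y, Measurable fun p : α × ℝ => g p.1 y p.2) (κ : ℝ) (x : Lattice d) :
    Measurable fun p : α × ℝ => g p.1 (x + walk κ (W p.1) p.2) p.2 := by
  have h1 : Measurable fun q : Lattice d × (α × ℝ) => g q.2.1 (x + q.1) q.2.2 :=
    measurable_from_prod_countable_right fun y => hg (x + y)
  have h2 : Measurable fun p : α × ℝ => walk κ (W p.1) p.2 :=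
    (measurable_walk κ).comp ((hW.comp measurable_fst).prodMk measurable_snd)
  exact h1.comp (h2.prodMk measurable_id)

theorem measurable_walk_const (κ t : ℝ) : Measurable fun w : WalkSpace d => walk κ w t :=
  (measurable_walk κ).comp (measurable_id.prodMk measurable_const)

theorem measurable_feynmanKac_integrand {α : Type*} [MeasurableSpace α] {W : α → WalkSpace d}
    (hW : Measurable W) {g : α → Lattice d → ℝ → ℝ}
    (hg : ∀ y, Measurable fun p : α × ℝ => g p.1 y p.2) (κ : ℝ) (x y : Lattice d) (t : ℝ) :
    Measurable fun p : α => ENNReal.ofReal (Real.exp (∫ s in (0 : ℝ)..t,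
      g p (x + walk κ (W p) s) s) * (if x + walk κ (W p) t = y then 1 else 0)) := by
  have h1 : Measurable fun p : α => ∫ s in (0 : ℝ)..t, g p (x + walk κ (W p) s) s :=
    measurable_intervalIntegral (g := fun (p : α) s => g p (x + walk κ (W p) s) s)
      (measurable_along_walk hW hg κ x) 0 t
  have h2 : Measurable fun p : α => (if x + walk κ (W p) t = y then 1 else 0 : ℝ) := by
    have h3 : Measurable fun z : Lattice d => (if x + z = y then 1 else 0 : ℝ) :=
      measurable_of_countable _
    exact h3.comp ((measurable_walk_const κ t).comp hW)
  exact (h1.exp.mul h2).ennreal_ofReal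

theorem IsRegular.exists_finset_walk_mem {w : WalkSpace d} (hw : IsRegular w) {κ : ℝ} (hκ : 0 ≤ κ)
    (t : ℝ) : ∃ A : Finset (Lattice d), ∀ s ≤ t, walk κ w s ∈ A := by
  classical
  obtain ⟨n, hn⟩ := hw.2 (2 * d * κ * t)
  refine ⟨(Finset.range (n + 1)).image fun m => ∑ i ∈ Finset.range m, step (w i).2, fun s hs => ?_⟩
  refine Finset.mem_image.2 ⟨jumpCount w (2 * d * κ * s), ?_, rfl⟩
  have h1 : 2 * d * κ * s ≤ 2 * d * κ * t := mul_le_mul_of_nonneg_left hs (by positivity)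
  have h2 : 2 * d * κ * s < jumpTime w (n + 1) :=
    (h1.trans_lt hn).trans_le (hw.monotone_jumpTime n.le_succ)
  exact Finset.mem_range.2 (Nat.lt_succ_of_le (jumpCount_le h2))

theorem IsRegular.intervalIntegrable_walk {w : WalkSpace d} (hw : IsRegular w) {κ : ℝ}
    (hκ : 0 ≤ κ) {f : Lattice d → ℝ → ℝ} (hf : ∀ y, Measurable (f y))
    (hfi : ∀ y a b, IntervalIntegrable (f y) volume a b) (x : Lattice d) (a b : ℝ) :
    IntervalIntegrable (fun s => f (x + walk κ w s) s) volume a b := by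
  obtain ⟨A, hA⟩ := hw.exists_finset_walk_mem hκ (max a b)
  have hm : Measurable fun s => f (x + walk κ w s) s := by
    have h : Measurable fun q : Lattice d × ℝ => f (x + q.1) q.2 :=
      measurable_from_prod_countable_right fun y => hf (x + y)
    exact h.comp (((measurable_walk κ).comp (measurable_const.prodMk measurable_id)).prodMk
      measurable_id)
  have hsum : IntervalIntegrable (fun s => ∑ y ∈ A, |f (x + y) s|) volume a b := by
    have h := IntervalIntegrable.sum A (f := fun y s => |f (x + y) s|) (μ := volume) (a := a)
      (b := b) fun y _ => (hfi (x + y) a b).abs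
    simpa only [Finset.sum_fn] using h
  refine hsum.mono_fun' hm.aestronglyMeasurable ?_
  refine (ae_restrict_iff' measurableSet_uIoc).2 (ae_of_all _ fun s hs => ?_)
  simp only [Real.norm_eq_abs]
  exact Finset.single_le_sum (f := fun y => |f (x + y) s|) (fun y _ => abs_nonneg _)
    (hA s (Set.mem_uIoc.1 hs |>.elim (fun h => h.2.trans (le_max_right _ _))
      fun h => h.2.trans (le_max_left _ _)))

/-- Half of the Chapman-Kolmogorov equation: only the paths that are at `y` at time `s` are kept on
the left. -/
theorem feynmanKac_mul_le [NeZero d] {κ : ℝ} (hκ : 0 ≤ κ) {f : Lattice d → ℝ → ℝ}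
    (hf : ∀ y, Measurable (f y)) (hfi : ∀ y a b, IntervalIntegrable (f y) volume a b)
    (x y z : Lattice d) {s t : ℝ} (hs : 0 ≤ s) (ht : 0 ≤ t) :
    feynmanKac κ f x y s * feynmanKac κ (fun u v => f u (s + v)) y z t
      ≤ feynmanKac κ f x z (s + t) := by
  have hf' : ∀ u, Measurable fun v => f u (s + v) := fun u =>
    (hf u).comp (measurable_id.const_add s)
  have hr : 0 ≤ 2 * d * κ * s := by positivity
  have h := markov hr (measurable_feynmanKac_integrand (W := fun w => w)
      (g := fun _ : WalkSpace d => f) measurable_id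
      (fun u => (hf u).comp measurable_snd) κ x y s)
    (measurable_feynmanKac_integrand (W := fun w => w)
      (g := fun _ : WalkSpace d => fun u v => f u (s + v)) measurable_id
      (fun u => (hf' u).comp measurable_snd) κ y z t)
    (F := fun w => if x + walk κ w s = y then
      ENNReal.ofReal (Real.exp (∫ v in (0 : ℝ)..(s + t), f (x + walk κ w v) v)
        * (if x + walk κ w (s + t) = z then 1 else 0)) else 0) ?_ ?_
  · unfold feynmanKac
    refine h.ge.trans (lintegral_mono fun w => ?_)
    dsimp only
    split_ifs <;> simp
  · intro n w hw hwn
    rw [walk_truncate hw hκ le_rfl hwn]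
    congr 3
    refine intervalIntegral.integral_congr fun v hv => ?_
    rw [Set.uIcc_of_le hs] at hv
    rw [walk_truncate hw hκ hv.2 hwn]
  · intro n w hw hwn
    by_cases hy : x + walk κ w s = y
    · have h1 : ∀ v, 0 ≤ v →
          x + walk κ w (s + v) = y + walk κ (afterTime n (2 * d * κ * s) w) v := by
        intro v hv
        rw [walk_add hw hκ hv hwn, ← add_assoc, hy]
      have hint := hw.intervalIntegrable_walk hκ hf hfi x
      have h2 : ∫ v in (0 : ℝ)..(s + t), f (x + walk κ w v) v
          = (∫ v in (0 : ℝ)..s, f (x + walk κ w v) v)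
            + ∫ v in (0 : ℝ)..t, f (y + walk κ (afterTime n (2 * d * κ * s) w) v) (s + v) := by
        rw [← intervalIntegral.integral_add_adjacent_intervals (hint 0 s) (hint s (s + t))]
        congr 1
        have h3 := intervalIntegral.integral_comp_add_left (a := 0) (b := t)
          (fun v => f (x + walk κ w v) v) s
        rw [add_zero] at h3
        rw [← h3]
        refine intervalIntegral.integral_congr fun v hv => ?_
        rw [Set.uIcc_of_le ht] at hv
        rw [h1 v hv.1]
      rw [if_pos hy, if_pos hy, h2, h1 t ht, mul_one, ← ENNReal.ofReal_mul (Real.exp_pos _).le,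
        Real.exp_add, mul_assoc]
    · simp [hy]

/-- The contribution of the walks that do not jump up to time `t`. -/
theorem le_feynmanKac_self [NeZero d] {κ : ℝ} (hκ : 0 ≤ κ) (f : Lattice d → ℝ → ℝ)
    (x : Lattice d) {t : ℝ} (ht : 0 ≤ t) :
    ENNReal.ofReal (Real.exp ((∫ s in (0 : ℝ)..t, f x s) - 2 * d * κ * t))
      ≤ feynmanKac κ f x x t := by
  have hr : 0 ≤ 2 * d * κ * t := by positivity
  have hwalk : ∀ w ∈ jumpEvent d 0 (2 * d * κ * t), ∀ s ≤ t, walk κ w s = 0 := by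
    intro w hw s hs
    have h1 : 2 * d * κ * s ≤ 2 * d * κ * t := mul_le_mul_of_nonneg_left hs (by positivity)
    have h2 : jumpCount w (2 * d * κ * s) = 0 := Nat.le_zero.1 (jumpCount_le (h1.trans_lt hw.2))
    simp [walk, h2]
  calc _ = ∫⁻ w in jumpEvent d 0 (2 * d * κ * t),
          ENNReal.ofReal (Real.exp (∫ s in (0 : ℝ)..t, f x s)) ∂walkLaw d := by
        rw [lintegral_const, Measure.restrict_apply_univ, walkLaw_jumpEvent_zero hr,
          ← ENNReal.ofReal_mul (Real.exp_pos _).le, ← Real.exp_add, sub_eq_add_neg]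
    _ ≤ ∫⁻ w in jumpEvent d 0 (2 * d * κ * t),
          ENNReal.ofReal (Real.exp (∫ s in (0 : ℝ)..t, f (x + walk κ w s) s)
          * (if x + walk κ w t = x then 1 else 0)) ∂walkLaw d := by
        refine setLIntegral_mono' (measurableSet_jumpEvent _ _) fun w hw => ?_
        rw [hwalk w hw t le_rfl, add_zero, if_pos rfl, mul_one]
        refine le_of_eq ?_
        congr 2
        refine intervalIntegral.integral_congr fun s hs => ?_
        rw [Set.uIcc_of_le ht] at hs
        rw [hwalk w hw s hs.2, add_zero]
    _ ≤ _ := setLIntegral_le_lintegral _ _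

/-- The event that the walk of rate one makes the step `a` before time `r` and then rests for a
time longer than `r`. -/
def singleJump (a : Fin d × Bool) (r : ℝ) : Set (WalkSpace d) :=
  {w | ((w 0).1 ≤ r ∧ (w 0).2 = a) ∧ r < (w 1).1}

theorem walkLaw_singleJump_pos [NeZero d] (a : Fin d × Bool) {r : ℝ} (hr : 0 < r) :
    0 < walkLaw d (singleJump a r) := by
  have : IsProbabilityMeasure (expMeasure 1) := isProbabilityMeasure_expMeasure one_pos
  set t : ℕ → Set (ℝ × (Fin d × Bool)) :=
    fun i => if i = 0 then Set.Iic r ×ˢ {a} else Set.Ioi r ×ˢ Set.univ with ht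
  have h1 : singleJump a r = Set.pi (({0, 1} : Finset ℕ) : Set ℕ) t := by
    ext w
    simp [singleJump, ht]
  have htm : ∀ i, MeasurableSet (t i) := by
    intro i
    simp only [ht]
    split_ifs
    · exact measurableSet_Iic.prod (measurableSet_singleton a)
    · exact measurableSet_Ioi.prod MeasurableSet.univ
  have h2 : 0 < expMeasure 1 (Set.Ioi r) := by
    rw [expMeasure_Ioi hr.le]
    simpa using Real.exp_pos _
  have h3 : 0 < expMeasure 1 (Set.Iic r) := by
    rw [← Set.compl_Ioi, prob_compl_eq_one_sub measurableSet_Ioi, expMeasure_Ioi hr.le]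
    refine tsub_pos_of_lt ?_
    rw [ENNReal.ofReal_lt_one]
    simpa using hr
  have h4 : 0 < uniformOn (Set.univ : Set (Fin d × Bool)) {a} := by
    rw [uniformOn_univ]
    simp [ENNReal.mul_eq_top]
  have h5 : walkLaw d (singleJump a r) = ∏ i ∈ ({0, 1} : Finset ℕ), stepLaw d (t i) := by
    rw [h1]
    exact Measure.infinitePi_pi _ fun i _ => htm i
  rw [h5, Finset.prod_pair zero_ne_one]
  simp only [ht, if_true, one_ne_zero, if_false, stepLaw, Measure.prod_prod, measure_univ, mul_one]
  exact ENNReal.mul_pos (ENNReal.mul_pos h3.ne' h4.ne').ne' h2.ne'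

/-- The contribution of the walks that make the step `a`, and no other, in unit time. -/
theorem mul_le_feynmanKac_step [NeZero d] {κ : ℝ} (hκ : 0 ≤ κ) {f : Lattice d → ℝ → ℝ}
    (hf : ∀ y, Measurable (f y)) (hfi : ∀ y a b, IntervalIntegrable (f y) volume a b)
    (x : Lattice d) (a : Fin d × Bool) :
    walkLaw d (singleJump a (2 * d * κ)) * ENNReal.ofReal (Real.exp
      (-((∫ s in (0 : ℝ)..1, |f x s|) + ∫ s in (0 : ℝ)..1, |f (x + step a) s|)))
      ≤ feynmanKac κ f x (x + step a) 1 := by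
  set r := 2 * d * κ with hrdef
  have hr : 0 ≤ r := by positivity
  have hm : MeasurableSet (singleJump a r) := by
    have h0 : Measurable fun w : WalkSpace d => (w 0).1 :=
      measurable_fst.comp (measurable_pi_apply 0)
    have h1 : Measurable fun w : WalkSpace d => (w 1).1 :=
      measurable_fst.comp (measurable_pi_apply 1)
    have h2 : Measurable fun w : WalkSpace d => (w 0).2 :=
      measurable_snd.comp (measurable_pi_apply 0)
    exact ((measurableSet_le h0 measurable_const).inter (h2 (measurableSet_singleton a))).inter
      (measurableSet_lt measurable_const h1)
  calc _ = ∫⁻ w in singleJump a r, ENNReal.ofReal (Real.exp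
      (-((∫ s in (0 : ℝ)..1, |f x s|) + ∫ s in (0 : ℝ)..1, |f (x + step a) s|))) ∂walkLaw d := by
        rw [lintegral_const, Measure.restrict_apply_univ, mul_comm]
    _ ≤ ∫⁻ w in singleJump a r,
          ENNReal.ofReal (Real.exp (∫ s in (0 : ℝ)..1, f (x + walk κ w s) s)
          * (if x + walk κ w 1 = x + step a then 1 else 0)) ∂walkLaw d := by
        refine lintegral_mono_ae ?_
        filter_upwards [ae_restrict_of_ae ae_isRegular, ae_restrict_mem hm] with w hw hwm
        obtain ⟨⟨h0, ha⟩, h1⟩ := hwm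
        have hpos := hw.1 0
        have h2 : r < jumpTime w 2 := by
          rw [jumpTime_succ, jumpTime_succ, jumpTime_zero]
          linarith
        have h3 : jumpCount w r = 1 := hw.jumpCount_eq ⟨by simpa [jumpTime] using h0, h2⟩
        have hstep : ∀ s ≤ 1, walk κ w s = 0 ∨ walk κ w s = step a := by
          intro s hs
          have h4 : r * s < jumpTime w (1 + 1) :=
            (mul_le_of_le_one_right hr hs).trans_lt h2
          have h5 := jumpCount_le h4
          unfold walk
          rw [← hrdef]
          interval_cases jumpCount w (r * s)
          · simp
          · simp [ha]
        have h6 : walk κ w 1 = step a := by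
          unfold walk
          rw [← hrdef, mul_one, h3]
          simp [ha]
        rw [h6, if_pos rfl, mul_one]
        refine ENNReal.ofReal_le_ofReal (Real.exp_le_exp.2 ?_)
        have hint := hw.intervalIntegrable_walk hκ hf hfi x 0 1
        rw [← intervalIntegral.integral_add (hfi x 0 1).abs (hfi (x + step a) 0 1).abs,
          ← intervalIntegral.integral_neg]
        refine intervalIntegral.integral_mono_on zero_le_one
          ((hfi x 0 1).abs.add (hfi (x + step a) 0 1).abs).neg hint fun s hs => ?_
        rcases hstep s hs.2 with h | h <;> rw [h]
        · rw [add_zero]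
          linarith [neg_abs_le (f x s), abs_nonneg (f (x + step a) s)]
        · linarith [neg_abs_le (f (x + step a) s), abs_nonneg (f x s)]
    _ ≤ _ := setLIntegral_le_lintegral _ _

end Kernel

/-! ### Functionals of a stationary family -/

section Covariance

variable {Ω X S ι β : Type*} [MeasurableSpace Ω] [MeasurableSpace X] [MeasurableSpace S]
  [MeasurableSpace β] {P : Measure Ω} {Y : ι → Ω → X}

/-- The random variables `A i` are, almost surely, one and the same measurable functional of the
random elements `Y i`. The exceptional null set may depend on `i`. -/
def IsCovariant (P : Measure Ω) (Y : ι → Ω → X) (A : ι → Ω → β) : Prop :=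
  ∃ g : X → β, Measurable g ∧ ∀ i, A i =ᵐ[P] fun ω => g (Y i ω)

theorem IsCovariant.comp {β' : Type*} [MeasurableSpace β'] {A : ι → Ω → β}
    (h : IsCovariant P Y A) {φ : β → β'} (hφ : Measurable φ) :
    IsCovariant P Y fun i ω => φ (A i ω) := by
  obtain ⟨g, hg, hA⟩ := h
  refine ⟨fun x => φ (g x), hφ.comp hg, fun i => ?_⟩
  filter_upwards [hA i] with ω hω
  rw [hω]

theorem IsCovariant.prodMk {β' : Type*} [MeasurableSpace β'] {A : ι → Ω → β} {A' : ι → Ω → β'}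
    (h : IsCovariant P Y A) (h' : IsCovariant P Y A') :
    IsCovariant P Y fun i ω => (A i ω, A' i ω) := by
  obtain ⟨g, hg, hA⟩ := h
  obtain ⟨g', hg', hA'⟩ := h'
  refine ⟨fun x => (g x, g' x), hg.prodMk hg', fun i => ?_⟩
  filter_upwards [hA i, hA' i] with ω hω hω'
  rw [hω, hω']

theorem IsCovariant.congr {A A' : ι → Ω → β} (h : IsCovariant P Y A)
    (hA : ∀ i, A' i =ᵐ[P] A i) : IsCovariant P Y A' := by
  obtain ⟨g, hg, hgA⟩ := h
  exact ⟨g, hg, fun i => (hA i).trans (hgA i)⟩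

theorem IsCovariant.iSup {A : ℕ → ι → Ω → ℝ≥0∞} (h : ∀ n, IsCovariant P Y (A n)) :
    IsCovariant P Y fun i ω => ⨆ n, A n i ω := by
  choose g hg hA using h
  refine ⟨fun x => ⨆ n, g n x, Measurable.iSup hg, fun i => ?_⟩
  filter_upwards [ae_all_iff.2 fun n => hA n i] with ω hω
  simp only [hω]

variable [IsProbabilityMeasure P] {μ : Measure X} [IsProbabilityMeasure μ]

/-- Integration over a parameter preserves covariance. The functionals `g s` that represent
`A i s` for fixed `s` need not be jointly measurable in `s` and `x`, so they cannot be integrated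
directly. Instead `∫ A i s dm(s)` turns out to be a function of `Y i` as its integral over any
event `F` depends on `F` only through the conditional probability given `Y i`; that function is
the density of a measure which does not depend on `i`. -/
theorem IsCovariant.lintegral_of_le (hY : ∀ i, Measurable (Y i)) (hμ : ∀ i, P.map (Y i) = μ)
    {m : Measure S} [IsFiniteMeasure m] {A : ι → S → Ω → ℝ≥0∞}
    (hA : ∀ i, Measurable fun p : S × Ω => A i p.1 p.2) {N : ℝ≥0} (hN : ∀ i s ω, A i s ω ≤ N)
    (h : ∀ᵐ s ∂m, IsCovariant P Y fun i => A i s) :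
    IsCovariant P Y fun i ω => ∫⁻ s, A i s ω ∂m := by
  rcases isEmpty_or_nonempty ι with hι | ⟨⟨i₀⟩⟩
  · exact ⟨fun _ => 0, measurable_const, fun i => isEmptyElim i⟩
  set B : ι → Ω → ℝ≥0∞ := fun i ω => ∫⁻ s, A i s ω ∂m with hB
  have hBm : ∀ i, Measurable (B i) := fun i => (hA i).lintegral_prod_left'
  have hBle : ∀ i ω, B i ω ≤ N * m Set.univ := by
    intro i ω
    calc B i ω ≤ ∫⁻ _, (N : ℝ≥0∞) ∂m := lintegral_mono fun s => hN i s ω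
      _ = _ := lintegral_const _
  have hswap : ∀ i (H : Ω → ℝ≥0∞), Measurable H →
      ∫⁻ ω, H ω * B i ω ∂P = ∫⁻ s, ∫⁻ ω, H ω * A i s ω ∂P ∂m := by
    intro i H hH
    rw [lintegral_lintegral_swap]
    · refine lintegral_congr fun ω => ?_
      have hm : Measurable fun s => A i s ω := (hA i).comp measurable_prodMk_right
      rw [lintegral_const_mul _ hm]
    · exact ((hH.comp measurable_snd).mul (hA i)).aemeasurable
  -- The measure `ν i` on `X` has density `E[B i | Y i]` with respect to `μ`.
  set ν : ι → Measure X := fun i => (P.withDensity (B i)).map (Y i) with hν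
  have hfin : ∀ i, IsFiniteMeasure (P.withDensity (B i)) := fun i => by
    refine isFiniteMeasure_withDensity (ne_top_of_le_ne_top ?_ (lintegral_mono (hBle i)))
    rw [lintegral_const]
    finiteness
  have hνac : ∀ i, ν i ≪ μ := by
    intro i
    rw [← hμ i]
    exact (withDensity_absolutelyContinuous P (B i)).map (hY i)
  have hνint : ∀ i (G : X → ℝ≥0∞), Measurable G →
      ∫⁻ x, G x ∂ν i = ∫⁻ s, ∫⁻ ω, G (Y i ω) * A i s ω ∂P ∂m := by
    intro i G hG
    have hGY : Measurable fun ω => G (Y i ω) := hG.comp (hY i)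
    rw [← hswap i _ hGY, hν, lintegral_map hG (hY i),
      lintegral_withDensity_eq_lintegral_mul _ (hBm i) hGY]
    simp only [Pi.mul_apply, mul_comm]
  have hνeq : ∀ i, ν i = ν i₀ := by
    intro i
    refine Measure.ext_of_lintegral _ fun G hG => ?_
    rw [hνint i G hG, hνint i₀ G hG]
    refine lintegral_congr_ae ?_
    filter_upwards [h] with s ⟨g, hg, hgA⟩
    have key : ∀ j, ∫⁻ ω, G (Y j ω) * A j s ω ∂P = ∫⁻ x, G x * g x ∂μ := by
      intro j
      rw [← hμ j, lintegral_map (f := fun x => G x * g x) (hG.mul hg) (hY j)]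
      refine lintegral_congr_ae ?_
      filter_upwards [hgA j] with ω hω
      rw [hω]
    rw [key, key]
  refine ⟨(ν i₀).rnDeriv μ, Measure.measurable_rnDeriv _ _, fun i => ?_⟩
  rw [← hνeq i]
  refine ae_eq_of_forall_setLIntegral_eq_of_sigmaFinite (hBm i)
    ((Measure.measurable_rnDeriv _ _).comp (hY i)) fun F hF _ => ?_
  -- Test against the event `F`, whose conditional probability given `Y i` is `h (Y i)`.
  set ρ : Measure X := (P.restrict F).map (Y i) with hρ
  have hρac : ρ ≪ μ := by
    rw [← hμ i]
    exact Measure.absolutelyContinuous_of_le Measure.restrict_le_self |>.map (hY i)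
  have hρint : ∀ G : X → ℝ≥0∞, Measurable G →
      ∫⁻ ω in F, G (Y i ω) ∂P = ∫⁻ ω, ρ.rnDeriv μ (Y i ω) * G (Y i ω) ∂P := by
    intro G hG
    rw [← lintegral_map hG (hY i), ← lintegral_map
      (f := fun x => ρ.rnDeriv μ x * G x) ((Measure.measurable_rnDeriv _ _).mul hG) (hY i), hμ i,
      lintegral_rnDeriv_mul hρac hG.aemeasurable]
  have hfinν : IsFiniteMeasure (ν i) := by
    rw [hν]
    infer_instance
  calc ∫⁻ ω in F, B i ω ∂P = ∫⁻ ω, F.indicator (fun _ => 1) ω * B i ω ∂P := by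
        rw [← lintegral_indicator hF]
        refine lintegral_congr fun ω => ?_
        by_cases hω : ω ∈ F <;> simp [hω]
    _ = ∫⁻ s, ∫⁻ ω, F.indicator (fun _ => 1) ω * A i s ω ∂P ∂m :=
        hswap i _ (measurable_const.indicator hF)
    _ = ∫⁻ s, ∫⁻ ω, ρ.rnDeriv μ (Y i ω) * A i s ω ∂P ∂m := by
        refine lintegral_congr_ae ?_
        filter_upwards [h] with s ⟨g, hg, hgA⟩
        have h1 : ∫⁻ ω, F.indicator (fun _ => 1) ω * A i s ω ∂P = ∫⁻ ω in F, g (Y i ω) ∂P := by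
          rw [← lintegral_indicator hF]
          refine lintegral_congr_ae ?_
          filter_upwards [hgA i] with ω hω
          by_cases hωF : ω ∈ F <;> simp [hωF, hω]
        rw [h1, hρint g hg]
        refine lintegral_congr_ae ?_
        filter_upwards [hgA i] with ω hω
        rw [hω]
    _ = ∫⁻ x, ρ.rnDeriv μ x ∂ν i := (hνint i _ (Measure.measurable_rnDeriv _ _)).symm
    _ = ∫⁻ x, (ν i).rnDeriv μ x * ρ.rnDeriv μ x ∂μ :=
        (lintegral_rnDeriv_mul (hνac i) (Measure.measurable_rnDeriv _ _).aemeasurable).symm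
    _ = ∫⁻ ω, (ν i).rnDeriv μ (Y i ω) * ρ.rnDeriv μ (Y i ω) ∂P := by
        rw [← hμ i, lintegral_map (f := fun x => (ν i).rnDeriv (P.map (Y i)) x *
          ρ.rnDeriv (P.map (Y i)) x) ((Measure.measurable_rnDeriv _ _).mul
          (Measure.measurable_rnDeriv _ _)) (hY i)]
    _ = ∫⁻ ω in F, (ν i).rnDeriv μ (Y i ω) ∂P := by
        rw [hρint _ (Measure.measurable_rnDeriv _ _)]
        simp only [mul_comm]

theorem IsCovariant.lintegral (hY : ∀ i, Measurable (Y i)) (hμ : ∀ i, P.map (Y i) = μ)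
    {m : Measure S} [IsFiniteMeasure m] {A : ι → S → Ω → ℝ≥0∞}
    (hA : ∀ i, Measurable fun p : S × Ω => A i p.1 p.2)
    (h : ∀ᵐ s ∂m, IsCovariant P Y fun i => A i s) :
    IsCovariant P Y fun i ω => ∫⁻ s, A i s ω ∂m := by
  have h1 : ∀ i ω, ∫⁻ s, A i s ω ∂m = ⨆ N : ℕ, ∫⁻ s, min (A i s ω) N ∂m := by
    intro i ω
    have hm : Measurable fun s => A i s ω := (hA i).comp measurable_prodMk_right
    rw [← lintegral_iSup (fun n => hm.min measurable_const)]
    · refine lintegral_congr fun s => ?_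
      rw [← inf_iSup_eq, ENNReal.iSup_natCast, inf_top_eq]
    · intro a b hab x
      dsimp only
      gcongr
  simp only [h1]
  refine IsCovariant.iSup fun N => ?_
  refine IsCovariant.lintegral_of_le hY hμ (A := fun i s ω => min (A i s ω) N) (N := N)
    (fun i => (hA i).min measurable_const) (fun i s ω => by simp) ?_
  filter_upwards [h] with s hs
  exact hs.comp (φ := fun a => min a (N : ℝ≥0∞)) (measurable_id.min measurable_const)

theorem IsCovariant.integral (hY : ∀ i, Measurable (Y i)) (hμ : ∀ i, P.map (Y i) = μ)
    {m : Measure S} [IsFiniteMeasure m] {A : ι → S → Ω → ℝ}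
    (hA : ∀ i, Measurable fun p : S × Ω => A i p.1 p.2)
    (h : ∀ᵐ s ∂m, IsCovariant P Y fun i => A i s)
    (hint : ∀ i, ∀ᵐ ω ∂P, Integrable (fun s => A i s ω) m) :
    IsCovariant P Y fun i ω => ∫ s, A i s ω ∂m := by
  have h1 := IsCovariant.lintegral hY hμ (A := fun i s ω => ENNReal.ofReal (A i s ω))
    (fun i => (hA i).ennreal_ofReal)
    (h.mono fun s hs => hs.comp (φ := ENNReal.ofReal) ENNReal.measurable_ofReal)
  have h2 := IsCovariant.lintegral hY hμ (A := fun i s ω => ENNReal.ofReal (-A i s ω))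
    (fun i => (hA i).neg.ennreal_ofReal)
    (h.mono fun s hs => hs.comp (φ := fun a => ENNReal.ofReal (-a))
      (ENNReal.measurable_ofReal.comp measurable_neg))
  refine ((h1.prodMk h2).comp (φ := fun q => q.1.toReal - q.2.toReal)
    (measurable_fst.ennreal_toReal.sub measurable_snd.ennreal_toReal)).congr fun i => ?_
  filter_upwards [hint i] with ω hω
  exact integral_eq_lintegral_pos_part_sub_lintegral_neg_part hω

end Covariance

/-! ### The fundamental solution in a stationary environment -/

section Field

variable {Ω : Type*} {d : ℕ} {ξ : Lattice d → ℝ≥0 → Ω → ℝ}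

/-- The field `ξ` seen from the space-time point `z`. -/
def shiftField (z : SpaceTime d) (ξ : Lattice d → ℝ≥0 → Ω → ℝ) : Lattice d → ℝ≥0 → Ω → ℝ :=
  fun x t ω => ξ (x + z.1) (t + z.2) ω

/-- The sample path of the field `ξ` seen from the space-time point `z`. -/
def path (ξ : Lattice d → ℝ≥0 → Ω → ℝ) (z : SpaceTime d) (ω : Ω) : SpaceTime d → ℝ :=
  fun p => shiftField z ξ p.1 p.2 ω

theorem shiftField_zero : shiftField 0 ξ = ξ := by
  funext x t ω
  simp [shiftField]

theorem shiftField_shiftField (z z' : SpaceTime d) :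
    shiftField z (shiftField z' ξ) = shiftField (z + z') ξ := by
  funext x t ω
  simp [shiftField, add_assoc]

theorem shift_path (z z' : SpaceTime d) (ω : Ω) : shift z (path ξ z' ω) = path ξ (z + z') ω := by
  funext p
  simp [shift, path, shiftField, add_assoc]

/-- The potential `(y, s) ↦ γ ξ(y, t - s)` met by a path that runs back from time `t`. -/
noncomputable def potential (ξ : Lattice d → ℝ≥0 → Ω → ℝ) (γ t : ℝ) (ω : Ω) :
    Lattice d → ℝ → ℝ :=
  fun y s => γ * ξ y (t - s).toNNReal ω

/-- The fundamental solution `u(x, y; t)` of the parabolic Anderson model, with initial condition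
`δ_y` and evaluated at `(x, t)`. -/
noncomputable def fundamental [NeZero d] (ξ : Lattice d → ℝ≥0 → Ω → ℝ) (κ γ : ℝ)
    (x y : Lattice d) (t : ℝ) (ω : Ω) : ℝ≥0∞ :=
  feynmanKac κ (potential ξ γ t ω) x y t

theorem solution_eq_fundamental [NeZero d] (κ γ : ℝ) (x : Lattice d) (t : ℝ) (ω : Ω) :
    solution ξ κ γ x t ω = fundamental ξ κ γ x 0 t ω := by
  unfold solution fundamental feynmanKac potential
  simp only [intervalIntegral.integral_const_mul]

theorem fundamental_shiftField_space [NeZero d] (κ γ : ℝ) (x y z : Lattice d) (t : ℝ) (ω : Ω) :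
    fundamental (shiftField (z, 0) ξ) κ γ x y t ω = fundamental ξ κ γ (x + z) (y + z) t ω := by
  unfold fundamental feynmanKac potential shiftField
  simp only [add_zero, add_right_comm x z, add_left_inj]

/-- The environment is integrable on bounded time intervals at every site. -/
def IsLocallyIntegrable (ξ : Lattice d → ℝ≥0 → Ω → ℝ) (ω : Ω) : Prop :=
  ∀ x a b, IntervalIntegrable (fun r : ℝ => ξ x r.toNNReal ω) volume a b

theorem IsLocallyIntegrable.potential {ω : Ω} (h : IsLocallyIntegrable ξ ω) (γ t : ℝ)
    (y : Lattice d) (a b : ℝ) : IntervalIntegrable (potential ξ γ t ω y) volume a b := by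
  have := (h y (t - a) (t - b)).comp_sub_left t
  simp only [sub_sub_cancel] at this
  exact this.const_mul γ

theorem feynmanKac_congr [NeZero d] {κ : ℝ} {f f' : Lattice d → ℝ → ℝ} {t : ℝ} (ht : 0 ≤ t)
    (h : ∀ y, ∀ s ∈ Set.Icc 0 t, f y s = f' y s) (x y : Lattice d) :
    feynmanKac κ f x y t = feynmanKac κ f' x y t := by
  unfold feynmanKac
  refine lintegral_congr fun w => ?_
  congr 3
  refine intervalIntegral.integral_congr fun s hs => ?_
  rw [Set.uIcc_of_le ht] at hs
  exact h _ s hs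

variable [MeasurableSpace Ω] {P : Measure Ω}

/-- A jointly measurable, stationary and integrable random field on `ℤ^d × [0,∞)`. -/
structure IsStationaryField (P : Measure Ω) (ξ : Lattice d → ℝ≥0 → Ω → ℝ) : Prop where
  measurable : ∀ x, Measurable (fun p : ℝ≥0 × Ω => ξ x p.1 p.2)
  stationary : IsStationary (fieldLaw P ξ)
  integrable : Integrable (ξ 0 0) P

theorem IsEnvironment.isStationaryField (hξ : IsEnvironment P ξ) : IsStationaryField P ξ :=
  ⟨hξ.measurable, hξ.stationary, hξ.integrable⟩

theorem measurable_shift (z : SpaceTime d) : Measurable (shift z) :=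
  measurable_pi_iff.2 fun p => measurable_pi_apply (p + z)

namespace IsStationaryField

theorem measurable_apply (hξ : IsStationaryField P ξ) (x : Lattice d) (t : ℝ≥0) :
    Measurable (ξ x t) := (hξ.measurable x).comp measurable_prodMk_left

theorem measurable_path (hξ : IsStationaryField P ξ) (z : SpaceTime d) :
    Measurable (path ξ z) :=
  measurable_pi_iff.2 fun p => hξ.measurable_apply (p.1 + z.1) (p.2 + z.2)

theorem fieldLaw_shiftField (hξ : IsStationaryField P ξ) (z : SpaceTime d) :
    fieldLaw P (shiftField z ξ) = fieldLaw P ξ := by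
  conv_rhs => rw [← hξ.stationary z]
  have h := hξ.measurable_path 0
  have h' : path ξ 0 = fun ω p => ξ p.1 p.2 ω := by
    funext ω p
    simp [path, shiftField]
  rw [h'] at h
  rw [fieldLaw, fieldLaw, Measure.map_map (measurable_shift z) h]
  rfl

theorem map_path (hξ : IsStationaryField P ξ) (z : SpaceTime d) :
    P.map (path ξ z) = fieldLaw P ξ := hξ.fieldLaw_shiftField z

theorem isProbabilityMeasure_fieldLaw [IsProbabilityMeasure P] (hξ : IsStationaryField P ξ) :
    IsProbabilityMeasure (fieldLaw P ξ) := by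
  rw [← hξ.map_path 0]
  exact Measure.isProbabilityMeasure_map (hξ.measurable_path 0).aemeasurable

theorem lintegral_enorm (hξ : IsStationaryField P ξ) (x : Lattice d) (t : ℝ≥0) :
    ∫⁻ ω, ‖ξ x t ω‖ₑ ∂P = ∫⁻ ω, ‖ξ 0 0 ω‖ₑ ∂P := by
  have key : ∀ z : SpaceTime d,
      ∫⁻ ω, ‖ξ z.1 z.2 ω‖ₑ ∂P = ∫⁻ f, ‖f 0‖ₑ ∂fieldLaw P ξ := by
    intro z
    rw [← hξ.map_path z, lintegral_map (measurable_pi_apply 0).enorm (hξ.measurable_path z)]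
    simp [path, shiftField]
  exact (key (x, t)).trans (key 0).symm

theorem integrable_apply (hξ : IsStationaryField P ξ) (x : Lattice d) (t : ℝ≥0) :
    Integrable (ξ x t) P :=
  ⟨(hξ.measurable_apply x t).aestronglyMeasurable,
    (hξ.lintegral_enorm x t).trans_lt hξ.integrable.2⟩

theorem shiftField (hξ : IsStationaryField P ξ) (z : SpaceTime d) :
    IsStationaryField P (shiftField z ξ) := by
  refine ⟨fun x => ?_, ?_, ?_⟩
  · exact (hξ.measurable (x + z.1)).comp
      ((measurable_fst.add_const z.2).prodMk measurable_snd)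
  · rw [hξ.fieldLaw_shiftField]
    exact hξ.stationary
  · exact hξ.integrable_apply (0 + z.1) (0 + z.2)

theorem measurePreserving_shift (hξ : IsStationaryField P ξ) (z : SpaceTime d) :
    MeasurePreserving (shift z) (fieldLaw P ξ) (fieldLaw P ξ) :=
  ⟨measurable_shift z, hξ.stationary z⟩

theorem measurable_toNNReal (hξ : IsStationaryField P ξ) (x : Lattice d) :
    Measurable fun p : ℝ × Ω => ξ x p.1.toNNReal p.2 :=
  (hξ.measurable x).comp (measurable_fst.real_toNNReal.prodMk measurable_snd)

theorem lintegral_lintegral_enorm [IsProbabilityMeasure P] (hξ : IsStationaryField P ξ)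
    (x : Lattice d) (s : Set ℝ) :
    ∫⁻ ω, (∫⁻ r in s, ‖ξ x r.toNNReal ω‖ₑ) ∂P = volume s * ∫⁻ ω, ‖ξ 0 0 ω‖ₑ ∂P := by
  rw [lintegral_lintegral_swap]
  · simp only [hξ.lintegral_enorm, lintegral_const, Measure.restrict_apply_univ, mul_comm]
  · exact ((hξ.measurable_toNNReal x).comp measurable_swap).enorm.aemeasurable

theorem ae_intervalIntegrable [IsProbabilityMeasure P] (hξ : IsStationaryField P ξ) :
    ∀ᵐ ω ∂P, ∀ x a b, IntervalIntegrable (fun r : ℝ => ξ x r.toNNReal ω) volume a b := by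
  have h : ∀ᵐ ω ∂P, ∀ (x : Lattice d) (n : ℕ),
      IntegrableOn (fun r : ℝ => ξ x r.toNNReal ω) (Set.Ioc (-n) n) volume := by
    refine ae_all_iff.2 fun x => ae_all_iff.2 fun n => ?_
    have hm : Measurable fun ω => ∫⁻ r in Set.Ioc (-n : ℝ) n, ‖ξ x r.toNNReal ω‖ₑ :=
      ((hξ.measurable_toNNReal x).comp measurable_swap).enorm.lintegral_prod_right'
    have hfin : ∫⁻ ω, (∫⁻ r in Set.Ioc (-n : ℝ) n, ‖ξ x r.toNNReal ω‖ₑ) ∂P ≠ ∞ := by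
      rw [hξ.lintegral_lintegral_enorm]
      exact ENNReal.mul_ne_top (by simp) hξ.integrable.2.ne
    filter_upwards [ae_lt_top hm hfin] with ω hω
    exact ⟨((hξ.measurable_toNNReal x).comp measurable_prodMk_right).aestronglyMeasurable, hω⟩
  filter_upwards [h] with ω hω x a b
  obtain ⟨n, hn⟩ := exists_nat_ge (max |a| |b|)
  refine intervalIntegrable_iff.2 ((hω x n).mono_set fun r hr => ?_)
  have ha := abs_le.1 ((le_max_left _ _).trans hn)
  have hb := abs_le.1 ((le_max_right _ _).trans hn)
  rcases Set.mem_uIoc.1 hr with h | h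
  · exact ⟨by linarith, by linarith⟩
  · exact ⟨by linarith, by linarith⟩

end IsStationaryField

theorem IsStationaryField.measurable_potential (hξ : IsStationaryField P ξ) (γ t : ℝ)
    (y : Lattice d) : Measurable fun p : Ω × ℝ => potential ξ γ t p.1 y p.2 :=
  ((hξ.measurable_toNNReal y).comp
    ((measurable_snd.const_sub t).prodMk measurable_fst)).const_mul γ

theorem IsStationaryField.measurable_potential' (hξ : IsStationaryField P ξ) (γ t : ℝ)
    (ω : Ω) (y : Lattice d) : Measurable (potential ξ γ t ω y) :=
  (hξ.measurable_potential γ t y).comp measurable_prodMk_left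

/-- Paths run backwards in time, so the first stretch `[0, s]` of a path of length `s + t` meets
the environment after time `t`. -/
theorem fundamental_mul_le [NeZero d] (hξ : IsStationaryField P ξ) {ω : Ω}
    (hω : IsLocallyIntegrable ξ ω) {κ : ℝ} (hκ : 0 ≤ κ) (γ : ℝ) (x y z : Lattice d) (s t : ℝ≥0) :
    fundamental (shiftField (0, t) ξ) κ γ x y s ω * fundamental ξ κ γ y z t ω
      ≤ fundamental ξ κ γ x z ((s + t : ℝ≥0) : ℝ) ω := by
  have h := feynmanKac_mul_le hκ (hξ.measurable_potential' γ ((s + t : ℝ≥0) : ℝ) ω)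
    (hω.potential γ _) x y z s.coe_nonneg t.coe_nonneg
  unfold fundamental
  refine le_trans (le_of_eq ?_) (h.trans_eq (by push_cast; rfl))
  congr 1
  · refine feynmanKac_congr s.coe_nonneg (fun y r hr => ?_) x y
    unfold potential shiftField
    have : ((s + t : ℝ≥0) - r : ℝ).toNNReal = (s - r).toNNReal + t := by
      have h1 : ((s + t : ℝ≥0) - r : ℝ) = (s - r) + t := by push_cast; ring
      rw [h1, Real.toNNReal_add (sub_nonneg.2 hr.2) t.coe_nonneg, Real.toNNReal_coe]
    rw [this, add_zero]
  · congr 1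
    funext u v
    unfold potential
    have : ((s + t : ℝ≥0) : ℝ) - (s + v) = t - v := by push_cast; ring
    rw [this]

theorem IsStationaryField.measurable_fundamental [NeZero d] [IsProbabilityMeasure P]
    (hξ : IsStationaryField P ξ)
    (κ γ : ℝ) (x y : Lattice d) (t : ℝ) : Measurable (fundamental ξ κ γ x y t) := by
  have h := measurable_feynmanKac_integrand (α := WalkSpace d × Ω) (W := Prod.fst) measurable_fst
    (g := fun p => potential ξ γ t p.2)
    (fun y => (hξ.measurable_potential γ t y).comp
      ((measurable_snd.comp measurable_fst).prodMk measurable_snd)) κ x y t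
  exact h.lintegral_prod_left'

end Field

/-! ### Resting at the origin -/

section Bounds

variable {Ω : Type*} {d : ℕ} {ξ : Lattice d → ℝ≥0 → Ω → ℝ}

/-- The integral of `|ξ(y, ·)|` over the time interval `[0,1]`. -/
noncomputable def unitMass (ξ : Lattice d → ℝ≥0 → Ω → ℝ) (y : Lattice d) (ω : Ω) : ℝ :=
  ∫ r in (0 : ℝ)..1, |ξ y r.toNNReal ω|

theorem unitMass_nonneg (y : Lattice d) (ω : Ω) : 0 ≤ unitMass ξ y ω :=
  intervalIntegral.integral_nonneg zero_le_one fun _ _ => abs_nonneg _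

theorem integral_shiftField_time (F : ℝ → ℝ) (y : Lattice d) (τ : ℝ≥0) {s : ℝ} (hs : 0 ≤ s)
    (ω : Ω) : ∫ r in (0 : ℝ)..s, F (shiftField (0, τ) ξ y r.toNNReal ω)
      = ∫ r in (τ : ℝ)..(τ + s), F (ξ y r.toNNReal ω) := by
  have h := intervalIntegral.integral_comp_add_left (a := 0) (b := s)
    (fun r : ℝ => F (ξ y r.toNNReal ω)) (τ : ℝ)
  rw [add_zero] at h
  rw [← h]
  refine intervalIntegral.integral_congr fun r hr => ?_
  rw [Set.uIcc_of_le hs] at hr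
  simp only [shiftField, add_zero]
  rw [Real.toNNReal_add τ.coe_nonneg hr.1, Real.toNNReal_coe, add_comm]

theorem integral_potential (F : ℝ → ℝ) (γ t : ℝ) (ω : Ω) (y : Lattice d) :
    ∫ s in (0 : ℝ)..t, F (potential ξ γ t ω y s) = ∫ r in (0 : ℝ)..t, F (γ * ξ y r.toNNReal ω) := by
  have h := intervalIntegral.integral_comp_sub_left (a := 0) (b := t)
    (fun r : ℝ => F (γ * ξ y r.toNNReal ω)) t
  rw [sub_self, sub_zero] at h
  exact h

theorem fundamental_self_pos [NeZero d] {κ : ℝ} (hκ : 0 ≤ κ) (γ : ℝ) (x : Lattice d) {t : ℝ}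
    (ht : 0 ≤ t) (ω : Ω) : 0 < fundamental ξ κ γ x x t ω :=
  (ENNReal.ofReal_pos.2 (Real.exp_pos _)).trans_le (le_feynmanKac_self hκ _ x ht)

/-- The cost of resting at the origin during the time interval `[0,1]`: minus the logarithm of the
probability not to jump, plus a bound on the contribution of the potential that is uniform over
subintervals. -/
noncomputable def restCost (ξ : Lattice d → ℝ≥0 → Ω → ℝ) (κ γ : ℝ) (ω : Ω) : ℝ :=
  γ * unitMass ξ 0 ω + 2 * d * κ

theorem restCost_nonneg {κ γ : ℝ} (hκ : 0 ≤ κ) (hγ : 0 ≤ γ) (ω : Ω) : 0 ≤ restCost ξ κ γ ω := by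
  have := unitMass_nonneg (ξ := ξ) 0 ω
  unfold restCost
  positivity

/-- The solution loses at most the factor `exp (-restCost)` by resting at the origin during a part
of the time interval `[n, n + 1]`. -/
theorem exp_neg_restCost_le [NeZero d] {ω : Ω} (hω : IsLocallyIntegrable ξ ω) {κ γ : ℝ}
    (hκ : 0 ≤ κ) (hγ : 0 ≤ γ) {n τ s : ℝ≥0} (hn : n ≤ τ) (hs : τ + s ≤ n + 1) :
    ENNReal.ofReal (Real.exp (-restCost (shiftField (0, n) ξ) κ γ ω))
      ≤ fundamental (shiftField (0, τ) ξ) κ γ 0 0 s ω := by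
  have hn' : (n : ℝ) ≤ τ := by exact_mod_cast hn
  have hs' : (τ : ℝ) + s ≤ n + 1 := by exact_mod_cast hs
  have hs0 := s.coe_nonneg
  refine le_trans ?_ (le_feynmanKac_self hκ _ 0 s.coe_nonneg)
  refine ENNReal.ofReal_le_ofReal (Real.exp_le_exp.2 ?_)
  have h1 := integral_potential (ξ := shiftField (0, τ) ξ) (fun a => a) γ s ω 0
  have h2 := integral_shiftField_time (ξ := ξ) (fun a => γ * a) 0 τ s.coe_nonneg ω
  have h3 := integral_shiftField_time (ξ := ξ) (fun a => |a|) 0 n zero_le_one ω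
  have h4 : |∫ r in (τ : ℝ)..(τ + s), γ * ξ 0 r.toNNReal ω|
      ≤ γ * ∫ r in (n : ℝ)..(n + 1), |ξ 0 r.toNNReal ω| := by
    rw [intervalIntegral.integral_const_mul, abs_mul, abs_of_nonneg hγ]
    refine mul_le_mul_of_nonneg_left ?_ hγ
    refine (intervalIntegral.abs_integral_le_integral_abs (by linarith)).trans ?_
    exact intervalIntegral.integral_mono_interval hn' (by linarith) hs'
      (ae_of_all _ fun _ => abs_nonneg _) (hω 0 _ _).abs
  have h5 : 2 * d * κ * s ≤ 2 * d * κ := by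
    refine mul_le_of_le_one_right (by positivity) (by linarith)
  have h6 := neg_abs_le (∫ r in (τ : ℝ)..(τ + s), γ * ξ 0 r.toNNReal ω)
  unfold restCost unitMass
  rw [h1, h2, h3]
  linarith

/-- `log u(0,t)`, with the junk value `0` where `u(0,t) = ∞`. -/
noncomputable def logSolution [NeZero d] (ξ : Lattice d → ℝ≥0 → Ω → ℝ) (κ γ t : ℝ) (ω : Ω) : ℝ :=
  Real.log (fundamental ξ κ γ 0 0 t ω).toReal

theorem log_toReal_add_le {a b c : ℝ≥0∞} (ha : 0 < a) (hb : 0 < b) (hc : c < ∞) (h : a * b ≤ c) :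
    Real.log a.toReal + Real.log b.toReal ≤ Real.log c.toReal := by
  have hab : a * b ≠ ∞ := (h.trans_lt hc).ne
  have ha' : a ≠ ∞ := fun h' => hab (by rw [h', ENNReal.top_mul hb.ne'])
  have hb' : b ≠ ∞ := fun h' => hab (by rw [h', ENNReal.mul_top ha.ne'])
  have ha0 := ENNReal.toReal_pos ha.ne' ha'
  have hb0 := ENNReal.toReal_pos hb.ne' hb'
  rw [← Real.log_mul ha0.ne' hb0.ne', ← ENNReal.toReal_mul]
  refine Real.log_le_log ?_ (ENNReal.toReal_mono hc.ne h)
  rw [ENNReal.toReal_mul]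
  positivity

theorem lt_top_of_mul_le {a b c : ℝ≥0∞} (ha : 0 < a) (hc : c < ∞) (h : a * b ≤ c) : b < ∞ := by
  refine lt_top_iff_ne_top.2 fun hb => ?_
  rw [hb, ENNReal.mul_top ha.ne', top_le_iff] at h
  exact hc.ne h

end Bounds

section Covariance

variable {Ω : Type*} [MeasurableSpace Ω] {d : ℕ} {P : Measure Ω}
  {ξ : Lattice d → ℝ≥0 → Ω → ℝ}

theorem isCovariant_apply (ξ : Lattice d → ℝ≥0 → Ω → ℝ) (x : Lattice d) (t : ℝ≥0) :
    IsCovariant P (path ξ) fun z ω => shiftField z ξ x t ω :=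
  ⟨fun f => f (x, t), measurable_pi_apply _, fun _ => ae_eq_rfl⟩

variable [IsProbabilityMeasure P]

theorem IsStationaryField.isCovariant_unitMass (hξ : IsStationaryField P ξ) (y : Lattice d) :
    IsCovariant P (path ξ) fun z ω => unitMass (PAM.shiftField z ξ) y ω := by
  have := hξ.isProbabilityMeasure_fieldLaw
  simp only [unitMass, intervalIntegral.integral_of_le zero_le_one]
  refine IsCovariant.integral hξ.measurable_path hξ.map_path
    (A := fun z (r : ℝ) ω => |PAM.shiftField z ξ y r.toNNReal ω|)
    (fun z => ((hξ.shiftField z).measurable_toNNReal y).abs) (ae_of_all _ fun r => ?_) fun z => ?_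
  · exact (isCovariant_apply ξ y r.toNNReal).comp (φ := fun a => |a|) measurable_id.abs
  · filter_upwards [(hξ.shiftField z).ae_intervalIntegrable] with ω hω
    exact ((intervalIntegrable_iff_integrableOn_Ioc_of_le zero_le_one).1 (hω y 0 1)).abs

theorem IsStationaryField.integrable_unitMass (hξ : IsStationaryField P ξ) (y : Lattice d) :
    Integrable (unitMass ξ y) P := by
  have hm : Measurable (unitMass ξ y) :=
    measurable_intervalIntegral (g := fun ω (r : ℝ) => |ξ y r.toNNReal ω|)
      (((hξ.measurable_toNNReal y).comp measurable_swap).abs) 0 1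
  refine ⟨hm.aestronglyMeasurable, ?_⟩
  calc ∫⁻ ω, ‖unitMass ξ y ω‖ₑ ∂P
      ≤ ∫⁻ ω, (∫⁻ r in Set.Ioc (0 : ℝ) 1, ‖ξ y r.toNNReal ω‖ₑ) ∂P := by
        refine lintegral_mono fun ω => ?_
        simp only [unitMass, intervalIntegral.integral_of_le zero_le_one]
        refine (enorm_integral_le_lintegral_enorm _).trans_eq ?_
        simp
    _ < ∞ := by
        rw [hξ.lintegral_lintegral_enorm]
        exact ENNReal.mul_lt_top (by simp) hξ.integrable.2

theorem IsStationaryField.integrable_restCost (hξ : IsStationaryField P ξ) (κ γ : ℝ) :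
    Integrable (restCost ξ κ γ) P :=
  ((hξ.integrable_unitMass 0).const_mul γ).add (integrable_const _)

end Covariance

section BoundsField

variable {Ω : Type*} [MeasurableSpace Ω] {d : ℕ} [NeZero d] {P : Measure Ω}
  {ξ : Lattice d → ℝ≥0 → Ω → ℝ}

/-- Finiteness at all real times follows from finiteness at the integers, since
`u(0,n) ≥ c u(0,t)` with `c > 0` for any integer `n ≥ t`. -/
theorem fundamental_lt_top (hξ : IsStationaryField P ξ) {ω : Ω} (hω : IsLocallyIntegrable ξ ω)
    {κ γ : ℝ} (hκ : 0 ≤ κ) (hfin : ∀ n : ℕ, fundamental ξ κ γ 0 0 n ω < ∞) {t : ℝ} (ht : 0 ≤ t) :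
    fundamental ξ κ γ 0 0 t ω < ∞ := by
  lift t to ℝ≥0 using ht
  obtain ⟨n, hn⟩ := exists_nat_ge t
  have h := fundamental_mul_le hξ hω hκ γ 0 0 0 (n - t) t
  rw [tsub_add_cancel_of_le hn] at h
  exact lt_top_of_mul_le (fundamental_self_pos hκ γ 0 (NNReal.coe_nonneg _) ω) (hfin n) h

/-- The process `t ↦ log u(0,t)` is superadditive over the time translations of the environment.
-/
theorem logSolution_add_le (hξ : IsStationaryField P ξ) {ω : Ω} (hω : IsLocallyIntegrable ξ ω)
    {κ γ : ℝ} (hκ : 0 ≤ κ) (hfin : ∀ t : ℝ, 0 ≤ t → fundamental ξ κ γ 0 0 t ω < ∞) (s t : ℝ≥0) :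
    logSolution (shiftField (0, t) ξ) κ γ s ω + logSolution ξ κ γ t ω
      ≤ logSolution ξ κ γ ((s + t : ℝ≥0) : ℝ) ω :=
  log_toReal_add_le (fundamental_self_pos hκ γ 0 s.coe_nonneg ω)
    (fundamental_self_pos hκ γ 0 t.coe_nonneg ω) (hfin _ (NNReal.coe_nonneg _))
    (fundamental_mul_le hξ hω hκ γ 0 0 0 s t)

/-- The solution changes over a short time interval `[s, t] ⊆ [n, n + 1]` at most by the cost of
resting at the origin. -/
theorem logSolution_sub_restCost_le (hξ : IsStationaryField P ξ) {ω : Ω}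
    (hω : IsLocallyIntegrable ξ ω) {κ γ : ℝ} (hκ : 0 ≤ κ) (hγ : 0 ≤ γ)
    (hfin : ∀ t : ℝ, 0 ≤ t → fundamental ξ κ γ 0 0 t ω < ∞) {n s t : ℝ≥0} (hns : n ≤ s)
    (hst : s ≤ t) (htn : t ≤ n + 1) :
    logSolution ξ κ γ s ω - restCost (shiftField (0, n) ξ) κ γ ω ≤ logSolution ξ κ γ t ω := by
  have h := (mul_le_mul_left (exp_neg_restCost_le hω hκ hγ hns
    (s := t - s) (by rwa [add_tsub_cancel_of_le hst])) (fundamental ξ κ γ 0 0 s ω)).trans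
    (fundamental_mul_le hξ hω hκ γ 0 0 0 (t - s) s)
  rw [tsub_add_cancel_of_le hst] at h
  have h2 := log_toReal_add_le (ENNReal.ofReal_pos.2 (Real.exp_pos _))
    (fundamental_self_pos hκ γ 0 s.coe_nonneg ω) (hfin _ t.coe_nonneg) h
  rw [ENNReal.toReal_ofReal (Real.exp_pos _).le, Real.log_exp] at h2
  unfold logSolution
  linarith

/-- The contribution of the walk that rests at the origin. -/
theorem exp_neg_sum_restCost_le (hξ : IsStationaryField P ξ) {ω : Ω}
    (hω : IsLocallyIntegrable ξ ω) {κ γ : ℝ} (hκ : 0 ≤ κ) (hγ : 0 ≤ γ) (n : ℕ) :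
    ENNReal.ofReal (Real.exp (-∑ k ∈ Finset.range n, restCost (shiftField (0, (k : ℝ≥0)) ξ) κ γ ω))
      ≤ fundamental ξ κ γ 0 0 n ω := by
  induction n with
  | zero =>
    have := le_feynmanKac_self hκ (potential ξ γ 0 ω) 0 le_rfl
    simpa [fundamental] using this
  | succ n ih =>
    have h := fundamental_mul_le hξ hω hκ γ 0 0 0 1 n
    have h1 := exp_neg_restCost_le hω hκ hγ (n := n) (τ := n) (s := 1) le_rfl le_rfl
    rw [Finset.sum_range_succ, neg_add_rev, Real.exp_add, ENNReal.ofReal_mul (Real.exp_pos _).le]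
    refine (mul_le_mul' h1 ?_).trans (h.trans_eq ?_)
    · simpa using ih
    · congr 1
      push_cast
      ring

variable [IsProbabilityMeasure P]

/-- The fundamental solution is a functional of the sample path of the environment: it is a double
integral, over the walk and over time, of values of the field. -/
theorem IsStationaryField.isCovariant_fundamental (hξ : IsStationaryField P ξ) {κ : ℝ}
    (hκ : 0 ≤ κ) (γ : ℝ) (x y : Lattice d) {t : ℝ} (ht : 0 ≤ t) :
    IsCovariant P (path ξ) fun z => fundamental (PAM.shiftField z ξ) κ γ x y t := by
  have := hξ.isProbabilityMeasure_fieldLaw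
  refine IsCovariant.lintegral hξ.measurable_path hξ.map_path
    (A := fun z w ω => ENNReal.ofReal (Real.exp (∫ s in (0 : ℝ)..t,
      potential (PAM.shiftField z ξ) γ t ω (x + walk κ w s) s)
      * (if x + walk κ w t = y then 1 else 0))) (fun z => ?_) ?_
  · exact measurable_feynmanKac_integrand (α := WalkSpace d × Ω) (W := Prod.fst) measurable_fst
      (g := fun p => potential (PAM.shiftField z ξ) γ t p.2)
      (fun y => ((hξ.shiftField z).measurable_potential γ t y).comp
        ((measurable_snd.comp measurable_fst).prodMk measurable_snd)) κ x y t
  · filter_upwards [ae_isRegular] with w hw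
    have h1 : IsCovariant P (path ξ) fun z ω => ∫ s in (0 : ℝ)..t,
        potential (PAM.shiftField z ξ) γ t ω (x + walk κ w s) s := by
      simp only [intervalIntegral.integral_of_le ht]
      refine IsCovariant.integral hξ.measurable_path hξ.map_path
        (A := fun z s ω => potential (PAM.shiftField z ξ) γ t ω (x + walk κ w s) s)
        (fun z => ?_) (ae_of_all _ fun s => ?_) fun z => ?_
      · have h := measurable_along_walk (α := Ω) (W := fun _ => w) measurable_const
          (g := fun ω => potential (PAM.shiftField z ξ) γ t ω)
          (fun y => (hξ.shiftField z).measurable_potential γ t y) κ x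
        have h2 : Measurable fun p : ℝ × Ω => (p.2, p.1) := measurable_snd.prodMk measurable_fst
        have h3 := h.comp h2
        simp only [Function.comp_def] at h3
        exact h3
      · exact (isCovariant_apply ξ _ _).comp (φ := fun a => γ * a) (measurable_id.const_mul γ)
      · filter_upwards [(hξ.shiftField z).ae_intervalIntegrable] with ω hω
        have hω' : IsLocallyIntegrable (PAM.shiftField z ξ) ω := hω
        exact (intervalIntegrable_iff_integrableOn_Ioc_of_le ht).1
          (hw.intervalIntegrable_walk hκ ((hξ.shiftField z).measurable_potential' γ t ω)
            (hω'.potential γ t) x 0 t)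
    exact h1.comp (φ := fun a => ENNReal.ofReal (Real.exp a
      * (if x + walk κ w t = y then 1 else 0)))
      (Real.measurable_exp.mul_const _).ennreal_ofReal

end BoundsField

/-! ### Growth in mean and passage to real times -/

/-- Convergence along the integers extends to real times if the increments over unit intervals are
controlled by a sublinear sequence. -/
theorem tendsto_of_sandwich {L : ℝ → ℝ} {D : ℕ → ℝ} {l : ℝ}
    (hL : Tendsto (fun n : ℕ => L n / n) atTop (𝓝 l))
    (hD : Tendsto (fun n : ℕ => D n / n) atTop (𝓝 0))
    (h : ∀ (n : ℕ) (t : ℝ), n ≤ t → t ≤ n + 1 → L n - D n ≤ L t ∧ L t ≤ L (n + 1) + D n) :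
    Tendsto (fun t => 1 / t * L t) atTop (𝓝 l) := by
  have hfl : Tendsto (fun t : ℝ => (⌊t⌋₊ : ℝ) / t) atTop (𝓝 1) := tendsto_nat_floor_div_atTop
  have hfl' : Tendsto (fun t : ℝ => ((⌊t⌋₊ + 1 : ℕ) : ℝ) / t) atTop (𝓝 1) := by
    have h1 := hfl.add (tendsto_inv_atTop_zero (𝕜 := ℝ))
    rw [add_zero] at h1
    refine h1.congr fun t => ?_
    push_cast
    rw [add_div, one_div]
  have hL' : Tendsto (fun n : ℕ => L ((n + 1 : ℕ) : ℝ) / ((n + 1 : ℕ) : ℝ)) atTop (𝓝 l) :=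
    (tendsto_add_atTop_iff_nat (f := fun n : ℕ => L n / n) 1).2 hL
  have hfloor : Tendsto (fun t : ℝ => ⌊t⌋₊) atTop atTop := tendsto_nat_floor_atTop
  have hlow := ((hL.comp hfloor).sub (hD.comp hfloor)).mul hfl
  have hup := ((hL'.comp hfloor).mul hfl').add ((hD.comp hfloor).mul hfl)
  simp only [sub_zero, mul_one, add_zero] at hlow hup
  refine tendsto_of_tendsto_of_tendsto_of_le_of_le' hlow hup ?_ ?_
  all_goals
    filter_upwards [eventually_ge_atTop 1] with t ht
    have ht0 : 0 < t := by linarith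
    have hn : (0 : ℝ) < ⌊t⌋₊ := by exact_mod_cast Nat.floor_pos.2 ht
    obtain ⟨h1, h2⟩ := h ⌊t⌋₊ t (Nat.floor_le ht0.le) (Nat.lt_floor_add_one t).le
    simp only [Function.comp_apply]
  · rw [← sub_div, div_mul_div_cancel₀ hn.ne', one_div_mul_eq_div]
    gcongr
  · have hn1 : ((⌊t⌋₊ + 1 : ℕ) : ℝ) ≠ 0 := by positivity
    rw [div_mul_div_cancel₀ hn1, div_mul_div_cancel₀ hn.ne', ← add_div, one_div_mul_eq_div]
    push_cast
    gcongr

/-- `L ∘ T` and `L` have the same integral, so one cannot be smaller than the other. -/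
theorem ae_eq_comp_of_ae_le {X : Type*} [MeasurableSpace X] {μ : Measure X} {T : X → X}
    (hT : MeasurePreserving T μ μ) {L : X → ℝ} (hL : Integrable L μ)
    (h : (fun x => L (T x)) ≤ᵐ[μ] L) : (fun x => L (T x)) =ᵐ[μ] L := by
  have hLT : Integrable (fun x => L (T x)) μ := hT.integrable_comp_of_integrable hL
  refine (integral_eq_iff_of_ae_le hLT hL h).1 ?_
  have h1 := integral_map hT.measurable.aemeasurable (f := L)
    (by rw [hT.map_eq]; exact hL.aestronglyMeasurable)
  rw [hT.map_eq] at h1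
  exact h1.symm

theorem log_eq_coe_logSolution {Ω : Type*} {d : ℕ} [NeZero d] {ξ : Lattice d → ℝ≥0 → Ω → ℝ}
    {κ γ t : ℝ} {ω : Ω} (h0 : 0 < fundamental ξ κ γ 0 0 t ω)
    (h1 : fundamental ξ κ γ 0 0 t ω < ∞) :
    ENNReal.log (fundamental ξ κ γ 0 0 t ω) = (logSolution ξ κ γ t ω : EReal) :=
  ENNReal.log_pos_real h0.ne' h1.ne

section Limit

variable {Ω : Type*} [MeasurableSpace Ω] {d : ℕ} {P : Measure Ω}
  {ξ : Lattice d → ℝ≥0 → Ω → ℝ}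

theorem shift_shift (z z' : SpaceTime d) (f : SpaceTime d → ℝ) :
    shift z (shift z' f) = shift (z + z') f := by
  funext p
  simp [shift, add_assoc]

theorem iterate_shift (n : ℕ) :
    (shift ((0, 1) : SpaceTime d))^[n] = shift ((0, (n : ℝ≥0)) : SpaceTime d) := by
  induction n with
  | zero =>
    funext f p
    simp [shift, ← Prod.zero_eq_mk]
  | succ n ih =>
    funext f
    rw [Function.iterate_succ_apply, ih, shift_shift]
    simp

theorem IsStationaryField.ae_path (hξ : IsStationaryField P ξ) {p : (SpaceTime d → ℝ) → Prop}
    (h : ∀ᵐ f ∂fieldLaw P ξ, p f) (z : SpaceTime d) : ∀ᵐ ω ∂P, p (path ξ z ω) :=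
  (MeasurePreserving.mk (hξ.measurable_path z) (hξ.map_path z)).quasiMeasurePreserving.ae h

theorem IsStationaryField.ae_fieldLaw (hξ : IsStationaryField P ξ)
    {p : (SpaceTime d → ℝ) → Prop} (hp : MeasurableSet {f | p f})
    (h : ∀ᵐ ω ∂P, p (path ξ 0 ω)) : ∀ᵐ f ∂fieldLaw P ξ, p f := by
  rw [← hξ.map_path 0]
  exact (ae_map_iff (hξ.measurable_path 0).aemeasurable hp).2 h

theorem IsStationaryField.integrable_fieldLaw (hξ : IsStationaryField P ξ)
    {g : (SpaceTime d → ℝ) → ℝ} (hg : Measurable g)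
    (h : Integrable (fun ω => g (path ξ 0 ω)) P) : Integrable g (fieldLaw P ξ) := by
  rw [← hξ.map_path 0]
  exact (integrable_map_measure hg.aestronglyMeasurable (hξ.measurable_path 0).aemeasurable).2 h

variable [IsProbabilityMeasure P]

theorem IsStationaryField.tendsto_unitMass_div (hξ : IsStationaryField P ξ) (y : Lattice d) :
    ∀ᵐ ω ∂P, Tendsto (fun n : ℕ => unitMass (PAM.shiftField (0, (n : ℝ≥0)) ξ) y ω / n)
      atTop (𝓝 0) := by
  have := hξ.isProbabilityMeasure_fieldLaw
  obtain ⟨g, hg, hgA⟩ := hξ.isCovariant_unitMass y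
  have hgi : Integrable g (fieldLaw P ξ) := by
    refine hξ.integrable_fieldLaw hg ((hξ.integrable_unitMass y).congr ?_)
    have h0 := hgA 0
    simp only [shiftField_zero] at h0
    exact h0
  have h := tendsto_iterate_div_of_nonneg (hξ.measurePreserving_shift (0, 1)) hg.abs
    (fun _ => abs_nonneg _) hgi.abs
  filter_upwards [hξ.ae_path h 0, ae_all_iff.2 fun n : ℕ => hgA (0, (n : ℝ≥0))] with ω hω hωg
  refine hω.congr fun n => ?_
  rw [iterate_shift, shift_path, add_zero, ← hωg n, abs_of_nonneg (unitMass_nonneg y ω)]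

theorem IsStationaryField.tendsto_restCost_div (hξ : IsStationaryField P ξ) (κ γ : ℝ) :
    ∀ᵐ ω ∂P, Tendsto (fun n : ℕ => restCost (PAM.shiftField (0, (n : ℝ≥0)) ξ) κ γ ω / n)
      atTop (𝓝 0) := by
  filter_upwards [hξ.tendsto_unitMass_div 0] with ω hω
  have h1 := (hω.const_mul γ).add (tendsto_const_div_atTop_nhds_zero_nat (2 * d * κ))
  rw [mul_zero, add_zero] at h1
  refine h1.congr fun n => ?_
  rw [restCost]
  ring

theorem IsStationaryField.lintegral_restCost (hξ : IsStationaryField P ξ) (κ γ : ℝ)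
    (z : SpaceTime d) :
    ∫⁻ ω, ENNReal.ofReal (restCost (PAM.shiftField z ξ) κ γ ω) ∂P
      = ∫⁻ ω, ENNReal.ofReal (restCost ξ κ γ ω) ∂P := by
  obtain ⟨g, hg, hgA⟩ := (hξ.isCovariant_unitMass 0).comp
    (φ := fun a => ENNReal.ofReal (γ * a + 2 * d * κ))
    ((measurable_id.const_mul γ).add_const _).ennreal_ofReal
  have key : ∀ z, ∫⁻ ω, ENNReal.ofReal (restCost (PAM.shiftField z ξ) κ γ ω) ∂P
      = ∫⁻ f, g f ∂fieldLaw P ξ := by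
    intro z
    rw [← hξ.map_path z, lintegral_map hg (hξ.measurable_path z)]
    exact lintegral_congr_ae (hgA z)
  rw [key, ← key 0, shiftField_zero]

variable [NeZero d]

/-- The growth bound on `E (log u(0,t))`, a difference of two possibly infinite integrals,
controls the positive part of `log u(0,n)`, since the negative part is at most a sum of `n`
resting costs. -/
theorem growth_of_expectation_le (hξ : IsStationaryField P ξ) {κ γ : ℝ} (hκ : 0 ≤ κ) (hγ : 0 ≤ γ)
    {c : ℝ} (hc : ∀ t : ℝ, 0 ≤ t →
      expectation P (fun ω => ENNReal.log (solution ξ κ γ 0 t ω)) ≤ ((c * t : ℝ) : EReal)) :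
    (∀ᵐ ω ∂P, ∀ n : ℕ, fundamental ξ κ γ 0 0 n ω < ∞) ∧ ∃ C : ℝ≥0, ∀ n : ℕ,
      ∫⁻ ω, ENNReal.ofReal (logSolution ξ κ γ n ω +
        ∑ k ∈ Finset.range n, restCost (shiftField (0, (k : ℝ≥0)) ξ) κ γ ω) ∂P ≤ n * C := by
  set R : ℕ → Ω → ℝ := fun n ω =>
    ∑ k ∈ Finset.range n, restCost (shiftField (0, (k : ℝ≥0)) ξ) κ γ ω with hR
  have hR0 : ∀ n ω, 0 ≤ R n ω := fun n ω => Finset.sum_nonneg fun k _ => restCost_nonneg hκ hγ ω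
  set E : ℝ≥0∞ := ∫⁻ ω, ENNReal.ofReal (restCost ξ κ γ ω) ∂P with hE
  have hEfin : E ≠ ∞ := (hξ.integrable_restCost κ γ).lintegral_lt_top.ne
  have hRint : ∀ n : ℕ, ∫⁻ ω, ENNReal.ofReal (R n ω) ∂P = n * E := by
    intro n
    simp only [hR, ENNReal.ofReal_sum_of_nonneg fun k _ => restCost_nonneg hκ hγ _]
    rw [lintegral_finsetSum']
    · simp only [hξ.lintegral_restCost, Finset.sum_const, Finset.card_range, nsmul_eq_mul, hE]
    · intro k _
      exact ((hξ.shiftField _).integrable_restCost κ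
        γ).aestronglyMeasurable.aemeasurable.ennreal_ofReal
  have hloc : ∀ᵐ ω ∂P, IsLocallyIntegrable ξ ω := hξ.ae_intervalIntegrable
  have hB : ∀ n : ℕ, ∫⁻ ω, (-ENNReal.log (fundamental ξ κ γ 0 0 n ω)).toENNReal ∂P ≤ n * E := by
    intro n
    rw [← hRint n]
    refine lintegral_mono_ae ?_
    filter_upwards [hloc] with ω hω
    have h1 := ENNReal.log_le_log (exp_neg_sum_restCost_le hξ hω hκ hγ n)
    rw [ENNReal.log_ofReal_of_pos (Real.exp_pos _), Real.log_exp] at h1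
    have h2 : -ENNReal.log (fundamental ξ κ γ 0 0 n ω) ≤ ((R n ω : ℝ) : EReal) := by
      rw [EReal.neg_le]
      exact_mod_cast h1
    exact (EReal.toENNReal_le_toENNReal h2).trans_eq (EReal.real_coe_toENNReal _)
  have hA : ∀ n : ℕ, ∫⁻ ω, (ENNReal.log (fundamental ξ κ γ 0 0 n ω)).toENNReal ∂P
      ≤ n * ENNReal.ofReal |c| + n * E := by
    intro n
    have h1 := hc n n.cast_nonneg
    simp only [expectation, solution_eq_fundamental] at h1
    have hBfin : ∫⁻ ω, (-ENNReal.log (fundamental ξ κ γ 0 0 n ω)).toENNReal ∂P ≠ ∞ :=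
      ne_top_of_le_ne_top (by finiteness) (hB n)
    generalize ∫⁻ ω, (ENNReal.log (fundamental ξ κ γ 0 0 n ω)).toENNReal ∂P = A at h1 ⊢
    have hBn := hB n
    generalize ∫⁻ ω, (-ENNReal.log (fundamental ξ κ γ 0 0 n ω)).toENNReal ∂P = B at h1 hBfin hBn
    lift B to ℝ≥0 using hBfin
    have h2 : (A : EReal) ≤ ((c * n : ℝ) : EReal) + ((B : ℝ≥0∞) : EReal) :=
      (EReal.sub_le_iff_le_add (.inl (by simp)) (.inl (by simp))).1 h1
    have h3 : A ≤ ENNReal.ofReal (c * n) + B := by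
      have h4 := EReal.toENNReal_le_toENNReal h2
      rw [EReal.toENNReal_coe] at h4
      refine h4.trans (EReal.toENNReal_add_le.trans ?_)
      rw [EReal.real_coe_toENNReal, EReal.toENNReal_coe]
    refine h3.trans (add_le_add ?_ hBn)
    rw [mul_comm, ENNReal.ofReal_mul n.cast_nonneg, ENNReal.ofReal_natCast]
    gcongr
    exact le_abs_self c
  have hmeas : ∀ n : ℕ, Measurable fun ω => (ENNReal.log (fundamental ξ κ γ 0 0 n ω)).toENNReal :=
    fun n => (ENNReal.measurable_log.comp (hξ.measurable_fundamental κ γ 0 0 n)).ereal_toENNReal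
  have hfin : ∀ᵐ ω ∂P, ∀ n : ℕ, fundamental ξ κ γ 0 0 n ω < ∞ := by
    refine ae_all_iff.2 fun n => ?_
    filter_upwards [ae_lt_top (hmeas n)
      (ne_top_of_le_ne_top (by finiteness) (hA n))]
      with ω hω
    refine ENNReal.log_lt_top_iff.1 (lt_top_iff_ne_top.2 fun h => hω.ne ?_)
    exact EReal.toENNReal_eq_top_iff.2 h
  refine ⟨hfin, (ENNReal.ofReal |c| + E + E).toNNReal, fun n => ?_⟩
  rw [ENNReal.coe_toNNReal (by finiteness)]
  calc _ ≤ ∫⁻ ω, ((ENNReal.log (fundamental ξ κ γ 0 0 n ω)).toENNReal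
        + ENNReal.ofReal (R n ω)) ∂P := by
        refine lintegral_mono_ae ?_
        filter_upwards [hfin] with ω hω
        rw [log_eq_coe_logSolution (fundamental_self_pos hκ γ 0 n.cast_nonneg ω) (hω n),
          EReal.real_coe_toENNReal]
        exact ENNReal.ofReal_add_le
    _ ≤ (n * ENNReal.ofReal |c| + n * E) + n * E := by
        rw [lintegral_add_left (hmeas n), hRint]
        gcongr
        exact hA n
    _ = _ := by ring

end Limit

/-! ### Existence of the growth rate -/

section Limit

variable {Ω : Type*} [MeasurableSpace Ω] {d : ℕ} [NeZero d] {P : Measure Ω}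
  [IsProbabilityMeasure P] {ξ : Lattice d → ℝ≥0 → Ω → ℝ} {κ γ : ℝ}

theorem IsStationaryField.ae_fundamental_lt_top (hξ : IsStationaryField P ξ) (hκ : 0 ≤ κ)
    (hfin : ∀ᵐ ω ∂P, ∀ n : ℕ, fundamental ξ κ γ 0 0 n ω < ∞) (z : SpaceTime d) :
    ∀ᵐ ω ∂P, ∀ t : ℝ, 0 ≤ t → fundamental (PAM.shiftField z ξ) κ γ 0 0 t ω < ∞ := by
  have h : ∀ᵐ ω ∂P, ∀ n : ℕ, fundamental (PAM.shiftField z ξ) κ γ 0 0 n ω < ∞ := by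
    refine ae_all_iff.2 fun n => ?_
    obtain ⟨g, hg, hgA⟩ := hξ.isCovariant_fundamental hκ γ 0 0 n.cast_nonneg
    have h1 : ∀ᵐ f ∂fieldLaw P ξ, g f < ∞ := by
      refine hξ.ae_fieldLaw (measurableSet_lt hg measurable_const) ?_
      filter_upwards [ae_all_iff.1 hfin n, hgA 0] with ω hω hωg
      rwa [← hωg, shiftField_zero]
    filter_upwards [hξ.ae_path h1 z, hgA z] with ω hω hωg
    rwa [hωg]
  filter_upwards [h, (hξ.shiftField z).ae_intervalIntegrable] with ω hω hint t ht
  exact fundamental_lt_top (hξ.shiftField z) hint hκ hω ht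

/-- Kingman's theorem for the superadditive process `n ↦ log u(0,n)`. The limit is a functional of
the sample path of the environment, the same one for all translates of the environment. -/
theorem IsStationaryField.exists_limit (hξ : IsStationaryField P ξ) (hκ : 0 ≤ κ) (hγ : 0 ≤ γ)
    (hfin : ∀ᵐ ω ∂P, ∀ n : ℕ, fundamental ξ κ γ 0 0 n ω < ∞) {C : ℝ≥0}
    (hC : ∀ n : ℕ, ∫⁻ ω, ENNReal.ofReal (logSolution ξ κ γ n ω + ∑ k ∈ Finset.range n,
      restCost (PAM.shiftField (0, (k : ℝ≥0)) ξ) κ γ ω) ∂P ≤ n * C) :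
    ∃ Λ : (SpaceTime d → ℝ) → ℝ, Measurable Λ ∧ Integrable Λ (fieldLaw P ξ) ∧
      (∀ z, ∀ᵐ ω ∂P, Tendsto (fun n : ℕ => logSolution (PAM.shiftField z ξ) κ γ n ω / n) atTop
        (𝓝 (Λ (path ξ z ω)))) ∧
      Tendsto (fun n : ℕ => ∫⁻ ω, ‖logSolution ξ κ γ n ω / n - Λ (path ξ 0 ω)‖ₑ ∂P) atTop
        (𝓝 0) := by
  have := hξ.isProbabilityMeasure_fieldLaw
  have hcov : ∀ n : ℕ, IsCovariant P (path ξ) fun z => logSolution (PAM.shiftField z ξ) κ γ n :=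
    fun n => (hξ.isCovariant_fundamental hκ γ 0 0 n.cast_nonneg).comp
      (φ := fun a => Real.log a.toReal) ENNReal.measurable_toReal.log
  choose a ham ha using hcov
  have ha' : ∀ z, ∀ᵐ ω ∂P, ∀ n : ℕ, logSolution (PAM.shiftField z ξ) κ γ n ω = a n (path ξ z ω) :=
    fun z => ae_all_iff.2 fun n => ha n z
  have hcovD : IsCovariant P (path ξ) fun z ω => |restCost (PAM.shiftField z ξ) κ γ ω| :=
    (hξ.isCovariant_unitMass 0).comp (φ := fun b => |γ * b + 2 * d * κ|)
      ((measurable_id.const_mul γ).add_const _).abs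
  obtain ⟨D, hDm, hD⟩ := hcovD
  have hD' : ∀ z, ∀ᵐ ω ∂P, restCost (PAM.shiftField z ξ) κ γ ω = |D (path ξ z ω)| := by
    intro z
    filter_upwards [hD z] with ω hω
    rw [← hω, abs_abs, abs_of_nonneg (restCost_nonneg hκ hγ ω)]
  set T : (SpaceTime d → ℝ) → SpaceTime d → ℝ := shift (0, 1) with hT
  have hTmp : MeasurePreserving T (fieldLaw P ξ) (fieldLaw P ξ) :=
    hξ.measurePreserving_shift (0, 1)
  have hiter : ∀ (n : ℕ) ω, T^[n] (path ξ 0 ω) = path ξ (0, (n : ℝ≥0)) ω := by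
    intro n ω
    rw [hT, iterate_shift, shift_path, add_zero]
  have hDi : Integrable (fun f => |D f|) (fieldLaw P ξ) := by
    refine hξ.integrable_fieldLaw hDm.abs ((hξ.integrable_restCost κ γ).congr ?_)
    have h0 := hD' 0
    rwa [shiftField_zero] at h0
  have hsum : ∀ᵐ ω ∂P, ∀ n : ℕ, birkhoffSum T (fun f => |D f|) n (path ξ 0 ω)
      = ∑ k ∈ Finset.range n, restCost (PAM.shiftField (0, (k : ℝ≥0)) ξ) κ γ ω := by
    filter_upwards [ae_all_iff.2 fun k : ℕ => hD' (0, (k : ℝ≥0))] with ω hω n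
    simp only [birkhoffSum, hiter, hω]
  have hsm : ∀ n, Measurable (birkhoffSum T (fun f => |D f|) n) := fun n =>
    measurable_birkhoffSum hTmp.measurable hDm.abs n
  have ha0 : ∀ᵐ ω ∂P, ∀ n : ℕ, logSolution ξ κ γ n ω = a n (path ξ 0 ω) := by
    have h0 := ha' 0
    rwa [shiftField_zero] at h0
  have hfin' := hξ.ae_fundamental_lt_top hκ hfin 0
  rw [shiftField_zero] at hfin'
  have hloc : ∀ᵐ ω ∂P, IsLocallyIntegrable ξ ω := hξ.ae_intervalIntegrable
  have hlow : ∀ᵐ f ∂fieldLaw P ξ, ∀ n, 0 ≤ a n f + birkhoffSum T (fun f => |D f|) n f := by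
    refine hξ.ae_fieldLaw ?_ ?_
    · simp only [Set.ofPred_forall]
      exact MeasurableSet.iInter fun n => measurableSet_le measurable_const ((ham n).add (hsm n))
    filter_upwards [hsum, ha0, hfin', hloc] with ω hω1 hω2 hω3 hω4 n
    rw [hω1, ← hω2]
    have h1 := exp_neg_sum_restCost_le hξ hω4 hκ hγ n
    have h2 := Real.log_le_log (Real.exp_pos _)
      ((ENNReal.ofReal_le_iff_le_toReal (hω3 n n.cast_nonneg).ne).1 h1)
    rw [Real.log_exp] at h2
    unfold logSolution
    linarith
  have hsup : ∀ᵐ f ∂fieldLaw P ξ, ∀ m n, a m f + a n (T^[m] f) ≤ a (m + n) f := by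
    refine hξ.ae_fieldLaw ?_ ?_
    · simp only [Set.ofPred_forall]
      exact MeasurableSet.iInter fun m => MeasurableSet.iInter fun n => measurableSet_le
        ((ham m).add ((ham n).comp (hTmp.measurable.iterate m))) (ham _)
    filter_upwards [ha0, ae_all_iff.2 fun k : ℕ => ha' (0, (k : ℝ≥0)), hfin', hloc]
      with ω hω1 hω2 hω3 hω4 m n
    rw [hiter, ← hω1, ← hω1, ← hω2]
    have h := logSolution_add_le hξ hω4 hκ hω3 n m
    push_cast at h ⊢
    rw [add_comm, add_comm (m : ℝ)]
    exact h
  have hbound : ∀ n : ℕ, ∫⁻ f, ENNReal.ofReal (a n f + birkhoffSum T (fun f => |D f|) n f)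
      ∂fieldLaw P ξ ≤ n * C := by
    intro n
    rw [← hξ.map_path 0, lintegral_map
      (f := fun f => ENNReal.ofReal (a n f + birkhoffSum T (fun f => |D f|) n f))
      ((ham n).add (hsm n)).ennreal_ofReal (hξ.measurable_path 0)]
    refine le_trans (le_of_eq (lintegral_congr_ae ?_)) (hC n)
    filter_upwards [hsum, ha0] with ω hω1 hω2
    rw [hω1, hω2]
  obtain ⟨Λ, hΛm, hΛi, hΛ, hΛ1⟩ := kingman hTmp ham hDm.abs (fun f => abs_nonneg _) hDi hlow hsup
    hbound
  refine ⟨Λ, hΛm, hΛi, fun z => ?_, hΛ1.congr fun n => ?_⟩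
  · filter_upwards [hξ.ae_path hΛ z, ha' z] with ω hω hωa
    simpa only [hωa] using hω
  · rw [← hξ.map_path 0, lintegral_map (f := fun f => ‖a n f / n - Λ f‖ₑ)
      (((ham n).div_const _).sub hΛm).enorm (hξ.measurable_path 0)]
    refine lintegral_congr_ae ?_
    filter_upwards [ha0] with ω hω
    rw [hω]

theorem IsStationaryField.logSolution_bounds (hξ : IsStationaryField P ξ) (hκ : 0 ≤ κ) (hγ : 0 ≤ γ)
    (hfin : ∀ᵐ ω ∂P, ∀ n : ℕ, fundamental ξ κ γ 0 0 n ω < ∞) :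
    ∀ᵐ ω ∂P, ∀ (n : ℕ) (t : ℝ), n ≤ t → t ≤ n + 1 →
      logSolution ξ κ γ n ω - restCost (PAM.shiftField (0, (n : ℝ≥0)) ξ) κ γ ω
        ≤ logSolution ξ κ γ t ω ∧
      logSolution ξ κ γ t ω ≤ logSolution ξ κ γ (n + 1) ω
        + restCost (PAM.shiftField (0, (n : ℝ≥0)) ξ) κ γ ω := by
  have hfin' := hξ.ae_fundamental_lt_top hκ hfin 0
  rw [shiftField_zero] at hfin'
  filter_upwards [hfin', hξ.ae_intervalIntegrable] with ω h1 h2 n t hnt htn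
  lift t to ℝ≥0 using n.cast_nonneg.trans hnt
  have hnt' : (n : ℝ≥0) ≤ t := by exact_mod_cast hnt
  have htn' : t ≤ n + 1 := by exact_mod_cast htn
  have h3 := logSolution_sub_restCost_le hξ h2 hκ hγ h1 le_rfl hnt' htn'
  have h4 := logSolution_sub_restCost_le hξ h2 hκ hγ h1 hnt' htn' le_rfl
  push_cast at h3 h4
  exact ⟨h3, by linarith⟩

theorem IsStationaryField.tendsto_logSolution (hξ : IsStationaryField P ξ) (hκ : 0 ≤ κ)
    (hγ : 0 ≤ γ) (hfin : ∀ᵐ ω ∂P, ∀ n : ℕ, fundamental ξ κ γ 0 0 n ω < ∞) {l : Ω → ℝ}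
    (hl : ∀ᵐ ω ∂P, Tendsto (fun n : ℕ => logSolution ξ κ γ n ω / n) atTop (𝓝 (l ω))) :
    ∀ᵐ ω ∂P, Tendsto (fun t : ℝ => 1 / t * logSolution ξ κ γ t ω) atTop (𝓝 (l ω)) := by
  filter_upwards [hξ.logSolution_bounds hκ hγ hfin, hl, hξ.tendsto_restCost_div κ γ]
    with ω h1 h2 h3
  exact tendsto_of_sandwich h2 h3 h1

/-- Convergence in mean along the integers extends to real times: between `n` and `n + 1` the
error is controlled by the errors at the two end points and by a stationary sequence divided by
`n`. -/
theorem IsStationaryField.tendsto_lintegral_logSolution (hξ : IsStationaryField P ξ) (hκ : 0 ≤ κ)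
    (hγ : 0 ≤ γ) (hfin : ∀ᵐ ω ∂P, ∀ n : ℕ, fundamental ξ κ γ 0 0 n ω < ∞) {l : Ω → ℝ}
    (hlm : Measurable l) (hli : Integrable l P)
    (hl : Tendsto (fun n : ℕ => ∫⁻ ω, ‖logSolution ξ κ γ n ω / n - l ω‖ₑ ∂P) atTop (𝓝 0)) :
    Tendsto (fun t : ℝ => ∫⁻ ω, ‖1 / t * logSolution ξ κ γ t ω - l ω‖ₑ ∂P) atTop (𝓝 0) := by
  set e : ℕ → ℝ≥0∞ := fun n => ∫⁻ ω, ‖logSolution ξ κ γ n ω / n - l ω‖ₑ ∂P with he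
  set K : ℝ≥0∞ := ∫⁻ ω, ‖l ω‖ₑ ∂P + ∫⁻ ω, ENNReal.ofReal (restCost ξ κ γ ω) ∂P with hK
  have hKfin : K ≠ ∞ :=
    ENNReal.add_ne_top.2 ⟨hli.2.ne, (hξ.integrable_restCost κ γ).lintegral_lt_top.ne⟩
  have hLm : ∀ t : ℝ, Measurable (logSolution ξ κ γ t) := fun t =>
    (hξ.measurable_fundamental κ γ 0 0 t).ennreal_toReal.log
  have key : ∀ t : ℝ, 1 ≤ t → ∫⁻ ω, ‖1 / t * logSolution ξ κ γ t ω - l ω‖ₑ ∂P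
      ≤ e ⌊t⌋₊ + 2 * e (⌊t⌋₊ + 1) + ENNReal.ofReal (1 / t) * K := by
    intro t ht
    set n := ⌊t⌋₊ with hn
    have ht0 : 0 < t := by linarith
    have hnt : (n : ℝ) ≤ t := Nat.floor_le ht0.le
    have htn : t ≤ n + 1 := (Nat.lt_floor_add_one t).le
    have hn1 : (1 : ℝ) ≤ n := by exact_mod_cast Nat.floor_pos.2 ht
    have hn0 : (0 : ℝ) < n := by linarith
    calc ∫⁻ ω, ‖1 / t * logSolution ξ κ γ t ω - l ω‖ₑ ∂P
        ≤ ∫⁻ ω, (‖logSolution ξ κ γ n ω / n - l ω‖ₑ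
          + 2 * ‖logSolution ξ κ γ (n + 1 : ℕ) ω / (n + 1 : ℕ) - l ω‖ₑ
          + ENNReal.ofReal (1 / t) * (‖l ω‖ₑ
            + ENNReal.ofReal (restCost (PAM.shiftField (0, (n : ℝ≥0)) ξ) κ γ ω))) ∂P := by
          refine lintegral_mono_ae ?_
          filter_upwards [hξ.logSolution_bounds hκ hγ hfin] with ω hω
          obtain ⟨h1, h2⟩ := hω n t hnt htn
          have h3 := restCost_nonneg (ξ := PAM.shiftField (0, (n : ℝ≥0)) ξ) hκ hγ ω
          push_cast
          generalize restCost (PAM.shiftField (0, (n : ℝ≥0)) ξ) κ γ ω = D at h1 h2 h3 ⊢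
          generalize logSolution ξ κ γ n ω = A at h1 ⊢
          generalize logSolution ξ κ γ (n + 1) ω = B at h2 ⊢
          generalize logSolution ξ κ γ t ω = M at h1 h2 ⊢
          generalize l ω = x
          have hreal : |1 / t * M - x| ≤ |A / n - x| + 2 * |B / (n + 1) - x|
              + 1 / t * (|x| + D) := by
            have hA : A = n * (A / n - x) + n * x := by field_simp; ring
            have hB : B = (n + 1) * (B / (n + 1) - x) + (n + 1) * x := by field_simp; ring
            generalize A / n - x = u at hA ⊢
            generalize B / (n + 1) - x = v at hB ⊢
            have hM : 1 / t * M - x = (M - t * x) / t := by field_simp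
            have hR : |u| + 2 * |v| + 1 / t * (|x| + D)
                = (t * |u| + 2 * t * |v| + (|x| + D)) / t := by field_simp
            rw [hM, hR, abs_div, abs_of_pos ht0]
            gcongr
            have hu := abs_le.1 (le_refl |u|)
            have hv := abs_le.1 (le_refl |v|)
            have h5 : |(t - n) * x| ≤ |x| := by
              rw [abs_mul, abs_of_nonneg (by linarith)]
              exact mul_le_of_le_one_left (abs_nonneg x) (by linarith)
            have h6 : |(n + 1 - t) * x| ≤ |x| := by
              rw [abs_mul, abs_of_nonneg (by linarith)]
              exact mul_le_of_le_one_left (abs_nonneg x) (by linarith)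
            have h7 : |n * u| ≤ t * |u| := by
              rw [abs_mul, abs_of_pos hn0]
              gcongr
            have h8 : |(n + 1) * v| ≤ 2 * t * |v| := by
              rw [abs_mul, abs_of_pos (by linarith)]
              gcongr
              linarith
            have h9 := abs_nonneg v
            have h10 := abs_nonneg u
            have h11 : 0 ≤ t * |v| := by positivity
            have h12 : 0 ≤ t * |u| := by positivity
            rw [abs_le] at h5 h6 h7 h8
            refine abs_le.2 ⟨?_, ?_⟩ <;> linarith
          simp only [Real.enorm_eq_ofReal_abs]
          rw [show (2 : ℝ≥0∞) = ENNReal.ofReal 2 by simp, ← ENNReal.ofReal_mul (by norm_num),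
            ← ENNReal.ofReal_add (by positivity) h3, ← ENNReal.ofReal_mul (by positivity),
            ← ENNReal.ofReal_add (by positivity) (by positivity),
            ← ENNReal.ofReal_add (by positivity) (by positivity)]
          exact ENNReal.ofReal_le_ofReal hreal
      _ = e n + 2 * e (n + 1) + ENNReal.ofReal (1 / t) * K := by
          have hm : ∀ n : ℕ, Measurable fun ω => ‖logSolution ξ κ γ n ω / n - l ω‖ₑ := fun n =>
            (((hLm n).div_const _).sub hlm).enorm
          have hm' : Measurable fun ω => ‖logSolution ξ κ γ n ω / n - l ω‖ₑ
              + 2 * ‖logSolution ξ κ γ (n + 1 : ℕ) ω / (n + 1 : ℕ) - l ω‖ₑ :=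
            (hm n).add ((hm (n + 1)).const_mul 2)
          rw [lintegral_add_left hm', lintegral_add_left (hm n), lintegral_const_mul _ (hm (n + 1)),
            lintegral_const_mul' _ _ ENNReal.ofReal_ne_top, lintegral_add_left hlm.enorm,
            hξ.lintegral_restCost]
  have hfloor : Tendsto (fun t : ℝ => ⌊t⌋₊) atTop atTop := tendsto_nat_floor_atTop
  have h1 := hl.comp hfloor
  have h2 := ENNReal.Tendsto.const_mul (a := 2)
    (((tendsto_add_atTop_iff_nat (f := e) 1).2 hl).comp hfloor) (.inr (by norm_num))
  have h3 : Tendsto (fun t : ℝ => ENNReal.ofReal (1 / t) * K) atTop (𝓝 0) := by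
    have h4 := ENNReal.Tendsto.mul_const (b := K) (ENNReal.tendsto_ofReal
      (tendsto_inv_atTop_zero (𝕜 := ℝ))) (.inr hKfin)
    simpa using h4
  have h5 := (h1.add h2).add h3
  simp only [mul_zero, add_zero] at h5
  refine tendsto_of_tendsto_of_tendsto_of_le_of_le' tendsto_const_nhds h5
    (Eventually.of_forall fun _ => zero_le) ?_
  filter_upwards [eventually_ge_atTop 1] with t ht
  exact key t ht

end Limit

/-! ### Invariance of the growth rate under translations -/

theorem tendsto_div_of_tendsto_div {x v : ℕ → ℝ} {l : ℝ}
    (h : Tendsto (fun n => x n / v n) atTop (𝓝 l))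
    (hv : Tendsto (fun n => v n / n) atTop (𝓝 1)) :
    Tendsto (fun n => x n / n) atTop (𝓝 l) := by
  have h1 := h.mul hv
  rw [mul_one] at h1
  refine h1.congr' ?_
  filter_upwards [hv.eventually_ne one_ne_zero] with n hn
  have : v n ≠ 0 := fun h0 => hn (by rw [h0, zero_div])
  rw [div_mul_div_cancel₀ this]

theorem tendsto_add_const_div (c : ℝ) : Tendsto (fun n : ℕ => ((n : ℝ) + c) / n) atTop (𝓝 1) := by
  have h := (tendsto_const_div_atTop_nhds_zero_nat c).const_add 1
  rw [add_zero] at h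
  refine h.congr' ?_
  filter_upwards [eventually_gt_atTop 0] with n hn
  have : (n : ℝ) ≠ 0 := by positivity
  field_simp

section Step

variable {Ω : Type*} [MeasurableSpace Ω] {d : ℕ} [NeZero d] {P : Measure Ω}
  {ξ : Lattice d → ℝ≥0 → Ω → ℝ} {κ γ : ℝ}

/-- The walk may make a single step in unit time: a lower bound for the solution at a neighbour of
the initial site. -/
theorem mul_le_fundamental_step (hξ : IsStationaryField P ξ) {ω : Ω}
    (hω : IsLocallyIntegrable ξ ω) (hκ : 0 ≤ κ) (hγ : 0 ≤ γ) (x : Lattice d) (a : Fin d × Bool) :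
    walkLaw d (singleJump a (2 * d * κ)) * ENNReal.ofReal (Real.exp
      (-(γ * (unitMass ξ x ω + unitMass ξ (x + step a) ω))))
      ≤ fundamental ξ κ γ x (x + step a) 1 ω := by
  have h := mul_le_feynmanKac_step hκ (hξ.measurable_potential' γ 1 ω) (hω.potential γ 1) x a
  simp only [integral_potential, abs_mul, abs_of_nonneg hγ, intervalIntegral.integral_const_mul,
    ← mul_add] at h
  exact h

theorem fundamental_step_pos (hξ : IsStationaryField P ξ) {ω : Ω}
    (hω : IsLocallyIntegrable ξ ω) (hκ : 0 < κ) (hγ : 0 ≤ γ) (a : Fin d × Bool) :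
    0 < fundamental ξ κ γ (step a) 0 1 ω := by
  have h := mul_le_fundamental_step hξ hω hκ.le hγ (step a) (a.1, !a.2)
  have h0 : step a + step (a.1, !a.2) = 0 := by
    obtain ⟨i, b⟩ := a
    cases b <;> simp [step, ← Pi.single_add]
  rw [h0] at h
  have hd : (0 : ℝ) < d := by exact_mod_cast Nat.pos_of_neZero d
  refine lt_of_lt_of_le ?_ h
  exact ENNReal.mul_pos (walkLaw_singleJump_pos _ (by positivity)).ne'
    (ENNReal.ofReal_pos.2 (Real.exp_pos _)).ne'

/-- The strategy that compares the environment with its translate by `(e, 1)`, where `e = step a`.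
On `[0, n + 2]` the path goes from `0` to `e` in unit time, follows a loop at `e` of length `n`,
and returns to `0` in unit time. The return meets the environment in the time interval `[0, 1]`,
hence costs a constant; the first step meets it in `[n + 1, n + 2]`. -/
theorem logSolution_step_le (hξ : IsStationaryField P ξ) {ω : Ω}
    (hω : ∀ n : ℕ, IsLocallyIntegrable (shiftField (0, (n : ℝ≥0)) ξ) ω) (hκ : 0 < κ) (hγ : 0 ≤ γ)
    (hfin : ∀ t : ℝ, 0 ≤ t → fundamental ξ κ γ 0 0 t ω < ∞) (a : Fin d × Bool) (n : ℕ) :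
    logSolution (shiftField (step a, 1) ξ) κ γ n ω
      + (Real.log (walkLaw d (singleJump a (2 * d * κ))).toReal
        + Real.log (fundamental ξ κ γ (step a) 0 1 ω).toReal)
      - γ * (unitMass (shiftField (0, ((n + 1 : ℕ) : ℝ≥0)) ξ) 0 ω
        + unitMass (shiftField (0, ((n + 1 : ℕ) : ℝ≥0)) ξ) (step a) ω)
      ≤ logSolution ξ κ γ (n + 2) ω := by
  have hω0 := hω 0
  rw [Nat.cast_zero, Prod.mk_zero_zero, shiftField_zero] at hω0
  have hd : (0 : ℝ) < d := by exact_mod_cast Nat.pos_of_neZero d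
  have hA := mul_le_fundamental_step (hξ.shiftField (0, ((n + 1 : ℕ) : ℝ≥0)))
    (hω (n + 1)) hκ.le hγ 0 a
  rw [zero_add] at hA
  have h1 := fundamental_mul_le hξ hω0 hκ.le γ 0 (step a) 0 1 ((n + 1 : ℕ) : ℝ≥0)
  have h2 := fundamental_mul_le hξ hω0 hκ.le γ (step a) (step a) 0 n 1
  have h3 := fundamental_shiftField_space (ξ := shiftField (0, 1) ξ) κ γ 0 0 (step a) n ω
  rw [shiftField_shiftField, Prod.mk_add_mk, add_zero, zero_add, zero_add] at h3
  have e1 : ((1 + ((n + 1 : ℕ) : ℝ≥0) : ℝ≥0) : ℝ) = n + 2 := by push_cast; ring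
  have e2 : (((n : ℝ≥0) + 1 : ℝ≥0) : ℝ) = ((n + 1 : ℕ) : ℝ≥0) := by push_cast; ring
  rw [e1] at h1
  rw [e2, NNReal.coe_natCast, NNReal.coe_one, ← h3] at h2
  rw [NNReal.coe_one] at h1
  set p := walkLaw d (singleJump a (2 * d * κ)) with hp
  have hp0 : 0 < p := walkLaw_singleJump_pos a (by positivity)
  have hpt : p ≠ ∞ := measure_ne_top _ _
  set m := γ * (unitMass (shiftField (0, ((n + 1 : ℕ) : ℝ≥0)) ξ) 0 ω
    + unitMass (shiftField (0, ((n + 1 : ℕ) : ℝ≥0)) ξ) (step a) ω) with hm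
  have hB := fundamental_self_pos (ξ := shiftField (step a, 1) ξ) hκ.le γ 0 n.cast_nonneg ω
  have hC := fundamental_step_pos hξ hω0 hκ hγ a
  have hexp : 0 < ENNReal.ofReal (Real.exp (-m)) := ENNReal.ofReal_pos.2 (Real.exp_pos _)
  have hpe : 0 < p * ENNReal.ofReal (Real.exp (-m)) := ENNReal.mul_pos hp0.ne' hexp.ne'
  have hBC := ENNReal.mul_pos hB.ne' hC.ne'
  have h4 := (mul_le_mul' hA h2).trans h1
  have hfin2 := hfin (n + 2) (by positivity)
  have h5 := log_toReal_add_le hpe hBC hfin2 h4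
  have h6 := log_toReal_add_le hB hC (lt_top_of_mul_le hpe hfin2 h4) le_rfl
  have h7 := log_toReal_add_le hp0 hexp (by finiteness) le_rfl
  rw [ENNReal.toReal_ofReal (Real.exp_pos _).le, Real.log_exp] at h7
  unfold logSolution
  linarith

end Step

section Invariance

variable {Ω : Type*} [MeasurableSpace Ω] {d : ℕ} {P : Measure Ω}
  {ξ : Lattice d → ℝ≥0 → Ω → ℝ} {κ γ : ℝ}

theorem IsStationaryField.comp_shift_ae_eq (hξ : IsStationaryField P ξ)
    {Λ : (SpaceTime d → ℝ) → ℝ} (hΛm : Measurable Λ) (hΛi : Integrable Λ (fieldLaw P ξ))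
    (z : SpaceTime d) (h : ∀ᵐ ω ∂P, Λ (path ξ z ω) ≤ Λ (path ξ 0 ω)) :
    (fun f => Λ (shift z f)) =ᵐ[fieldLaw P ξ] Λ := by
  refine ae_eq_comp_of_ae_le (hξ.measurePreserving_shift z) hΛi
    (hξ.ae_fieldLaw (measurableSet_le (hΛm.comp (measurable_shift z)) hΛm) ?_)
  filter_upwards [h] with ω hω
  rwa [shift_path, add_zero]

variable [NeZero d] [IsProbabilityMeasure P]

/-- Divide `log u(0, n + s) ≥ log u_s(0, n) + log u(0, s)` by `n`, where `u_s` lives in the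
environment shifted by time `s`. -/
theorem IsStationaryField.limit_time_le (hξ : IsStationaryField P ξ) (hκ : 0 ≤ κ) (hγ : 0 ≤ γ)
    (hfin : ∀ᵐ ω ∂P, ∀ n : ℕ, fundamental ξ κ γ 0 0 n ω < ∞)
    {Λ : (SpaceTime d → ℝ) → ℝ}
    (hΛ : ∀ z, ∀ᵐ ω ∂P, Tendsto (fun n : ℕ => logSolution (PAM.shiftField z ξ) κ γ n ω / n) atTop
        (𝓝 (Λ (path ξ z ω)))) (s : ℝ≥0) :
    ∀ᵐ ω ∂P, Λ (path ξ (0, s) ω) ≤ Λ (path ξ 0 ω) := by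
  have hfin' := hξ.ae_fundamental_lt_top hκ hfin 0
  have h0 := hΛ 0
  rw [shiftField_zero] at hfin' h0
  filter_upwards [hfin', hξ.ae_intervalIntegrable, hΛ (0, s),
    hξ.tendsto_logSolution hκ hγ hfin h0] with ω h1 h2 h3 h4
  have h5 : Tendsto (fun n : ℕ => logSolution ξ κ γ (n + s) ω / n) atTop
      (𝓝 (Λ (path ξ 0 ω))) := by
    refine tendsto_div_of_tendsto_div (v := fun n => (n : ℝ) + s) ?_ (tendsto_add_const_div s)
    -- The times `n + s` are not integers, so the limit along real times is needed.
    have h6 : Tendsto (fun n : ℕ => (n : ℝ) + s) atTop atTop :=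
      tendsto_atTop_add_const_right _ _ tendsto_natCast_atTop_atTop
    refine (h4.comp h6).congr fun n => ?_
    simp only [Function.comp_apply, one_div_mul_eq_div]
  have h7 := h3.add (tendsto_const_div_atTop_nhds_zero_nat (logSolution ξ κ γ s ω))
  rw [add_zero] at h7
  refine le_of_tendsto_of_tendsto' h7 h5 fun n => ?_
  rw [← add_div]
  have h8 := logSolution_add_le hξ h2 hκ h1 n s
  push_cast at h8
  gcongr

theorem IsStationaryField.limit_step_le (hξ : IsStationaryField P ξ) (hκ : 0 < κ) (hγ : 0 ≤ γ)
    (hfin : ∀ᵐ ω ∂P, ∀ n : ℕ, fundamental ξ κ γ 0 0 n ω < ∞)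
    {Λ : (SpaceTime d → ℝ) → ℝ}
    (hΛ : ∀ z, ∀ᵐ ω ∂P, Tendsto (fun n : ℕ => logSolution (PAM.shiftField z ξ) κ γ n ω / n) atTop
        (𝓝 (Λ (path ξ z ω)))) (a : Fin d × Bool) :
    ∀ᵐ ω ∂P, Λ (path ξ (step a, 1) ω) ≤ Λ (path ξ 0 ω) := by
  have hfin' := hξ.ae_fundamental_lt_top hκ.le hfin 0
  have h0 := hΛ 0
  rw [shiftField_zero] at hfin' h0
  filter_upwards [hfin',
    ae_all_iff.2 fun n : ℕ => (hξ.shiftField (0, (n : ℝ≥0))).ae_intervalIntegrable,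
    hΛ (step a, 1), h0,
    hξ.tendsto_unitMass_div 0, hξ.tendsto_unitMass_div (step a)] with ω h1 h2 h3 h4 h5 h6
  have hshift : ∀ {x : ℕ → ℝ} {l : ℝ} (k : ℕ), Tendsto (fun n => x n / n) atTop (𝓝 l) →
      Tendsto (fun n => x (n + k) / n) atTop (𝓝 l) := fun {x l} k h =>
    tendsto_div_of_tendsto_div (v := fun n => ((n + k : ℕ) : ℝ))
      ((tendsto_add_atTop_iff_nat (f := fun n => x n / n) k).2 h)
      (by simpa using tendsto_add_const_div k)
  have h7 := hshift 2 h4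
  have h8 := (h3.add (tendsto_const_div_atTop_nhds_zero_nat
    (Real.log (walkLaw d (singleJump a (2 * d * κ))).toReal
      + Real.log (fundamental ξ κ γ (step a) 0 1 ω).toReal))).sub
    (((hshift 1 h5).add (hshift 1 h6)).const_mul γ)
  simp only [add_zero, mul_zero, sub_zero] at h8
  refine le_of_tendsto_of_tendsto' h8 h7 fun n => ?_
  have h9 := logSolution_step_le hξ h2 hκ hγ h1 a n
  rw [← add_div, ← add_div, ← mul_div_assoc, ← sub_div]
  push_cast at h9 ⊢
  gcongr

end Invariance

/-- The translations that leave a functional `Λ` invariant form a monoid; if it contains the time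
translations and a translation over each unit vector, it contains all translations. -/
theorem comp_shift_ae_eq_of_step {d : ℕ} {μ : Measure (SpaceTime d → ℝ)} (hμ : IsStationary μ)
    {Λ : (SpaceTime d → ℝ) → ℝ}
    (htime : ∀ s : ℝ≥0, (fun f => Λ (shift (0, s) f)) =ᵐ[μ] Λ)
    (hstep : ∀ a : Fin d × Bool, (fun f => Λ (shift (step a, 1) f)) =ᵐ[μ] Λ) (z : SpaceTime d) :
    (fun f => Λ (shift z f)) =ᵐ[μ] Λ := by
  have hq : ∀ z : SpaceTime d, Measure.QuasiMeasurePreserving (shift z) μ μ := fun z =>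
    (MeasurePreserving.mk (measurable_shift z) (hμ z)).quasiMeasurePreserving
  have hadd : ∀ z z' : SpaceTime d, (fun f => Λ (shift z f)) =ᵐ[μ] Λ →
      (fun f => Λ (shift (z + z') f)) =ᵐ[μ] fun f => Λ (shift z' f) := by
    intro z z' hz
    filter_upwards [(hq z').ae hz] with f hf
    rw [← shift_shift, hf]
  let M : AddSubmonoid (Lattice d) :=
    { carrier := {y | (fun f => Λ (shift (y, 0) f)) =ᵐ[μ] Λ}
      zero_mem' := htime 0
      add_mem' := fun {y y'} hy hy' => by
        have h := (hadd (y, 0) (y', 0) hy).trans hy'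
        rwa [Prod.mk_add_mk, add_zero] at h }
  have hM : ∀ a : Fin d × Bool, step a ∈ M := by
    intro a
    have h := hadd (0, 1) (step a, 0) (htime 1)
    rw [Prod.mk_add_mk, add_zero, zero_add] at h
    exact h.symm.trans (hstep a)
  have hsingle : ∀ (i : Fin d) (k : ℤ), Pi.single i k ∈ M := by
    intro i k
    obtain ⟨n, rfl | rfl⟩ := k.eq_nat_or_neg
    · have h := M.nsmul_mem (hM (i, true)) n
      rwa [step, ← Pi.single_smul, if_pos rfl, nsmul_one] at h
    · have h := M.nsmul_mem (hM (i, false)) n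
      rwa [step, ← Pi.single_smul, if_neg (by simp), nsmul_eq_mul, mul_neg_one] at h
  have hz : z.1 ∈ M := by
    rw [← Finset.univ_sum_single z.1]
    exact M.sum_mem fun i _ => hsingle i _
  have h := (hadd (z.1, 0) (0, z.2) hz).trans (htime z.2)
  rwa [Prod.mk_add_mk, add_zero, zero_add] at h

theorem IsErgodicUnder.ae_eq_const {d : ℕ} {S : Set (SpaceTime d)}
    {μ : Measure (SpaceTime d → ℝ)} [IsProbabilityMeasure μ] (hS : IsErgodicUnder S μ)
    {Λ : (SpaceTime d → ℝ) → ℝ} (hΛ : Measurable Λ)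
    (h : ∀ z ∈ S, (fun f => Λ (shift z f)) =ᵐ[μ] Λ) : ∃ c, ∀ᵐ f ∂μ, Λ f = c := by
  refine Filter.exists_eventuallyEq_const_of_forall_separating MeasurableSet fun U hU => ?_
  have hm : MeasurableSet (Λ ⁻¹' U) := hΛ hU
  have hinv : ∀ z ∈ S, shift z ⁻¹' (Λ ⁻¹' U) =ᵐ[μ] Λ ⁻¹' U := by
    intro z hz
    filter_upwards [h z hz] with f hf
    exact congrArg (· ∈ U) hf
  rcases hS (Λ ⁻¹' U) hm hinv with h0 | h1
  · exact .inr (measure_eq_zero_iff_ae_notMem.1 h0)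
  · exact .inl ((mem_ae_iff_prob_eq_one hm).2 h1)

end PAM

theorem theorem1 {Ω : Type*} [MeasurableSpace Ω] (P : Measure Ω) [IsProbabilityMeasure P]
    (d : ℕ) [NeZero d] (ξ : PAM.Lattice d → ℝ≥0 → Ω → ℝ)
    (hξ : PAM.IsEnvironment P ξ) (hgrowth : PAM.GrowthBound P ξ)
    (κ γ : ℝ) (hκ : 0 ≤ κ) (hγ : 0 < γ) :
    (∀ᵐ ω ∂P, ∀ t : ℝ, 0 ≤ t →
      0 < PAM.solution ξ κ γ 0 t ω ∧ PAM.solution ξ κ γ 0 t ω < ∞) ∧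
    ∃ lam : Ω → ℝ, Integrable lam P ∧
      (∀ᵐ ω ∂P, Tendsto (fun t : ℝ => PAM.growthRate ξ κ γ t ω) atTop (𝓝 (lam ω))) ∧
      Tendsto (fun t : ℝ => eLpNorm (fun ω => PAM.growthRate ξ κ γ t ω - lam ω) 1 P)
        atTop (𝓝 0) ∧
      (0 < κ ∨ PAM.IsErgodicUnder (PAM.timeTranslations d) (PAM.fieldLaw P ξ) →
        ∃ lam₀ : ℝ, ∀ᵐ ω ∂P, lam ω = lam₀) := by
  have hs := hξ.isStationaryField
  have hprob := hs.isProbabilityMeasure_fieldLaw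
  obtain ⟨c, hc⟩ := hgrowth κ γ hκ hγ.le
  obtain ⟨hfin, C, hC⟩ := PAM.growth_of_expectation_le hs hκ hγ.le hc
  obtain ⟨Λ, hΛm, hΛi, hΛ, hΛ1⟩ := hs.exists_limit hκ hγ.le hfin hC
  have hfin' := hs.ae_fundamental_lt_top hκ hfin 0
  have h0 := hΛ 0
  rw [PAM.shiftField_zero] at hfin' h0
  have hmp : MeasurePreserving (PAM.path ξ 0) P (PAM.fieldLaw P ξ) :=
    ⟨hs.measurable_path 0, hs.map_path 0⟩
  have hli : Integrable (fun ω => Λ (PAM.path ξ 0 ω)) P := hmp.integrable_comp_of_integrable hΛi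
  have hrate : ∀ t ω, PAM.growthRate ξ κ γ t ω = 1 / t * PAM.logSolution ξ κ γ t ω := by
    intro t ω
    rw [PAM.growthRate, PAM.solution_eq_fundamental, PAM.logSolution]
  refine ⟨?_, fun ω => Λ (PAM.path ξ 0 ω), hli, ?_, ?_, fun h => ?_⟩
  · filter_upwards [hfin'] with ω hω t ht
    rw [PAM.solution_eq_fundamental]
    exact ⟨PAM.fundamental_self_pos hκ γ 0 ht ω, hω t ht⟩
  · simp only [hrate]
    exact hs.tendsto_logSolution hκ hγ.le hfin h0
  · simp only [hrate, eLpNorm_one_eq_lintegral_enorm]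
    exact hs.tendsto_lintegral_logSolution hκ hγ.le hfin (hΛm.comp hmp.measurable) hli hΛ1
  · have htime : ∀ s : ℝ≥0, (fun f => Λ (PAM.shift (0, s) f)) =ᵐ[PAM.fieldLaw P ξ] Λ := fun s =>
      hs.comp_shift_ae_eq hΛm hΛi _ (hs.limit_time_le hκ hγ.le hfin hΛ s)
    have hconst : ∃ c, ∀ᵐ f ∂PAM.fieldLaw P ξ, Λ f = c := by
      rcases h with hκ' | herg
      · refine hξ.ergodic.ae_eq_const hΛm fun z _ => ?_
        exact PAM.comp_shift_ae_eq_of_step hξ.stationary htime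
          (fun a => hs.comp_shift_ae_eq hΛm hΛi _ (hs.limit_step_le hκ' hγ.le hfin hΛ a)) z
      · refine herg.ae_eq_const hΛm ?_
        rintro ⟨y, s⟩ rfl
        exact htime s
    obtain ⟨c, hc⟩ := hconst
    exact ⟨c, hs.ae_path hc 0⟩
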